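/- **Theorem.** *Problem.* For real weights $w(q,j)$, $w'(p,i)$, $s_{ij}$, each of which can be evaluated in $O(1)$ time without memory access, the GAP recurrence on the table $0\le i\le m$, $0\le j\le n$ is $D[0,0]=0$ and, for $(i,j)\ne(0,0)$, $$D[i,j]=\min\Big\{D[i-1,j-1]+s_{ij}\ (\text{if } i,j\ge 1),\ \min_{0\le q<j}\big(D[i,q]+w(q,j)\big),\ \min_{0\le p<i}\big(D[p,j]+w'(p,i)\big)\Big\},$$ where $m$ and $n$ are of the same order of magnitude. *Model.* A Nested Dataflow (ND) program is a finite system of recursive procedures whose bodies compose strands (sequences of assignments with right-hand sides over $\min$, $+$, $0$, $+\infty$, memory words and weights) by $a\parallel b$ (no dependency), $a\,;b$ (every strand of $b$ depends on every strand of $a$) and fire constructs $a\rightsquigarrow_f b$ (partial dependency, refined recursively by a fixed finite set of fire rules until source and sink are strands). It unfolds to a DAG of strands. Work is the total number of operations, time is the largest number of operations along a directed path, space is the number of memory words used, and the number of cache misses is that of the serial (depth-first, left-to-right) execution in the ideal cache model with cache size $M$ and line size $B$, under the tall-cache assumption $M=\Omega(B^2)$. The program does not know $M$ and $B$. *Claim.*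 There is an ND program for the GAP recurrence, obtained from the cache-oblivious parallel (COP) algorithm of Chowdhury and Ramachandran (in-place, on a row-major table padded to a side that is a power of two) by replacing some of the constructs "$;$" by fire constructs, such that for all $m,n$ and all weights every schedule that respects the DAG computes the table $D$ from arbitrary initial memory contents, any two strands one of which writes a word that the other accesses are ordered by the DAG, and for $n\ge 2$, $m=\Theta(n)$: 1. the time is $O(n\log n)$; 2. the work is $O(n^3)$; 3. the space is $O(n^2)$; 4. the number of cache misses is $O\big(n^3/(B\sqrt M)\big)$ if $n^2\ge M$, and $O(n^2/B+1)$ if $n^2<M$. The work and space bounds are optimal: every serial straight-line program of such assignments that solves the GAP recurrence for all weights has work $\Omega(n^3)$ and uses $\Omega(n^2)$ memory words. The time of the COP algorithm itself is $O(n^{\log_2 3})$. All constants depend only on the constants in $m=\Theta(n)$ and $M=\Omega(B^2)$. -/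

import Mathlib

namespace GapND

/-! ## The GAP recurrence -/

/-- The data of a GAP instance: `w q j` (horizontal gap), `w' p i` (vertical gap), `s i j`. -/
structure Weights where
  w : ℕ → ℕ → ℝ
  w' : ℕ → ℕ → ℝ
  s : ℕ → ℕ → ℝ

/-- The values over which the GAP recurrence minimizes at the cell `(i, j)`; the diagonal
term is present only where `(i - 1, j - 1)` is a cell of the table. -/
def gapCandidates (W : Weights) (D : ℕ → ℕ → ℝ) (i j : ℕ) : Set ℝ :=
  {x | 1 ≤ i ∧ 1 ≤ j ∧ x = D (i - 1) (j - 1) + W.s i j} ∪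
  {x | ∃ q, q < j ∧ x = D i q + W.w q j} ∪
  {x | ∃ p, p < i ∧ x = D p j + W.w' p i}

/-- `D` satisfies the GAP recurrence on the table `0 ≤ i ≤ m`, `0 ≤ j ≤ n`. -/
def IsGapSolution (m n : ℕ) (W : Weights) (D : ℕ → ℕ → ℝ) : Prop :=
  D 0 0 = 0 ∧
    ∀ i j, i ≤ m → j ≤ n → (i, j) ≠ (0, 0) → IsLeast (gapCandidates W D i j) (D i j)

/-! ## Straight-line computation over `(min, +)` on a word-addressed memory

The expressions are polymorphic in the type `ι` of indices: `ι = ℕ` for executable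
instructions, `ι = Idx` for the text of a program. -/

/-- Right-hand sides: memory reads, evaluations of the weights (no memory access),
the constants `0` and `+∞`, additions, and minima. -/
inductive Val (ι : Type) : Type where
  | cell (a : ι)
  | w (q j : ι)
  | w' (p i : ι)
  | s (i j : ι)
  | zero
  | top
  | add (x y : Val ι)
  | min (x y : Val ι)

/-- The assignment `memory[dst] := val`. -/
structure Assign (ι : Type) where
  dst : ι
  val : Val ι

namespace Val

def map {ι κ : Type} (f : ι → κ) : Val ι → Val κ
  | cell a => cell (f a)
  | w q j => w (f q) (f j)
  | w' p i => w' (f p) (f i)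
  | s i j => s (f i) (f j)
  | zero => zero
  | top => top
  | add x y => add (x.map f) (y.map f)
  | min x y => min (x.map f) (y.map f)

/-- Number of unit-time operations: reads, weight evaluations, constants, `+`, `min`. -/
def cost {ι : Type} : Val ι → ℕ
  | add x y => x.cost + y.cost + 1
  | min x y => x.cost + y.cost + 1
  | _ => 1

/-- The addresses read, from left to right. -/
def reads : Val ℕ → List ℕ
  | cell a => [a]
  | add x y => x.reads ++ y.reads
  | min x y => x.reads ++ y.reads
  | _ => []

end Val

/-- Memory contents. -/
abbrev Mem : Type := ℕ → WithTop ℝ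

noncomputable section

def Val.eval (W : Weights) (μ : Mem) : Val ℕ → WithTop ℝ
  | .cell a => μ a
  | .w q j => (W.w q j : ℝ)
  | .w' p i => (W.w' p i : ℝ)
  | .s i j => (W.s i j : ℝ)
  | .zero => 0
  | .top => ⊤
  | .add x y => x.eval W μ + y.eval W μ
  | .min x y => Min.min (x.eval W μ) (y.eval W μ)

def Assign.exec (W : Weights) (μ : Mem) (A : Assign ℕ) : Mem :=
  Function.update μ A.dst (A.val.eval W μ)

/-- Execution of a sequence of assignments, one after the other. -/
def execList (W : Weights) (μ : Mem) (L : List (Assign ℕ)) : Mem :=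
  L.foldl (Assign.exec W) μ

end

def Assign.map {ι κ : Type} (f : ι → κ) (A : Assign ι) : Assign κ :=
  ⟨f A.dst, A.val.map f⟩

/-- One unit for the write, plus the operations of the right-hand side. -/
def Assign.cost {ι : Type} (A : Assign ι) : ℕ := A.val.cost + 1

/-- The addresses accessed, in order: the reads, then the write. -/
def Assign.trace (A : Assign ℕ) : List ℕ := A.val.reads ++ [A.dst]

/-- Work of a serial straight-line program. -/
def workList (L : List (Assign ℕ)) : ℕ := (L.map Assign.cost).sum

/-- Memory access sequence of a serial straight-line program. -/
def traceList (L : List (Assign ℕ)) : List ℕ := L.flatMap Assign.trace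

/-- The memory words used by a straight-line program. -/
def footprint (L : List (Assign ℕ)) : Finset ℕ := (traceList L).toFinset

/-- `μ` holds at the addresses `out i j` a solution of the GAP recurrence. -/
def HoldsGapSolution (m n : ℕ) (W : Weights) (out : ℕ → ℕ → ℕ) (μ : Mem) : Prop :=
  ∃ D : ℕ → ℕ → ℝ, IsGapSolution m n W D ∧
    ∀ i j, i ≤ m → j ≤ n → μ (out i j) = ((D i j : ℝ) : WithTop ℝ)

/-- The serial straight-line program `L` solves all GAP instances of dimensions `m`, `n`,
whatever the initial contents of the memory; the table is delivered at the addresses `out`. -/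
def SeriallySolves (m n : ℕ) (out : ℕ → ℕ → ℕ) (L : List (Assign ℕ)) : Prop :=
  ∀ (W : Weights) (μ : Mem), HoldsGapSolution m n W out (execList W μ L)

/-! ## The ideal cache -/

/-- `CacheRun Z S l q`: started with the set `S` of lines in a fully associative cache of `Z`
lines, the sequence `l` of line accesses can be served with exactly `q` misses. On a miss the
line is brought in and any lines may be evicted. -/
inductive CacheRun (Z : ℕ) : Finset ℕ → List ℕ → ℕ → Prop
  | nil (S : Finset ℕ) : CacheRun Z S [] 0
  | hit {S : Finset ℕ} {x : ℕ} {l : List ℕ} {q : ℕ} (hx : x ∈ S) (h : CacheRun Z S l q) :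
      CacheRun Z S (x :: l) q
  | miss {S S' : Finset ℕ} {x : ℕ} {l : List ℕ} {q : ℕ} (hx : x ∉ S) (hS : S' ⊆ insert x S)
      (hx' : x ∈ S') (hZ : S'.card ≤ Z) (h : CacheRun Z S' l q) : CacheRun Z S (x :: l) (q + 1)

/-- Under optimal replacement, the serial program `L` incurs at most `b` misses on an initially
empty cache of `M` words with lines of `B` words. -/
def CacheMissesLE (M B : ℕ) (L : List (Assign ℕ)) (b : ℝ) : Prop :=
  ∃ q : ℕ, CacheRun (M / B) ∅ ((traceList L).map (fun a => a / B)) q ∧ (q : ℝ) ≤ b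

/-! ## Nested Dataflow: spawn trees and fire rules -/

/-- The constructs that compose two tasks; `φ` is the type of fire constructs. -/
inductive Comp (φ : Type) : Type where
  | ser
  | par
  | fire (f : φ)

/-- A spawn tree. A leaf is a strand: a sequence of assignments with no parallel construct. -/
inductive Tree (φ : Type) : Type where
  | leaf (L : List (Assign ℕ))
  | node (c : Comp φ) (a b : Tree φ)

/-- One clause of a fire rule: the subtask of the source at `src` is related to the subtask of
the sink at `snk` by a full dependency (`none`) or again by a fire construct. In a path,
`false` is the first and `true` is the second component of a composition. -/
structure FireClause (φ : Type) where
  src : List Bool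
  snk : List Bool
  dep : Option φ

/-- A finite list of clauses for each fire construct. -/
abbrev FireRules (φ : Type) : Type := φ → List (FireClause φ)

namespace Tree

variable {φ : Type}

/-- The subtask reached by a path; a path that goes on below a strand stays at the strand. -/
def sub : Tree φ → List Bool → Tree φ
  | leaf L, _ => leaf L
  | node c a b, [] => node c a b
  | node _ a _, false :: p => a.sub p
  | node _ _ b, true :: p => b.sub p

/-- The part of the path that is used to reach `t.sub p`. -/
def trunc : Tree φ → List Bool → List Bool
  | leaf _, _ => []
  | node _ _ _, [] => []
  | node _ a _, false :: p => false :: a.trunc p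
  | node _ _ b, true :: p => true :: b.trunc p

/-- The positions of the strands, in serial (depth-first, left to right) order. -/
def strands : Tree φ → List (List Bool)
  | leaf _ => [[]]
  | node _ a b => a.strands.map (List.cons false) ++ b.strands.map (List.cons true)

/-- The code of the strand at (or above) a position. -/
def code (t : Tree φ) (p : List Bool) : List (Assign ℕ) :=
  match t.sub p with
  | leaf L => L
  | node _ _ _ => []

/-- The serial elision: all the code in depth-first, left to right order. -/
def serial : Tree φ → List (Assign ℕ)
  | leaf L => L
  | node _ a b => a.serial ++ b.serial

end Tree

/-- Refinement of a dependency from the task `a` to the task `b` to dependencies between their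
strands. A full dependency relates all strands of `a` to all strands of `b`. A fire construct
is refined by the clauses of its rule until source and sink are both strands, where it is a
full dependency. -/
inductive Refines {φ : Type} (R : FireRules φ) :
    Option φ → Tree φ → Tree φ → List Bool → List Bool → Prop
  | full {a b : Tree φ} {x y : List Bool} (hx : x ∈ a.strands) (hy : y ∈ b.strands) :
      Refines R none a b x y
  | base (f : φ) (L L' : List (Assign ℕ)) :
      Refines R (some f) (Tree.leaf L) (Tree.leaf L') [] []
  | step {f : φ} {a b : Tree φ} {r : FireClause φ} {x y : List Bool} (hr : r ∈ R f)
      (h : Refines R r.dep (a.sub r.src) (b.sub r.snk) x y) :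
      Refines R (some f) a b (a.trunc r.src ++ x) (b.trunc r.snk ++ y)

/-- The edges of the computation DAG of a spawn tree; its vertices are the strands. -/
inductive Edge {φ : Type} (R : FireRules φ) : Tree φ → List Bool → List Bool → Prop
  | ser {a b : Tree φ} {x y : List Bool} (h : Refines R none a b x y) :
      Edge R (Tree.node Comp.ser a b) (false :: x) (true :: y)
  | fire {f : φ} {a b : Tree φ} {x y : List Bool} (h : Refines R (some f) a b x y) :
      Edge R (Tree.node (Comp.fire f) a b) (false :: x) (true :: y)
  | left {c : Comp φ} {a b : Tree φ} {x y : List Bool} (h : Edge R a x y) :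
      Edge R (Tree.node c a b) (false :: x) (false :: y)
  | right {c : Comp φ} {a b : Tree φ} {x y : List Bool} (h : Edge R b x y) :
      Edge R (Tree.node c a b) (true :: x) (true :: y)

namespace Tree

variable {φ : Type}

/-- Cost of a vertex: one unit, plus the operations of the strand. -/
def strandCost (t : Tree φ) (p : List Bool) : ℕ := workList (t.code p) + 1

/-- Work: the sum of the costs of all vertices. -/
def work (t : Tree φ) : ℕ := (t.strands.map t.strandCost).sum

/-- Space: the number of memory words used. -/
def space (t : Tree φ) : ℕ := (footprint t.serial).card

/-- Time (span, critical path length) at most `b`: no directed path of the DAG has larger cost. -/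
def TimeLE (R : FireRules φ) (t : Tree φ) (b : ℝ) : Prop :=
  ∀ l : List (List Bool), (∀ x ∈ l, x ∈ t.strands) → l.IsChain (Edge R t) →
    (((l.map t.strandCost).sum : ℕ) : ℝ) ≤ b

/-- A schedule: an order of all strands that respects the DAG. -/
def IsSchedule (R : FireRules φ) (t : Tree φ) (σ : List (List Bool)) : Prop :=
  σ.Perm t.strands ∧ σ.Pairwise (fun x y => ¬ Edge R t y x)

/-- Every schedule solves all GAP instances of dimensions `m`, `n`. -/
def Solves (R : FireRules φ) (t : Tree φ) (m n : ℕ) (out : ℕ → ℕ → ℕ) : Prop :=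
  ∀ σ : List (List Bool), t.IsSchedule R σ → SeriallySolves m n out (σ.flatMap t.code)

/-- Exclusive writes and no determinacy race: if one of two strands writes a word that the
other one accesses, then the DAG orders the two. -/
def RaceFree (R : FireRules φ) (t : Tree φ) : Prop :=
  ∀ x ∈ t.strands, ∀ y ∈ t.strands, x ≠ y →
    ∀ A ∈ t.code x, A.dst ∈ traceList (t.code y) →
      Relation.TransGen (Edge R t) x y ∨ Relation.TransGen (Edge R t) y x

end Tree

/-! ## Nested Dataflow programs: recursive procedures with integer parameters -/

/-- Index arithmetic on the parameters (subtraction and division are those of `ℕ`). -/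
inductive Idx : Type where
  | var (k : ℕ)
  | lit (c : ℕ)
  | add (x y : Idx)
  | sub (x y : Idx)
  | mul (x y : Idx)
  | div (x y : Idx)

def Idx.eval (env : List ℕ) : Idx → ℕ
  | .var k => env.getD k 0
  | .lit c => c
  | .add x y => x.eval env + y.eval env
  | .sub x y => x.eval env - y.eval env
  | .mul x y => x.eval env * y.eval env
  | .div x y => x.eval env / y.eval env

/-- Statements. `π` is the type of procedure names; `iflt x y a b` is
`if x < y then a else b`. -/
inductive Stmt (π φ : Type) : Type where
  | strand (L : List (Assign Idx))
  | call (p : π) (args : List Idx)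
  | iflt (x y : Idx) (a b : Stmt π φ)
  | comp (c : Comp φ) (a b : Stmt π φ)

/-- A program: a procedure body for each name, and the procedure that is started. -/
structure Program (π φ : Type) where
  body : π → Stmt π φ
  main : π

/-- The spawn tree of a statement, given the spawn trees of the calls. -/
def Stmt.expand {π φ : Type} (k : π → List ℕ → Option (Tree φ)) (env : List ℕ) :
    Stmt π φ → Option (Tree φ)
  | .strand L => some (Tree.leaf (L.map (Assign.map (Idx.eval env))))
  | .call p args => k p (args.map (Idx.eval env))
  | .iflt x y a b => if x.eval env < y.eval env then a.expand k env else b.expand k env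
  | .comp c a b =>
    match a.expand k env, b.expand k env with
    | some s, some t => some (Tree.node c s t)
    | _, _ => none

/-- Expansion of a call with recursion depth bounded by the first argument. -/
def Program.run {π φ : Type} (P : Program π φ) : ℕ → π → List ℕ → Option (Tree φ)
  | 0, _, _ => none
  | d + 1, p, env => (P.body p).expand (P.run d) env

/-- Started with the arguments `args`, the program unfolds to the spawn tree `t`. -/
def Program.Unfolds {π φ : Type} (P : Program π φ) (args : List ℕ) (t : Tree φ) : Prop :=
  ∃ d : ℕ, P.run d P.main args = some t

/-- Every fire construct is replaced by the full dependency `;`. -/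
def Comp.erase {φ ψ : Type} : Comp φ → Comp ψ
  | .ser => .ser
  | .par => .par
  | .fire _ => .ser

def Stmt.erase {π φ ψ : Type} : Stmt π φ → Stmt π ψ
  | .strand L => .strand L
  | .call p args => .call p args
  | .iflt x y a b => .iflt x y a.erase b.erase
  | .comp c a b => .comp c.erase a.erase b.erase

def Program.erase {π φ ψ : Type} (P : Program π φ) : Program π ψ :=
  ⟨fun p => (P.body p).erase, P.main⟩

/-! ## The cache-oblivious parallel (COP) algorithm for GAP

The table is stored in row-major order. It is padded to a square whose side `L` is a power of
two; strands at cells outside the table do nothing. A block is given by its side `L` and its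
top-left cell `(r, c)`. -/

/-- Row-major address of the cell `(i, j)` of a table with columns `0, …, n`. -/
def rowMajor (n i j : ℕ) : ℕ := i * (n + 1) + j

inductive GapProc : Type where
  | main
  | grow
  | init
  | tri
  | boxH
  | boxV

namespace Cop

/-- The first two parameters of all procedures are `m` and `n`, the third one of all but `main`
is the side `L`; then come the row `r` and the column `c` of the block, and, for the box
procedures, the column (`boxH`) or the row (`boxV`) `d` of the source block. -/
abbrev m : Idx := .var 0
abbrev n : Idx := .var 1
abbrev L : Idx := .var 2
abbrev r : Idx := .var 3
abbrev c : Idx := .var 4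
abbrev d : Idx := .var 5
abbrev half : Idx := .div L (.lit 2)
/-- `x`, or `x` plus half the side. -/
abbrev shift (x : Idx) : Bool → Idx
  | false => x
  | true => .add x half
abbrev addr (i j : Idx) : Idx := .add (.mul i (.add n (.lit 1))) j

abbrev S : Type := Stmt GapProc Empty
abbrev seq (a b : S) : S := .comp .ser a b
abbrev par (a b : S) : S := .comp .par a b
abbrev nop : S := .strand []

/-- `a` if the cell `(r, c)` belongs to the table, else nothing. -/
abbrev inTable (a : S) : S := .iflt m r nop (.iflt n c nop a)

/-- The strand `D[r, c] := v`. -/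
abbrev set (v : Val Idx) : S := .strand [⟨addr r c, v⟩]

/-- The strand `D[r, c] := min (D[r, c], D[i, j] + v)`. -/
abbrev relax (i j : Idx) (v : Val Idx) : S :=
  set (.min (.cell (addr r c)) (.add (.cell (addr i j)) v))

/-- Calls on the quadrant `(x, y)` of the current block. -/
abbrev initQ (x y : Bool) : S := .call .init [m, n, half, shift r x, shift c y]
abbrev triQ (x y : Bool) : S := .call .tri [m, n, half, shift r x, shift c y]
/-- Horizontal (vertical) update of the quadrant `(x, y)` from the block of half the side, in the
same rows (columns), whose first column (row) is `e`. -/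
abbrev boxHQ (x y : Bool) (e : Idx) : S := .call .boxH [m, n, half, shift r x, shift c y, e]
abbrev boxVQ (x y : Bool) (e : Idx) : S := .call .boxV [m, n, half, shift r x, shift c y, e]

/-- The same task for each of the four quadrants, in parallel. -/
abbrev quadrants (f : Bool → Bool → S) : S :=
  par (par (f false false) (f false true)) (par (f true false) (f true true))

def body : GapProc → S
  | .main => .call .grow [m, n, .lit 1]
  -- find a power of two that exceeds `m` and `n`
  | .grow =>
      .iflt m L
        (.iflt n L
          (seq (.call .init [m, n, L, .lit 0, .lit 0]) (.call .tri [m, n, L, .lit 0, .lit 0]))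
          (.call .grow [m, n, .mul (.lit 2) L]))
        (.call .grow [m, n, .mul (.lit 2) L])
  | .init =>
      .iflt L (.lit 2)
        (inTable (.iflt (.add r c) (.lit 1) (set .zero) (set .top)))
        (quadrants initQ)
  | .tri =>
      .iflt L (.lit 2)
        (inTable (.iflt r (.lit 1) nop (.iflt c (.lit 1) nop
          (relax (.sub r (.lit 1)) (.sub c (.lit 1)) (.s r c)))))
        (seq
          (seq (triQ false false)
            (par
              (seq (boxHQ false true c) (triQ false true))
              (seq (boxVQ true false r) (triQ true false))))
          (seq
            (seq (boxVQ true true r) (boxHQ true true c))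
            (triQ true true)))
  | .boxH =>
      .iflt L (.lit 2)
        (inTable (relax r d (.w d c)))
        (quadrants fun x y => seq (boxHQ x y (shift d false)) (boxHQ x y (shift d true)))
  | .boxV =>
      .iflt L (.lit 2)
        (inTable (relax d c (.w' d r)))
        (quadrants fun x y => seq (boxVQ x y (shift d false)) (boxVQ x y (shift d true)))

end Cop

/-- The COP algorithm; it has no fire construct. -/
def copGap : Program GapProc Empty := ⟨Cop.body, .main⟩

end GapND

/-! The recursion of COP is kept and only its sequential compositions are turned into fire
constructs. The strands are elementary tasks: `I` initializes a cell, `H` and `V` relax it from one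
earlier cell of its row or column, and `T` performs its diagonal step. The fire rules leave only two
kinds of edges. The tasks at one cell form a chain that begins with `I` and ends with `T`
(`pairwise_prec`), and `T` at a cell precedes every `H` and `V` that reads this cell (`oEdge_H`,
`oEdge_V`). Diagonal reads are covered by a path through a neighbouring cell (`prec_diag`).

Correctness: along any schedule, an initialized cell holds the minimum of the candidates of the
tasks executed there so far (`executed_append`). A cell is read by others only after its `T`, hence
with its final value. Race freedom follows from the same two facts.

Time: the integer `Op.time` strictly increases along every edge (`allEdges_gapTree`) and takes
values in an interval of length O(N log N), where N is the side of the padded table; hence no path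
has more vertices. It is the sum of a coarse part `start`, which pays `8 * 2 ^ k` for leaving an
aligned block of side `2 ^ k`, and a rank that orders the tasks at one cell.

Work is the number O(N^3) of tasks, and space is the size of the table. For cache misses, the
recursion is cut at blocks whose side is of order √M; each of the O((N/√M)^3) pieces loads its
O(M/B) lines once (`misses_gapTree`, `exists_block`).

Lower bounds: for suitable weights all entries of the table differ, so the output words are
distinct, and each has to be written. For work, a program is read as computing sets of monomials in
the weights. Potentials and their negatives, used as weights, force each monomial of an output to
cross every row and column boundary exactly as a path to that cell does
(`SeriallySolves.wt_potential`). Some monomial at `(i, j)` contains both `w q j` and `s i q`; the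
addition that brings the two letters together determines `(i, q, j)` up to the order of its operands
(`SeriallySolves.witness`). So there are of order n^3 additions.

The critical path of COP itself satisfies T(2N) = 3 T(N) + 3 N (`height_triTree`). -/

namespace GapND

/-! ## Labelled spawn trees -/

/-- The elementary tasks: initialization, diagonal step, horizontal and vertical relaxation of the
cell `(i, j)`; `d` is the column or row of the source. -/
inductive Op : Type where
  | I (i j : ℕ)
  | T (i j : ℕ)
  | H (i j d : ℕ)
  | V (i j d : ℕ)

def Op.cell : Op → ℕ × ℕ
  | I i j => (i, j)
  | T i j => (i, j)
  | H i j _ => (i, j)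
  | V i j _ => (i, j)

/-- Spawn trees whose strands are elementary tasks. -/
inductive OTree (φ : Type) : Type where
  | leaf (o : Op)
  | node (c : Comp φ) (a b : OTree φ)

namespace OTree

variable {φ : Type} (f : Op → List (Assign ℕ))

def toTree : OTree φ → Tree φ
  | leaf o => .leaf (f o)
  | node c a b => .node c a.toTree b.toTree

def sub : OTree φ → List Bool → OTree φ
  | leaf o, _ => leaf o
  | node c a b, [] => node c a b
  | node _ a _, false :: p => a.sub p
  | node _ _ b, true :: p => b.sub p

/-- The task at a position. -/
def lab : OTree φ → List Bool → Option Op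
  | leaf o, [] => some o
  | leaf _, _ :: _ => none
  | node _ _ _, [] => none
  | node _ a _, false :: p => a.lab p
  | node _ _ b, true :: p => b.lab p

/-- The tasks in serial order. -/
def ops : OTree φ → List Op
  | leaf o => [o]
  | node _ a b => a.ops ++ b.ops

@[simp] theorem sub_nil (t : OTree φ) : t.sub [] = t := by cases t <;> rfl

theorem toTree_sub (t : OTree φ) (p : List Bool) : (t.sub p).toTree f = (t.toTree f).sub p := by
  induction t generalizing p with
  | leaf o => rfl
  | node c a b iha ihb =>
    match p with
    | [] => rfl
    | false :: p => exact iha p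
    | true :: p => exact ihb p

/-- `Refines.step` prefixes positions with the part of a path that is actually used; this translates
such positions into labels. -/
theorem lab_trunc (t : OTree φ) (p x : List Bool) :
    t.lab ((t.toTree f).trunc p ++ x) = (t.sub p).lab x := by
  induction t generalizing p with
  | leaf o => rfl
  | node c a b iha ihb =>
    match p with
    | [] => rfl
    | false :: p => exact iha p
    | true :: p => exact ihb p

theorem mem_ops_iff (t : OTree φ) (o : Op) : o ∈ t.ops ↔ ∃ x, t.lab x = some o := by
  induction t with
  | leaf o' =>
    constructor
    · intro h
      exact ⟨[], by simp [ops] at h; simp [lab, h]⟩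
    · rintro ⟨_ | _, h⟩ <;> simp_all [lab, ops]
  | node c a b iha ihb =>
    rw [ops, List.mem_append, iha, ihb]
    constructor
    · rintro (⟨x, h⟩ | ⟨x, h⟩)
      · exact ⟨false :: x, h⟩
      · exact ⟨true :: x, h⟩
    · rintro ⟨_ | ⟨_ | _, x⟩, h⟩
      · simp [lab] at h
      · exact .inl ⟨x, h⟩
      · exact .inr ⟨x, h⟩

theorem mem_strands_iff (t : OTree φ) (x : List Bool) :
    x ∈ (t.toTree f).strands ↔ ∃ o, t.lab x = some o := by
  induction t generalizing x with
  | leaf o' => cases x <;> simp [toTree, Tree.strands, lab]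
  | node c a b iha ihb =>
    rcases x with _ | ⟨_ | _, x⟩ <;> simp [toTree, Tree.strands, lab, iha, ihb]

theorem map_lab_strands (t : OTree φ) :
    (t.toTree f).strands.map t.lab = t.ops.map some := by
  induction t with
  | leaf o' => rfl
  | node c a b iha ihb =>
    simp only [toTree, Tree.strands, ops, List.map_append, List.map_map, ← iha, ← ihb]
    rfl

/-- A task that occurs only once determines its position, which allows edges between positions to be
treated as a relation between tasks. -/
theorem lab_inj {t : OTree φ} (h : t.ops.Nodup) {x y : List Bool} {o : Op}
    (hx : t.lab x = some o) (hy : t.lab y = some o) : x = y := by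
  have hs := h.map (Option.some_injective _)
  rw [← map_lab_strands (fun _ => [])] at hs
  exact List.inj_on_of_nodup_map hs ((mem_strands_iff _ _ _).2 ⟨o, hx⟩)
    ((mem_strands_iff _ _ _).2 ⟨o, hy⟩) (hx.trans hy.symm)

theorem code_eq {t : OTree φ} {x : List Bool} {o : Op} (h : t.lab x = some o) :
    (t.toTree f).code x = f o := by
  induction t generalizing x with
  | leaf o' =>
    cases x
    · simp only [lab, Option.some.injEq] at h
      rw [← h]
      rfl
    · simp [lab] at h
  | node c a b iha ihb =>
    rcases x with _ | ⟨_ | _, x⟩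
    · simp [lab] at h
    · exact iha h
    · exact ihb h

theorem serial_eq (t : OTree φ) : (t.toTree f).serial = t.ops.flatMap f := by
  induction t with
  | leaf o' => simp [toTree, Tree.serial, ops]
  | node c a b iha ihb => simp [toTree, Tree.serial, ops, iha, ihb]

theorem work_eq (t : OTree φ) :
    (t.toTree f).work = (t.ops.map fun o => workList (f o) + 1).sum := by
  have h : (t.toTree f).strands.map (t.toTree f).strandCost =
      ((t.toTree f).strands.map t.lab).map
        (fun o => o.elim 0 fun o => workList (f o) + 1) := by
    rw [List.map_map]
    refine List.map_congr_left fun x hx => ?_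
    obtain ⟨o, ho⟩ := (mem_strands_iff f t x).1 hx
    simp [Tree.strandCost, code_eq f ho, ho]
  rw [Tree.work, h, map_lab_strands, List.map_map]
  rfl

/-! ### Dependencies expressed by tasks instead of positions -/

variable (R : FireRules φ)

/-- The dependency `dep` from `a` to `b` is refined to a dependency of `o'` on `o`. -/
def ORef (dep : Option φ) (a b : OTree φ) (o o' : Op) : Prop :=
  ∃ x y, a.lab x = some o ∧ b.lab y = some o' ∧ Refines R dep (a.toTree f) (b.toTree f) x y

/-- The DAG has an edge from the task `o` to the task `o'`. -/
def OEdge (t : OTree φ) (o o' : Op) : Prop :=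
  ∃ x y, t.lab x = some o ∧ t.lab y = some o' ∧ Edge R (t.toTree f) x y

/-- All refinements of the dependency `dep` from `a` to `b` are in the relation `Rel`. -/
def AllRef (dep : Option φ) (a b : OTree φ) (Rel : Op → Op → Prop) : Prop :=
  ∀ x y, Refines R dep (a.toTree f) (b.toTree f) x y →
    ∃ o o', a.lab x = some o ∧ b.lab y = some o' ∧ Rel o o'

/-- All edges of the DAG are in the relation `Rel`. -/
def AllEdges (t : OTree φ) (Rel : Op → Op → Prop) : Prop :=
  ∀ x y, Edge R (t.toTree f) x y → ∃ o o', t.lab x = some o ∧ t.lab y = some o' ∧ Rel o o'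

variable {f R}

theorem ORef.base (g : φ) (o o' : Op) : ORef f R (some g) (leaf o) (leaf o') o o' :=
  ⟨[], [], rfl, rfl, Refines.base g _ _⟩

theorem ORef.step {g : φ} {a b : OTree φ} {o o' : Op} (r : FireClause φ) (hr : r ∈ R g)
    (h : ORef f R r.dep (a.sub r.src) (b.sub r.snk) o o') : ORef f R (some g) a b o o' := by
  obtain ⟨x, y, hx, hy, h⟩ := h
  rw [toTree_sub, toTree_sub] at h
  exact ⟨_, _, (lab_trunc f a _ x).trans hx, (lab_trunc f b _ y).trans hy, Refines.step hr h⟩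

theorem OEdge.fire {g : φ} {a b : OTree φ} {o o' : Op} (h : ORef f R (some g) a b o o') :
    OEdge f R (node (.fire g) a b) o o' := by
  obtain ⟨x, y, hx, hy, h⟩ := h
  exact ⟨false :: x, true :: y, hx, hy, Edge.fire h⟩

theorem OEdge.left {c : Comp φ} {a b : OTree φ} {o o' : Op} (h : OEdge f R a o o') :
    OEdge f R (node c a b) o o' := by
  obtain ⟨x, y, hx, hy, h⟩ := h
  exact ⟨false :: x, false :: y, hx, hy, Edge.left h⟩

theorem OEdge.right {c : Comp φ} {a b : OTree φ} {o o' : Op} (h : OEdge f R b o o') :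
    OEdge f R (node c a b) o o' := by
  obtain ⟨x, y, hx, hy, h⟩ := h
  exact ⟨true :: x, true :: y, hx, hy, Edge.right h⟩

/-- Paths saturate at strands, so every clause applied to a pair of strands leads back to the same
pair. -/
theorem _root_.GapND.Refines.of_leaf {dep : Option φ} {L L' : List (Assign ℕ)} {x y : List Bool}
    (h : Refines R dep (.leaf L) (.leaf L') x y) : x = [] ∧ y = [] := by
  generalize ha : Tree.leaf (φ := φ) L = a at h
  generalize hb : Tree.leaf (φ := φ) L' = b at h
  induction h with
  | full hx hy => subst ha hb; simpa [Tree.strands] using And.intro hx hy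
  | base => exact ⟨rfl, rfl⟩
  | step hr h ih => subst ha hb; simpa [Tree.trunc] using ih rfl rfl

theorem AllRef.leaf {dep : Option φ} {o o' : Op} {Rel : Op → Op → Prop} (h : Rel o o') :
    AllRef f R dep (.leaf o) (.leaf o') Rel := by
  intro x y hxy
  obtain ⟨rfl, rfl⟩ := Refines.of_leaf hxy
  exact ⟨o, o', rfl, rfl, h⟩

/-- When the sink is not a strand, the base case of the refinement is excluded and some clause must
have been applied. In `step_left` the source plays this role. -/
theorem AllRef.step {g : φ} {c : Comp φ} {a b b' : OTree φ} {Rel : Op → Op → Prop}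
    (h : ∀ r ∈ R g, AllRef f R r.dep (a.sub r.src) ((node c b b').sub r.snk) Rel) :
    AllRef f R (some g) a (node c b b') Rel := by
  intro x y hxy
  generalize ha : toTree f a = a' at hxy
  generalize hb : toTree f (node c b b') = b' at hxy
  cases hxy with
  | base => simp [toTree] at hb
  | step hr hxy =>
    subst ha hb
    rw [← toTree_sub, ← toTree_sub] at hxy
    obtain ⟨o, o', h1, h2, h3⟩ := h _ hr _ _ hxy
    exact ⟨o, o', by rw [lab_trunc, h1], by rw [lab_trunc, h2], h3⟩

theorem AllRef.step_left {g : φ} {c : Comp φ} {a a' b : OTree φ} {Rel : Op → Op → Prop}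
    (h : ∀ r ∈ R g, AllRef f R r.dep ((node c a a').sub r.src) (b.sub r.snk) Rel) :
    AllRef f R (some g) (node c a a') b Rel := by
  intro x y hxy
  generalize ha : toTree f (node c a a') = t at hxy
  generalize hb : toTree f b = u at hxy
  cases hxy with
  | base => simp [toTree] at ha
  | step hr hxy =>
    subst ha hb
    rw [← toTree_sub, ← toTree_sub] at hxy
    obtain ⟨o, o', h1, h2, h3⟩ := h _ hr _ _ hxy
    exact ⟨o, o', by rw [lab_trunc, h1], by rw [lab_trunc, h2], h3⟩

theorem AllEdges.leaf (o : Op) (Rel : Op → Op → Prop) : AllEdges f R (.leaf o) Rel := by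
  intro x y h
  simp only [toTree] at h
  cases h

theorem AllEdges.par {a b : OTree φ} {Rel : Op → Op → Prop} (ha : AllEdges f R a Rel)
    (hb : AllEdges f R b Rel) : AllEdges f R (node .par a b) Rel := by
  intro x y h
  cases h with
  | left h => exact ha _ _ h
  | right h => exact hb _ _ h

theorem AllEdges.fire {g : φ} {a b : OTree φ} {Rel : Op → Op → Prop} (ha : AllEdges f R a Rel)
    (hb : AllEdges f R b Rel) (hab : AllRef f R (some g) a b Rel) :
    AllEdges f R (node (.fire g) a b) Rel := by
  intro x y h
  cases h with
  | left h => exact ha _ _ h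
  | right h => exact hb _ _ h
  | fire h => exact hab _ _ h

end OTree

theorem Edge.ne {φ : Type} {R : FireRules φ} {t : Tree φ} {x y : List Bool} (h : Edge R t x y) :
    x ≠ y := by
  induction h with
  | ser => simp
  | fire => simp
  | left _ ih => simpa using ih
  | right _ ih => simpa using ih

/-! ## The spawn trees of the procedures -/

/-- The constructs of the sequential compositions in the COP algorithm: `xy` composes a task
`X` with a task `Y`; `I` is the initialization, `T` a triangle, `H` and `V` are boxes, `P` is the
parallel part and `B` the pair of boxes of a triangle. -/
structure Slots (φ : Type) where
  it : Comp φ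
  tp : Comp φ
  ht : Comp φ
  vt : Comp φ
  tb : Comp φ
  vh : Comp φ
  bt : Comp φ
  hh : Comp φ
  vv : Comp φ

namespace OTree

variable {φ : Type}

def initTree : ℕ → ℕ → ℕ → OTree φ
  | 0, r, c => leaf (.I r c)
  | k + 1, r, c =>
    node .par (node .par (initTree k r c) (initTree k r (c + 2 ^ k)))
      (node .par (initTree k (r + 2 ^ k) c) (initTree k (r + 2 ^ k) (c + 2 ^ k)))

def boxTree (mk : ℕ → ℕ → ℕ → Op) (s : Comp φ) : ℕ → ℕ → ℕ → ℕ → OTree φ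
  | 0, r, c, d => leaf (mk r c d)
  | k + 1, r, c, d =>
    node .par
      (node .par (node s (boxTree mk s k r c d) (boxTree mk s k r c (d + 2 ^ k)))
        (node s (boxTree mk s k r (c + 2 ^ k) d) (boxTree mk s k r (c + 2 ^ k) (d + 2 ^ k))))
      (node .par
        (node s (boxTree mk s k (r + 2 ^ k) c d) (boxTree mk s k (r + 2 ^ k) c (d + 2 ^ k)))
        (node s (boxTree mk s k (r + 2 ^ k) (c + 2 ^ k) d)
          (boxTree mk s k (r + 2 ^ k) (c + 2 ^ k) (d + 2 ^ k))))

variable (s : Slots φ)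

def triTree : ℕ → ℕ → ℕ → OTree φ
  | 0, r, c => leaf (.T r c)
  | k + 1, r, c =>
    node s.tb
      (node s.tp (triTree k r c)
        (node .par
          (node s.ht (boxTree .H s.hh k r (c + 2 ^ k) c) (triTree k r (c + 2 ^ k)))
          (node s.vt (boxTree .V s.vv k (r + 2 ^ k) c r) (triTree k (r + 2 ^ k) c))))
      (node s.bt
        (node s.vh (boxTree .V s.vv k (r + 2 ^ k) (c + 2 ^ k) r)
          (boxTree .H s.hh k (r + 2 ^ k) (c + 2 ^ k) c))
        (triTree k (r + 2 ^ k) (c + 2 ^ k)))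

def gapTree (K : ℕ) : OTree φ := node s.it (initTree K 0 0) (triTree s K 0 0)

/-- `(i, j)` is a cell of the block with side `2 ^ k` and top-left cell `(r, c)`. -/
def InBlock (k r c i j : ℕ) : Prop := (r ≤ i ∧ i < r + 2 ^ k) ∧ c ≤ j ∧ j < c + 2 ^ k

/-- A triangle performs the relaxations whose source and target both lie in its block; sources
outside the block are left to the boxes of larger triangles. -/
def InTri (k r c : ℕ) : Op → Prop
  | .I _ _ => False
  | .T i j => InBlock k r c i j
  | .H i j d => InBlock k r c i j ∧ c ≤ d ∧ d < j
  | .V i j d => InBlock k r c i j ∧ r ≤ d ∧ d < i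

theorem mem_initTree (k r c : ℕ) (o : Op) :
    o ∈ (initTree k r c : OTree φ).ops ↔ ∃ i j, InBlock k r c i j ∧ o = .I i j := by
  induction k generalizing r c with
  | zero =>
    simp only [initTree, ops, List.mem_singleton, InBlock, pow_zero]
    constructor
    · rintro rfl; exact ⟨r, c, by omega, rfl⟩
    · rintro ⟨i, j, h, rfl⟩
      rw [show i = r by omega, show j = c by omega]
  | succ k ih =>
    simp only [initTree, ops, List.mem_append, ih, InBlock, pow_succ]
    generalize 2 ^ k = N
    constructor
    · rintro ((⟨i, j, h, rfl⟩ | ⟨i, j, h, rfl⟩) | (⟨i, j, h, rfl⟩ | ⟨i, j, h, rfl⟩)) <;>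
        exact ⟨i, j, by omega, rfl⟩
    · rintro ⟨i, j, h, rfl⟩
      rcases lt_or_ge i (r + N) with hi | hi <;> rcases lt_or_ge j (c + N) with hj | hj
      · exact .inl (.inl ⟨i, j, by omega, rfl⟩)
      · exact .inl (.inr ⟨i, j, by omega, rfl⟩)
      · exact .inr (.inl ⟨i, j, by omega, rfl⟩)
      · exact .inr (.inr ⟨i, j, by omega, rfl⟩)

theorem mem_boxTree (mk : ℕ → ℕ → ℕ → Op) (s : Comp φ) (k r c d : ℕ) (o : Op) :
    o ∈ (boxTree mk s k r c d).ops ↔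
      ∃ i j e, InBlock k r c i j ∧ (d ≤ e ∧ e < d + 2 ^ k) ∧ o = mk i j e := by
  induction k generalizing r c d with
  | zero =>
    simp only [boxTree, ops, List.mem_singleton, InBlock, pow_zero]
    constructor
    · rintro rfl; exact ⟨r, c, d, by omega, by omega, rfl⟩
    · rintro ⟨i, j, e, h, h', rfl⟩
      rw [show i = r by omega, show j = c by omega, show e = d by omega]
  | succ k ih =>
    simp only [boxTree, ops, List.mem_append, ih, InBlock, pow_succ]
    generalize 2 ^ k = N
    constructor
    · rintro (((⟨i, j, e, h, h', rfl⟩ | ⟨i, j, e, h, h', rfl⟩) |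
        (⟨i, j, e, h, h', rfl⟩ | ⟨i, j, e, h, h', rfl⟩)) |
        ((⟨i, j, e, h, h', rfl⟩ | ⟨i, j, e, h, h', rfl⟩) |
        (⟨i, j, e, h, h', rfl⟩ | ⟨i, j, e, h, h', rfl⟩))) <;>
        exact ⟨i, j, e, by omega, by omega, rfl⟩
    · rintro ⟨i, j, e, h, h', rfl⟩
      rcases lt_or_ge i (r + N) with hi | hi <;> rcases lt_or_ge j (c + N) with hj | hj <;>
        rcases lt_or_ge e (d + N) with he | he
      · exact .inl (.inl (.inl ⟨i, j, e, by omega, by omega, rfl⟩))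
      · exact .inl (.inl (.inr ⟨i, j, e, by omega, by omega, rfl⟩))
      · exact .inl (.inr (.inl ⟨i, j, e, by omega, by omega, rfl⟩))
      · exact .inl (.inr (.inr ⟨i, j, e, by omega, by omega, rfl⟩))
      · exact .inr (.inl (.inl ⟨i, j, e, by omega, by omega, rfl⟩))
      · exact .inr (.inl (.inr ⟨i, j, e, by omega, by omega, rfl⟩))
      · exact .inr (.inr (.inl ⟨i, j, e, by omega, by omega, rfl⟩))
      · exact .inr (.inr (.inr ⟨i, j, e, by omega, by omega, rfl⟩))

/-- Two columns (or rows) of a block lie in the same half or are separated by the middle. The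
separated pairs are those treated by the boxes, the others those of the four smaller triangles. -/
theorem mem_triTree (k r c : ℕ) (o : Op) : o ∈ (triTree s k r c).ops ↔ InTri k r c o := by
  induction k generalizing r c with
  | zero =>
    simp only [triTree, ops, List.mem_singleton]
    cases o <;> simp [InTri, InBlock] <;> omega
  | succ k ih =>
    simp only [triTree, ops, List.mem_append, ih, mem_boxTree]
    cases o <;> simp only [InTri, InBlock, pow_succ, Op.H.injEq, Op.V.injEq, reduceCtorEq,
      and_false, exists_false, or_false, false_or, exists_and_left, and_assoc]
    all_goals
      generalize 2 ^ k = N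
      try omega
    all_goals
      constructor
      · rintro h
        simp only [or_assoc] at h
        grind
      · intro h
        grind

theorem nodup_initTree (k r c : ℕ) : (initTree k r c : OTree φ).ops.Nodup := by
  induction k generalizing r c with
  | zero => simp [initTree, ops]
  | succ k ih =>
    simp only [initTree, ops, List.nodup_append', ih, true_and, List.disjoint_left,
      List.mem_append, mem_initTree, InBlock]
    grind

theorem nodup_boxTree {mk : ℕ → ℕ → ℕ → Op}
    (hmk : ∀ i j d i' j' d', mk i j d = mk i' j' d' → i = i' ∧ j = j' ∧ d = d')
    (s : Comp φ) (k r c d : ℕ) : (boxTree mk s k r c d).ops.Nodup := by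
  induction k generalizing r c d with
  | zero => simp [boxTree, ops]
  | succ k ih =>
    simp only [boxTree, ops, List.nodup_append', ih, true_and, List.disjoint_left,
      List.mem_append, mem_boxTree, InBlock, or_imp, forall_and, not_or, forall_exists_index,
      and_imp, not_exists, not_and]
    generalize 2 ^ k = N
    constructorm* _ ∧ _
    all_goals
      intro o i j e _ _ _ _ _ _ ho i' j' e' _ _ _ _ _ _ ho'
      have := hmk _ _ _ _ _ _ (ho.symm.trans ho')
      omega

theorem nodup_triTree (k r c : ℕ) : (triTree s k r c).ops.Nodup := by
  induction k generalizing r c with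
  | zero => simp [triTree, ops]
  | succ k ih =>
    have hH := fun r c d => nodup_boxTree (φ := φ) (mk := .H) (by simp) s.hh k r c d
    have hV := fun r c d => nodup_boxTree (φ := φ) (mk := .V) (by simp) s.vv k r c d
    simp only [triTree, ops, List.nodup_append', ih, hH, hV, true_and, List.disjoint_left,
      List.mem_append, mem_boxTree, mem_triTree, or_imp, forall_and, not_or]
    constructorm* _ ∧ _
    all_goals
      rintro (_ | _ | _ | _) <;>
      simp only [InTri, InBlock, Op.H.injEq, Op.V.injEq, reduceCtorEq, and_false, exists_false,
        not_false_eq_true, IsEmpty.forall_iff, implies_true, forall_exists_index,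
        and_imp, not_exists, not_and]
    all_goals
      intros
      omega

theorem nodup_gapTree (K : ℕ) : (gapTree s K).ops.Nodup := by
  simp only [gapTree, ops, List.nodup_append', nodup_initTree, nodup_triTree, true_and,
    List.disjoint_left, mem_initTree, mem_triTree]
  rintro _ ⟨i, j, _, rfl⟩
  simp [InTri]

theorem length_initTree (k r c : ℕ) : (initTree k r c : OTree φ).ops.length = 4 ^ k := by
  induction k generalizing r c with
  | zero => rfl
  | succ k ih => simp only [initTree, ops, List.length_append, ih]; ring

theorem length_boxTree (mk : ℕ → ℕ → ℕ → Op) (s : Comp φ) (k r c d : ℕ) :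
    (boxTree mk s k r c d).ops.length = 8 ^ k := by
  induction k generalizing r c d with
  | zero => rfl
  | succ k ih => simp only [boxTree, ops, List.length_append, ih]; ring

theorem length_triTree (k r c : ℕ) : (triTree s k r c).ops.length = 8 ^ k := by
  induction k generalizing r c with
  | zero => rfl
  | succ k ih => simp only [triTree, ops, List.length_append, ih, length_boxTree]; ring

theorem length_gapTree_le (K : ℕ) : (gapTree s K).ops.length ≤ 2 * 8 ^ K := by
  rw [gapTree, ops, List.length_append, length_initTree, length_triTree]
  have : 4 ^ K ≤ 8 ^ K := Nat.pow_le_pow_left (by norm_num) K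
  omega

end OTree

/-! ## The COP algorithm with other constructs for `;` -/

namespace Slots

variable {φ : Type} (s : Slots φ)

abbrev nop : Stmt GapProc φ := .strand []
abbrev inTable (a : Stmt GapProc φ) : Stmt GapProc φ :=
  .iflt Cop.m Cop.r nop (.iflt Cop.n Cop.c nop a)
abbrev set (v : Val Idx) : Stmt GapProc φ := .strand [⟨Cop.addr Cop.r Cop.c, v⟩]
abbrev relax (i j : Idx) (v : Val Idx) : Stmt GapProc φ :=
  set (.min (.cell (Cop.addr Cop.r Cop.c)) (.add (.cell (Cop.addr i j)) v))
abbrev callQ (p : GapProc) (x y : Bool) (e : List Idx) : Stmt GapProc φ :=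
  .call p ([Cop.m, Cop.n, Cop.half, Cop.shift Cop.r x, Cop.shift Cop.c y] ++ e)
abbrev quadrants (f : Bool → Bool → Stmt GapProc φ) : Stmt GapProc φ :=
  .comp .par (.comp .par (f false false) (f false true)) (.comp .par (f true false) (f true true))

def body : GapProc → Stmt GapProc φ
  | .main => .call .grow [Cop.m, Cop.n, .lit 1]
  | .grow =>
      .iflt Cop.m Cop.L
        (.iflt Cop.n Cop.L
          (.comp s.it (.call .init [Cop.m, Cop.n, Cop.L, .lit 0, .lit 0])
            (.call .tri [Cop.m, Cop.n, Cop.L, .lit 0, .lit 0]))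
          (.call .grow [Cop.m, Cop.n, .mul (.lit 2) Cop.L]))
        (.call .grow [Cop.m, Cop.n, .mul (.lit 2) Cop.L])
  | .init =>
      .iflt Cop.L (.lit 2)
        (inTable (.iflt (.add Cop.r Cop.c) (.lit 1) (set .zero) (set .top)))
        (quadrants fun x y => callQ .init x y [])
  | .tri =>
      .iflt Cop.L (.lit 2)
        (inTable (.iflt Cop.r (.lit 1) nop (.iflt Cop.c (.lit 1) nop
          (relax (.sub Cop.r (.lit 1)) (.sub Cop.c (.lit 1)) (.s Cop.r Cop.c)))))
        (.comp s.tb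
          (.comp s.tp (callQ .tri false false [])
            (.comp .par
              (.comp s.ht (callQ .boxH false true [Cop.c]) (callQ .tri false true []))
              (.comp s.vt (callQ .boxV true false [Cop.r]) (callQ .tri true false []))))
          (.comp s.bt
            (.comp s.vh (callQ .boxV true true [Cop.r]) (callQ .boxH true true [Cop.c]))
            (callQ .tri true true [])))
  | .boxH =>
      .iflt Cop.L (.lit 2)
        (inTable (relax Cop.r Cop.d (.w Cop.d Cop.c)))
        (quadrants fun x y => .comp s.hh (callQ .boxH x y [Cop.shift Cop.d false])
          (callQ .boxH x y [Cop.shift Cop.d true]))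
  | .boxV =>
      .iflt Cop.L (.lit 2)
        (inTable (relax Cop.d Cop.c (.w' Cop.d Cop.r)))
        (quadrants fun x y => .comp s.vv (callQ .boxV x y [Cop.shift Cop.d false])
          (callQ .boxV x y [Cop.shift Cop.d true]))

def program : Program GapProc φ := ⟨s.body, .main⟩

/-- All compositions are sequential. -/
def serial : Slots φ := ⟨.ser, .ser, .ser, .ser, .ser, .ser, .ser, .ser, .ser⟩

theorem program_serial : (serial : Slots Empty).program = copGap := by
  simp only [program, copGap, Program.mk.injEq, and_true]
  funext p
  cases p <;> rfl

/-- All compositions become sequential if the fire constructs are erased. -/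
def IsSequential : Prop :=
  s.it.erase = (.ser : Comp Empty) ∧ s.tp.erase = (.ser : Comp Empty) ∧
  s.ht.erase = (.ser : Comp Empty) ∧ s.vt.erase = (.ser : Comp Empty) ∧
  s.tb.erase = (.ser : Comp Empty) ∧ s.vh.erase = (.ser : Comp Empty) ∧
  s.bt.erase = (.ser : Comp Empty) ∧ s.hh.erase = (.ser : Comp Empty) ∧
  s.vv.erase = (.ser : Comp Empty)

theorem erase_program (h : s.IsSequential) : s.program.erase = copGap := by
  obtain ⟨h1, h2, h3, h4, h5, h6, h7, h8, h9⟩ := h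
  simp only [program, copGap, Program.erase, Program.mk.injEq, and_true]
  funext p
  cases p <;> simp only [body, Stmt.erase, h1, h2, h3, h4, h5, h6, h7, h8, h9] <;> rfl

end Slots

/-- The strand of an elementary task, for the table with dimensions `m`, `n`. -/
def opCode (m n : ℕ) (o : Op) : List (Assign ℕ) :=
  if m < o.cell.1 then [] else if n < o.cell.2 then [] else
  let a := rowMajor n
  match o with
  | .I i j => if i + j < 1 then [⟨a i j, .zero⟩] else [⟨a i j, .top⟩]
  | .T i j => if i < 1 then [] else if j < 1 then [] else
      [⟨a i j, .min (.cell (a i j)) (.add (.cell (a (i - 1) (j - 1))) (.s i j))⟩]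
  | .H i j d => [⟨a i j, .min (.cell (a i j)) (.add (.cell (a i d)) (.w d j))⟩]
  | .V i j d => [⟨a i j, .min (.cell (a i j)) (.add (.cell (a d j)) (.w' d i))⟩]

/-! ### Unfolding of the programs -/

section Run

variable {φ : Type} (s : Slots φ) (m n : ℕ)

open OTree

theorem two_pow_succ_div_two (k : ℕ) : 2 ^ (k + 1) / 2 = 2 ^ k := by
  rw [pow_succ, Nat.mul_div_cancel _ (by norm_num)]

theorem not_two_pow_succ_lt_two (k : ℕ) : ¬ 2 ^ (k + 1) < 2 := by
  have := Nat.one_le_two_pow (n := k)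
  rw [pow_succ]; omega

theorem run_init {D k : ℕ} (h : k < D) (r c : ℕ) :
    s.program.run D .init [m, n, 2 ^ k, r, c] =
      some ((initTree k r c).toTree (opCode m n)) := by
  induction k generalizing D r c with
  | zero =>
    obtain ⟨D, rfl⟩ : ∃ D', D = D' + 1 := ⟨D - 1, by omega⟩
    simp only [Program.run, Slots.program, Slots.body, Stmt.expand, Idx.eval, List.getD_cons_succ,
      List.getD_cons_zero, pow_zero, Nat.one_lt_ofNat, if_true, initTree, toTree, opCode, Op.cell]
    split_ifs <;> first | rfl | (simp only [*, if_true, if_false]; rfl)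
  | succ k ih =>
    obtain ⟨D, rfl⟩ : ∃ D', D = D' + 1 := ⟨D - 1, by omega⟩
    simp only [Slots.program] at ih
    simp only [Program.run, Slots.program, Slots.body, Stmt.expand, Idx.eval, List.getD_cons_succ,
      List.getD_cons_zero, not_two_pow_succ_lt_two, if_false, List.map_cons, List.map_nil,
      two_pow_succ_div_two, List.append_nil, Cop.shift,
      ih (show k < D by omega), initTree, toTree]

theorem run_boxH {D k : ℕ} (h : k < D) (r c d : ℕ) :
    s.program.run D .boxH [m, n, 2 ^ k, r, c, d] =
      some ((boxTree .H s.hh k r c d).toTree (opCode m n)) := by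
  induction k generalizing D r c d with
  | zero =>
    obtain ⟨D, rfl⟩ : ∃ D', D = D' + 1 := ⟨D - 1, by omega⟩
    simp only [Program.run, Slots.program, Slots.body, Stmt.expand, Idx.eval, List.getD_cons_succ,
      List.getD_cons_zero, pow_zero, Nat.one_lt_ofNat, if_true, boxTree, toTree, opCode, Op.cell]
    split_ifs <;> first | rfl | (simp only [*, if_true, if_false]; rfl)
  | succ k ih =>
    obtain ⟨D, rfl⟩ : ∃ D', D = D' + 1 := ⟨D - 1, by omega⟩
    simp only [Slots.program] at ih
    simp only [Program.run, Slots.program, Slots.body, Stmt.expand, Idx.eval, List.getD_cons_succ,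
      List.getD_cons_zero, not_two_pow_succ_lt_two, if_false, List.map_cons, List.map_nil,
      two_pow_succ_div_two, List.cons_append, List.nil_append, Cop.shift,
      ih (show k < D by omega), boxTree, toTree]

theorem run_boxV {D k : ℕ} (h : k < D) (r c d : ℕ) :
    s.program.run D .boxV [m, n, 2 ^ k, r, c, d] =
      some ((boxTree .V s.vv k r c d).toTree (opCode m n)) := by
  induction k generalizing D r c d with
  | zero =>
    obtain ⟨D, rfl⟩ : ∃ D', D = D' + 1 := ⟨D - 1, by omega⟩
    simp only [Program.run, Slots.program, Slots.body, Stmt.expand, Idx.eval, List.getD_cons_succ,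
      List.getD_cons_zero, pow_zero, Nat.one_lt_ofNat, if_true, boxTree, toTree, opCode, Op.cell]
    split_ifs <;> first | rfl | (simp only [*, if_true, if_false]; rfl)
  | succ k ih =>
    obtain ⟨D, rfl⟩ : ∃ D', D = D' + 1 := ⟨D - 1, by omega⟩
    simp only [Slots.program] at ih
    simp only [Program.run, Slots.program, Slots.body, Stmt.expand, Idx.eval, List.getD_cons_succ,
      List.getD_cons_zero, not_two_pow_succ_lt_two, if_false, List.map_cons, List.map_nil,
      two_pow_succ_div_two, List.cons_append, List.nil_append, Cop.shift,
      ih (show k < D by omega), boxTree, toTree]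

theorem run_tri {D k : ℕ} (h : k < D) (r c : ℕ) :
    s.program.run D .tri [m, n, 2 ^ k, r, c] =
      some ((triTree s k r c).toTree (opCode m n)) := by
  induction k generalizing D r c with
  | zero =>
    obtain ⟨D, rfl⟩ : ∃ D', D = D' + 1 := ⟨D - 1, by omega⟩
    simp only [Program.run, Slots.program, Slots.body, Stmt.expand, Idx.eval, List.getD_cons_succ,
      List.getD_cons_zero, pow_zero, Nat.one_lt_ofNat, if_true, triTree, toTree, opCode, Op.cell]
    split_ifs <;> first | rfl | (simp only [*, if_true, if_false]; rfl)
  | succ k ih =>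
    obtain ⟨D, rfl⟩ : ∃ D', D = D' + 1 := ⟨D - 1, by omega⟩
    have hH := fun r c d => run_boxH s m n (show k < D by omega) r c d
    have hV := fun r c d => run_boxV s m n (show k < D by omega) r c d
    simp only [Slots.program] at ih hH hV
    simp only [Program.run, Slots.program, Slots.body, Stmt.expand, Idx.eval, List.getD_cons_succ,
      List.getD_cons_zero, not_two_pow_succ_lt_two, if_false, List.map_cons, List.map_nil,
      two_pow_succ_div_two, List.cons_append, List.nil_append, Cop.shift,
      ih (show k < D by omega), hH, hV, triTree, toTree]

/-- The exponent of the side of the padded table. -/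
def gapExp : ℕ := Nat.size (max m n)

theorem lt_two_pow_gapExp : m < 2 ^ gapExp m n ∧ n < 2 ^ gapExp m n := by
  have := Nat.lt_size_self (max m n)
  exact ⟨(le_max_left _ _).trans_lt this, (le_max_right _ _).trans_lt this⟩

theorem two_pow_le_of_lt_gapExp {e : ℕ} (h : e < gapExp m n) : 2 ^ e ≤ max m n :=
  Nat.lt_size.1 h

/-- Each of the `f` remaining doublings uses one level of recursion depth, and the block procedures
need `gapExp m n + 1` levels. -/
theorem run_grow {D e f : ℕ} (hef : e + f = gapExp m n) (h : gapExp m n + f < D) :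
    s.program.run (D + 1) .grow [m, n, 2 ^ e] =
      some ((gapTree s (gapExp m n)).toTree (opCode m n)) := by
  induction f generalizing D e with
  | zero =>
    obtain rfl : e = gapExp m n := by omega
    have hI := fun r c => run_init s m n (show gapExp m n < D by omega) r c
    have hT := fun r c => run_tri s m n (show gapExp m n < D by omega) r c
    simp only [Slots.program] at hI hT
    simp only [Program.run, Slots.program, Slots.body, Stmt.expand, Idx.eval, List.getD_cons_succ,
      List.getD_cons_zero, lt_two_pow_gapExp m n, if_true, List.map_cons, List.map_nil, hI, hT,
      gapTree, toTree]
  | succ f ih =>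
    obtain ⟨D, rfl⟩ : ∃ D', D = D' + 1 := ⟨D - 1, by omega⟩
    -- The side does not yet exceed both dimensions, so one of the two tests fails; both failing
    -- branches make the same call.
    have hlt := two_pow_le_of_lt_gapExp m n (show e < gapExp m n by omega)
    have := ih (D := D) (e := e + 1) (by omega) (by omega)
    rw [pow_succ'] at this
    rw [Program.run]
    simp only [show s.program.body = s.body from rfl, Slots.body, Stmt.expand, Idx.eval,
      List.getD_cons_succ, List.getD_cons_zero, List.map_cons, List.map_nil]
    split_ifs
    · omega
    · exact this
    · exact this

theorem Stmt.expand_mono {π φ : Type} {k k' : π → List ℕ → Option (Tree φ)}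
    (h : ∀ p env t, k p env = some t → k' p env = some t) (env : List ℕ) (st : Stmt π φ)
    {t : Tree φ} (ht : st.expand k env = some t) : st.expand k' env = some t := by
  induction st generalizing t with
  | strand L => exact ht
  | call p args => exact h _ _ _ ht
  | iflt x y a b iha ihb =>
    simp only [Stmt.expand] at ht ⊢
    split_ifs at ht ⊢
    · exact iha ht
    · exact ihb ht
  | comp c a b iha ihb =>
    simp only [Stmt.expand] at ht ⊢
    rcases ha : a.expand k env with _ | u
    · simp [ha] at ht
    rcases hb : b.expand k env with _ | v
    · simp [ha, hb] at ht
    simp only [ha, hb, Option.some.injEq] at ht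
    simp [iha ha, ihb hb, ht]

/-- A larger depth bound never changes a result that is already defined, so the tree to which a
program unfolds is unique. -/
theorem Program.run_mono {π φ : Type} (P : Program π φ) {d d' : ℕ} (h : d ≤ d') (p : π)
    (env : List ℕ) {t : Tree φ} (ht : P.run d p env = some t) : P.run d' p env = some t := by
  induction d generalizing d' p env t with
  | zero => simp [Program.run] at ht
  | succ d ih =>
    obtain ⟨e, rfl⟩ : ∃ e, d' = e + 1 := ⟨d' - 1, by omega⟩
    exact Stmt.expand_mono (fun p env t => ih (by omega) p env) env _ ht

theorem unfolds_iff (t : Tree φ) :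
    s.program.Unfolds [m, n] t ↔ t = (gapTree s (gapExp m n)).toTree (opCode m n) := by
  have h : s.program.run (gapExp m n + gapExp m n + 1 + 1 + 1) .main [m, n] =
      some ((gapTree s (gapExp m n)).toTree (opCode m n)) := by
    have := run_grow s m n (D := gapExp m n + gapExp m n + 1) (e := 0) (f := gapExp m n)
      (by omega) (by omega)
    rw [Program.run]
    simpa only [Slots.program, Slots.body, Stmt.expand, List.map_cons, List.map_nil, Idx.eval,
      List.getD_cons_succ, List.getD_cons_zero, pow_zero] using this
  constructor
  · rintro ⟨d, hd⟩
    have h1 := Program.run_mono _ (le_max_left d (gapExp m n + gapExp m n + 1 + 1 + 1)) _ _ hd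
    have h2 := Program.run_mono _ (le_max_right d (gapExp m n + gapExp m n + 1 + 1 + 1)) _ _ h
    exact Option.some_injective _ (h1.symm.trans h2)
  · rintro rfl
    exact ⟨_, h⟩

end Run

/-! ## The fire constructs -/

section Clauses

variable {φ : Type}

/-- Positions, in a box or an initialization: the quadrant, and its first and last subtask. -/
abbrev quadPath (x y : Bool) : List Bool := [x, y]
abbrev firstPath (x y : Bool) : List Bool := [x, y, false]
abbrev lastPath (x y : Bool) : List Bool := [x, y, true]

/-- Positions of the triangles in a triangle. -/
abbrev triPath : Bool → Bool → List Bool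
  | false, false => [false, false]
  | false, true => [false, true, false, true]
  | true, false => [false, true, true, true]
  | true, true => [true, true]

/-- Positions of the first subtasks of the quadrants of a triangle. -/
abbrev triFirstPath : Bool → Bool → List Bool
  | false, false => [false, false]
  | false, true => [false, true, false, false]
  | true, false => [false, true, true, false]
  | true, true => [true, false, false]

/-- The dependency descends into the same quadrant of source and sink, so that it ends up relating
tasks at equal cells. The sink is entered through the first of the two subtasks of the quadrant. -/
def boxClauses (ρ : Bool → Bool → List Bool) (g : φ) : List (FireClause φ) :=
  [⟨ρ false false, firstPath false false, some g⟩, ⟨ρ false true, firstPath false true, some g⟩,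
   ⟨ρ true false, firstPath true false, some g⟩, ⟨ρ true true, firstPath true true, some g⟩]

/-- The kind of task that comes first at a cell of a triangle depends on the quadrant: the smaller
triangle decides in the first quadrant, a horizontal box comes first in the upper right one, and a
vertical box in the two lower ones. -/
def triClauses (ρ : Bool → Bool → List Bool) (gT gH gV : φ) : List (FireClause φ) :=
  [⟨ρ false false, triFirstPath false false, some gT⟩,
   ⟨ρ false true, triFirstPath false true, some gH⟩,
   ⟨ρ true false, triFirstPath true false, some gV⟩,
   ⟨ρ true true, triFirstPath true true, some gV⟩]

end Clauses

namespace Fire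

/-- The first letter stands for the source and the second for the sink, with the letters of `Slots`.
The dependencies `th` and `tv` go to the boxes that read a triangle; those between `i`, `h`, `v` and
from these to `t` relate tasks at equal cells. -/
abbrev tp : Fin 14 := 0
abbrev th : Fin 14 := 1
abbrev tv : Fin 14 := 2
abbrev hh : Fin 14 := 3
abbrev vv : Fin 14 := 4
abbrev hv : Fin 14 := 5
abbrev vh : Fin 14 := 6
abbrev ih : Fin 14 := 7
abbrev iv : Fin 14 := 8
abbrev ht : Fin 14 := 9
abbrev vt : Fin 14 := 10
abbrev it : Fin 14 := 11
abbrev tb : Fin 14 := 12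
abbrev bt : Fin 14 := 13

/-- From a triangle to the horizontal box that reads it: the triangle in the columns `y` of the
rows `x` is read by the parts `y` of the quadrants in the rows `x`. -/
def thClauses : List (FireClause (Fin 14)) :=
  [⟨triPath false false, [false, false, false], some th⟩,
   ⟨triPath false false, [false, true, false], some th⟩,
   ⟨triPath false true, [false, false, true], some th⟩,
   ⟨triPath false true, [false, true, true], some th⟩,
   ⟨triPath true false, [true, false, false], some th⟩,
   ⟨triPath true false, [true, true, false], some th⟩,
   ⟨triPath true true, [true, false, true], some th⟩,
   ⟨triPath true true, [true, true, true], some th⟩]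

/-- The transpose of `thClauses`: the row half of the source triangle selects the subtask of a
quadrant, and quadrants in both halves of the rows read it. -/
def tvClauses : List (FireClause (Fin 14)) :=
  [⟨triPath false false, [false, false, false], some tv⟩,
   ⟨triPath false false, [true, false, false], some tv⟩,
   ⟨triPath false true, [false, true, false], some tv⟩,
   ⟨triPath false true, [true, true, false], some tv⟩,
   ⟨triPath true false, [false, false, true], some tv⟩,
   ⟨triPath true false, [true, false, true], some tv⟩,
   ⟨triPath true true, [false, true, true], some tv⟩,
   ⟨triPath true true, [true, true, true], some tv⟩]

/-- In the last quadrant the vertical box reads only the upper right triangle and the horizontal box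
only the lower left one, which gives the two clauses of `tb`. The clause of `bt` starts from the
horizontal box alone, since at each cell it follows the vertical one. -/
def rules : FireRules (Fin 14) :=
  ![[⟨[], [false, false], some th⟩, ⟨[], [true, false], some tv⟩],
    thClauses, tvClauses,
    boxClauses lastPath hh, boxClauses lastPath vv, boxClauses lastPath hv,
    boxClauses lastPath vh, boxClauses quadPath ih, boxClauses quadPath iv,
    triClauses lastPath ht hh hv, triClauses lastPath vt vh vv, triClauses quadPath it ih iv,
    [⟨[true, false, true], [false, false], some tv⟩, ⟨[true, true, true], [false, true], some th⟩],
    [⟨[true], [], some ht⟩]]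

theorem rules_tp : rules tp = [⟨[], [false, false], some th⟩, ⟨[], [true, false], some tv⟩] := rfl
theorem rules_th : rules th = thClauses := rfl
theorem rules_tv : rules tv = tvClauses := rfl
theorem rules_hh : rules hh = boxClauses lastPath hh := rfl
theorem rules_vv : rules vv = boxClauses lastPath vv := rfl
theorem rules_hv : rules hv = boxClauses lastPath hv := rfl
theorem rules_vh : rules vh = boxClauses lastPath vh := rfl
theorem rules_ih : rules ih = boxClauses quadPath ih := rfl
theorem rules_iv : rules iv = boxClauses quadPath iv := rfl
theorem rules_ht : rules ht = triClauses lastPath ht hh hv := rfl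
theorem rules_vt : rules vt = triClauses lastPath vt vh vv := rfl
theorem rules_it : rules it = triClauses quadPath it ih iv := rfl
theorem rules_tb : rules tb =
    [⟨[true, false, true], [false, false], some tv⟩,
      ⟨[true, true, true], [false, true], some th⟩] :=
  rfl
theorem rules_bt : rules bt = [⟨[true], [], some ht⟩] := rfl

def slots : Slots (Fin 14) :=
  ⟨.fire it, .fire tp, .fire ht, .fire vt, .fire tb, .fire vh, .fire bt, .fire hh, .fire vv⟩

theorem isSequential_slots : slots.IsSequential := by
  simp [Slots.IsSequential, slots, Comp.erase]

end Fire

namespace OTree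

/-! ### Fire constructs between tasks at the same cell -/

section Grid

variable {φ : Type}

/-- The paths `ρ x y` to the quadrants of `t` lead, when they are iterated, to the task `a i j` at
the cell `(i, j)`. -/
def Grid (ρ : Bool → Bool → List Bool) (a : ℕ → ℕ → Op) : ℕ → ℕ → ℕ → OTree φ → Prop
  | 0, r, c, t => t = leaf (a r c)
  | k + 1, r, c, t => (∃ s u v, t = node s u v) ∧ ∀ x y,
      Grid ρ a k (cond x (r + 2 ^ k) r) (cond y (c + 2 ^ k) c) (t.sub (ρ x y))

theorem grid_initTree (k r c : ℕ) : Grid quadPath .I k r c (initTree k r c : OTree φ) := by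
  induction k generalizing r c with
  | zero => rfl
  | succ k ih =>
    refine ⟨⟨_, _, _, rfl⟩, ?_⟩
    rintro (_ | _) (_ | _) <;> simpa [initTree, sub] using ih _ _

theorem grid_boxTree_first (mk : ℕ → ℕ → ℕ → Op) (s : Comp φ) (k r c d : ℕ) :
    Grid firstPath (fun i j => mk i j d) k r c (boxTree mk s k r c d) := by
  induction k generalizing r c with
  | zero => rfl
  | succ k ih =>
    refine ⟨⟨_, _, _, rfl⟩, ?_⟩
    rintro (_ | _) (_ | _) <;> simpa [boxTree, sub] using ih _ _

theorem grid_boxTree_last (mk : ℕ → ℕ → ℕ → Op) (s : Comp φ) (k r c d : ℕ) :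
    Grid lastPath (fun i j => mk i j (d + 2 ^ k - 1)) k r c (boxTree mk s k r c d) := by
  induction k generalizing r c d with
  | zero => rfl
  | succ k ih =>
    refine ⟨⟨_, _, _, rfl⟩, ?_⟩
    have h : d + 2 ^ (k + 1) - 1 = d + 2 ^ k + 2 ^ k - 1 := by rw [pow_succ]; omega
    rw [h]
    rintro (_ | _) (_ | _) <;> simpa [boxTree, sub] using ih _ _ (d + 2 ^ k)

variable {f : Op → List (Assign ℕ)} {R : FireRules φ}

theorem InBlock.split {k r c i j : ℕ} (h : InBlock (k + 1) r c i j) :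
    ∃ x y, InBlock k (cond x (r + 2 ^ k) r) (cond y (c + 2 ^ k) c) i j := by
  simp only [InBlock, pow_succ] at h
  refine ⟨decide (r + 2 ^ k ≤ i), decide (c + 2 ^ k ≤ j), ?_⟩
  simp only [InBlock]
  by_cases h1 : r + 2 ^ k ≤ i <;> by_cases h2 : c + 2 ^ k ≤ j <;> simp [h1, h2] <;> omega

theorem InBlock.of_quadrant {k r c i j : ℕ} (x y : Bool)
    (h : InBlock k (cond x (r + 2 ^ k) r) (cond y (c + 2 ^ k) c) i j) :
    InBlock (k + 1) r c i j := by
  revert h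
  simp only [InBlock, pow_succ]
  cases x <;> cases y <;> simp only [cond_true, cond_false] <;> omega

/-- Descending on both sides into the quadrant that contains `(i, j)` ends at the strands of this
cell. Together with `Grid.allRef`: such a fire construct relates equal cells and nothing else. -/
theorem Grid.oRef {ρ : Bool → Bool → List Bool} {a b : ℕ → ℕ → Op} {g : φ}
    (hg : R g = boxClauses ρ g) {k r c : ℕ} {t u : OTree φ} (ht : Grid ρ a k r c t)
    (hu : Grid firstPath b k r c u) {i j : ℕ} (hij : InBlock k r c i j) :
    ORef f R (some g) t u (a i j) (b i j) := by
  induction k generalizing r c t u with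
  | zero =>
    obtain rfl : i = r := by simp [InBlock] at hij; omega
    obtain rfl : j = c := by simp [InBlock] at hij; omega
    simp only [Grid] at ht hu
    subst ht hu
    exact .base _ _ _
  | succ k ih =>
    obtain ⟨x, y, hxy⟩ := InBlock.split hij
    refine .step ⟨ρ x y, firstPath x y, some g⟩ ?_ (ih (ht.2 x y) (hu.2 x y) hxy)
    rw [hg]
    cases x <;> cases y <;> simp [boxClauses]

theorem Grid.allRef {ρ : Bool → Bool → List Bool} {a b : ℕ → ℕ → Op} {g : φ}
    (hg : R g = boxClauses ρ g) {k r c : ℕ} {t u : OTree φ} (ht : Grid ρ a k r c t)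
    (hu : Grid firstPath b k r c u) {Rel : Op → Op → Prop}
    (h : ∀ i j, InBlock k r c i j → Rel (a i j) (b i j)) : AllRef f R (some g) t u Rel := by
  induction k generalizing r c t u with
  | zero =>
    simp only [Grid] at ht hu
    subst ht hu
    exact .leaf (h _ _ (by simp [InBlock]))
  | succ k ih =>
    have key : ∀ x y, AllRef f R (some g) (t.sub (ρ x y)) (u.sub (firstPath x y)) Rel :=
      fun x y => ih (ht.2 x y) (hu.2 x y) fun i j hij => h i j (hij.of_quadrant x y)
    obtain ⟨s, v, w, rfl⟩ := hu.1
    refine .step ?_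
    rw [hg]
    intro q hq
    simp only [boxClauses, List.mem_cons, List.not_mem_nil, or_false] at hq
    rcases hq with rfl | rfl | rfl | rfl <;> exact key _ _

/-- The first task at the cell `(i, j)` in a triangle. -/
def firstOp : ℕ → ℕ → ℕ → ℕ → ℕ → Op
  | 0, _, _, i, j => .T i j
  | k + 1, r, c, i, j =>
    if i < r + 2 ^ k then if j < c + 2 ^ k then firstOp k r c i j else .H i j c else .V i j r

variable {s : Slots φ}

/-- The descent follows `gT` as long as the cell is in the first quadrant. On leaving it, the sink
is a box, and the rest of the way is that of `Grid.oRef` for `gH` or `gV`. -/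
theorem Grid.oRef_tri {ρ : Bool → Bool → List Bool} {a : ℕ → ℕ → Op} {gT gH gV : φ}
    (hT : R gT = triClauses ρ gT gH gV) (hH : R gH = boxClauses ρ gH)
    (hV : R gV = boxClauses ρ gV) {k r c : ℕ} {t : OTree φ} (ht : Grid ρ a k r c t)
    {i j : ℕ} (hij : InBlock k r c i j) :
    ORef f R (some gT) t (triTree s k r c) (a i j) (firstOp k r c i j) := by
  induction k generalizing r c t with
  | zero =>
    obtain rfl : i = r := by simp [InBlock] at hij; omega
    obtain rfl : j = c := by simp [InBlock] at hij; omega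
    simp only [Grid] at ht
    subst ht
    exact .base _ _ _
  | succ k ih =>
    obtain ⟨x, y, hxy⟩ := InBlock.split hij
    have hxy' := hxy
    cases x <;> cases y <;> simp only [InBlock, cond_true, cond_false] at hxy'
    · rw [firstOp, if_pos (by omega), if_pos (by omega)]
      refine .step ⟨ρ false false, triFirstPath false false, some gT⟩ (by simp [hT, triClauses]) ?_
      simpa only [triTree, sub, sub_nil, cond_true, cond_false] using ih (ht.2 false false) hxy
    · rw [firstOp, if_pos (by omega), if_neg (by omega)]
      refine .step ⟨ρ false true, triFirstPath false true, some gH⟩ (by simp [hT, triClauses]) ?_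
      simpa only [triTree, sub, sub_nil, cond_true, cond_false] using
        (ht.2 false true).oRef hH (grid_boxTree_first _ _ _ _ _ _) hxy
    · rw [firstOp, if_neg (by omega)]
      refine .step ⟨ρ true false, triFirstPath true false, some gV⟩ (by simp [hT, triClauses]) ?_
      simpa only [triTree, sub, sub_nil, cond_true, cond_false] using
        (ht.2 true false).oRef hV (grid_boxTree_first _ _ _ _ _ _) hxy
    · rw [firstOp, if_neg (by omega)]
      refine .step ⟨ρ true true, triFirstPath true true, some gV⟩ (by simp [hT, triClauses]) ?_
      simpa only [triTree, sub, sub_nil, cond_true, cond_false] using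
        (ht.2 true true).oRef hV (grid_boxTree_first _ _ _ _ _ _) hxy

theorem Grid.allRef_tri {ρ : Bool → Bool → List Bool} {a : ℕ → ℕ → Op} {gT gH gV : φ}
    (hT : R gT = triClauses ρ gT gH gV) (hH : R gH = boxClauses ρ gH)
    (hV : R gV = boxClauses ρ gV) {k r c : ℕ} {t : OTree φ} (ht : Grid ρ a k r c t)
    {Rel : Op → Op → Prop}
    (h : ∀ i j, InBlock k r c i j → Rel (a i j) (firstOp k r c i j)) :
    AllRef f R (some gT) t (triTree s k r c) Rel := by
  induction k generalizing r c t with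
  | zero =>
    simp only [Grid] at ht
    subst ht
    exact .leaf (h _ _ (by simp [InBlock]))
  | succ k ih =>
    refine .step ?_
    rw [hT]
    intro q hq
    simp only [triClauses, List.mem_cons, List.not_mem_nil, or_false] at hq
    rcases hq with rfl | rfl | rfl | rfl <;> simp only [sub, sub_nil]
    · refine ih (ht.2 false false) fun i j hij => ?_
      have := h i j (hij.of_quadrant false false)
      simp only [InBlock] at hij
      rwa [firstOp, if_pos (by omega), if_pos (by omega)] at this
    · refine (ht.2 false true).allRef hH (grid_boxTree_first _ _ _ _ _ _) fun i j hij => ?_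
      have := h i j (hij.of_quadrant false true)
      simp only [InBlock, cond_true, cond_false] at hij
      rwa [firstOp, if_pos (by omega), if_neg (by omega)] at this
    · refine (ht.2 true false).allRef hV (grid_boxTree_first _ _ _ _ _ _) fun i j hij => ?_
      have := h i j (hij.of_quadrant true false)
      simp only [InBlock, cond_true, cond_false] at hij
      rwa [firstOp, if_neg (by omega)] at this
    · refine (ht.2 true true).allRef hV (grid_boxTree_first _ _ _ _ _ _) fun i j hij => ?_
      have := h i j (hij.of_quadrant true true)
      simp only [InBlock, cond_true] at hij
      rwa [firstOp, if_neg (by omega)] at this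

end Grid

/-! ### Fire constructs from a triangle to the boxes that read it -/

section Source

variable {f : Op → List (Assign ℕ)} {s : Slots (Fin 14)} {c₀ : Comp (Fin 14)}

/-- The row, the source column and the target column are halved independently; the eight
combinations are the eight clauses. -/
theorem oRef_th {k r c c' i e j : ℕ} (hi : r ≤ i ∧ i < r + 2 ^ k) (he : c ≤ e ∧ e < c + 2 ^ k)
    (hj : c' ≤ j ∧ j < c' + 2 ^ k) :
    ORef f Fire.rules (some Fire.th) (triTree s k r c) (boxTree .H c₀ k r c' c) (.T i e)
      (.H i j e) := by
  induction k generalizing r c c' with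
  | zero =>
    obtain rfl : i = r := by simp at hi; omega
    obtain rfl : j = c' := by simp at hj; omega
    obtain rfl : e = c := by simp at he; omega
    exact .base _ _ _
  | succ k ih =>
    rw [pow_succ] at hi hj he
    rcases lt_or_ge i (r + 2 ^ k) with h1 | h1 <;> rcases lt_or_ge e (c + 2 ^ k) with h2 | h2 <;>
      rcases lt_or_ge j (c' + 2 ^ k) with h3 | h3
    · refine .step ⟨triPath false false, [false, false, false], some Fire.th⟩
        (show _ ∈ Fire.thClauses by simp [Fire.thClauses]) ?_
      simpa only [triTree, boxTree, sub, sub_nil] using (ih (by omega) (by omega) (by omega))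
    · refine .step ⟨triPath false false, [false, true, false], some Fire.th⟩
        (show _ ∈ Fire.thClauses by simp [Fire.thClauses]) ?_
      simpa only [triTree, boxTree, sub, sub_nil] using (ih (by omega) (by omega) (by omega))
    · refine .step ⟨triPath false true, [false, false, true], some Fire.th⟩
        (show _ ∈ Fire.thClauses by simp [Fire.thClauses]) ?_
      simpa only [triTree, boxTree, sub, sub_nil] using (ih (by omega) (by omega) (by omega))
    · refine .step ⟨triPath false true, [false, true, true], some Fire.th⟩
        (show _ ∈ Fire.thClauses by simp [Fire.thClauses]) ?_
      simpa only [triTree, boxTree, sub, sub_nil] using (ih (by omega) (by omega) (by omega))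
    · refine .step ⟨triPath true false, [true, false, false], some Fire.th⟩
        (show _ ∈ Fire.thClauses by simp [Fire.thClauses]) ?_
      simpa only [triTree, boxTree, sub, sub_nil] using (ih (by omega) (by omega) (by omega))
    · refine .step ⟨triPath true false, [true, true, false], some Fire.th⟩
        (show _ ∈ Fire.thClauses by simp [Fire.thClauses]) ?_
      simpa only [triTree, boxTree, sub, sub_nil] using (ih (by omega) (by omega) (by omega))
    · refine .step ⟨triPath true true, [true, false, true], some Fire.th⟩
        (show _ ∈ Fire.thClauses by simp [Fire.thClauses]) ?_
      simpa only [triTree, boxTree, sub, sub_nil] using (ih (by omega) (by omega) (by omega))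
    · refine .step ⟨triPath true true, [true, true, true], some Fire.th⟩
        (show _ ∈ Fire.thClauses by simp [Fire.thClauses]) ?_
      simpa only [triTree, boxTree, sub, sub_nil] using (ih (by omega) (by omega) (by omega))

theorem oRef_tv {k r c r' i e j : ℕ} (hi : r' ≤ i ∧ i < r' + 2 ^ k) (he : r ≤ e ∧ e < r + 2 ^ k)
    (hj : c ≤ j ∧ j < c + 2 ^ k) :
    ORef f Fire.rules (some Fire.tv) (triTree s k r c) (boxTree .V c₀ k r' c r) (.T e j)
      (.V i j e) := by
  induction k generalizing r c r' with
  | zero =>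
    obtain rfl : i = r' := by simp at hi; omega
    obtain rfl : j = c := by simp at hj; omega
    obtain rfl : e = r := by simp at he; omega
    exact .base _ _ _
  | succ k ih =>
    rw [pow_succ] at hi hj he
    rcases lt_or_ge e (r + 2 ^ k) with h1 | h1 <;> rcases lt_or_ge j (c + 2 ^ k) with h2 | h2 <;>
      rcases lt_or_ge i (r' + 2 ^ k) with h3 | h3
    · refine .step ⟨triPath false false, [false, false, false], some Fire.tv⟩
        (show _ ∈ Fire.tvClauses by simp [Fire.tvClauses]) ?_
      simpa only [triTree, boxTree, sub, sub_nil] using (ih (by omega) (by omega) (by omega))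
    · refine .step ⟨triPath false false, [true, false, false], some Fire.tv⟩
        (show _ ∈ Fire.tvClauses by simp [Fire.tvClauses]) ?_
      simpa only [triTree, boxTree, sub, sub_nil] using (ih (by omega) (by omega) (by omega))
    · refine .step ⟨triPath false true, [false, true, false], some Fire.tv⟩
        (show _ ∈ Fire.tvClauses by simp [Fire.tvClauses]) ?_
      simpa only [triTree, boxTree, sub, sub_nil] using (ih (by omega) (by omega) (by omega))
    · refine .step ⟨triPath false true, [true, true, false], some Fire.tv⟩
        (show _ ∈ Fire.tvClauses by simp [Fire.tvClauses]) ?_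
      simpa only [triTree, boxTree, sub, sub_nil] using (ih (by omega) (by omega) (by omega))
    · refine .step ⟨triPath true false, [false, false, true], some Fire.tv⟩
        (show _ ∈ Fire.tvClauses by simp [Fire.tvClauses]) ?_
      simpa only [triTree, boxTree, sub, sub_nil] using (ih (by omega) (by omega) (by omega))
    · refine .step ⟨triPath true false, [true, false, true], some Fire.tv⟩
        (show _ ∈ Fire.tvClauses by simp [Fire.tvClauses]) ?_
      simpa only [triTree, boxTree, sub, sub_nil] using (ih (by omega) (by omega) (by omega))
    · refine .step ⟨triPath true true, [false, true, true], some Fire.tv⟩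
        (show _ ∈ Fire.tvClauses by simp [Fire.tvClauses]) ?_
      simpa only [triTree, boxTree, sub, sub_nil] using (ih (by omega) (by omega) (by omega))
    · refine .step ⟨triPath true true, [true, true, true], some Fire.tv⟩
        (show _ ∈ Fire.tvClauses by simp [Fire.tvClauses]) ?_
      simpa only [triTree, boxTree, sub, sub_nil] using (ih (by omega) (by omega) (by omega))

theorem allRef_th {k r c c' : ℕ} {Rel : Op → Op → Prop}
    (h : ∀ i e j, (r ≤ i ∧ i < r + 2 ^ k) → (c ≤ e ∧ e < c + 2 ^ k) → (c' ≤ j ∧ j < c' + 2 ^ k) →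
      Rel (.T i e) (.H i j e)) :
    AllRef f Fire.rules (some Fire.th) (triTree s k r c) (boxTree .H c₀ k r c' c) Rel := by
  induction k generalizing r c c' with
  | zero => exact .leaf (h _ _ _ (by simp) (by simp) (by simp))
  | succ k ih =>
    refine .step ?_
    intro q hq
    rw [Fire.rules_th] at hq
    simp only [Fire.thClauses, List.mem_cons, List.not_mem_nil, or_false] at hq
    rw [pow_succ] at h
    rcases hq with rfl | rfl | rfl | rfl | rfl | rfl | rfl | rfl <;>
      simp only [triTree, sub, sub_nil] <;>
      exact ih fun i e j _ _ _ => h i e j (by omega) (by omega) (by omega)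

theorem allRef_tv {k r c r' : ℕ} {Rel : Op → Op → Prop}
    (h : ∀ i e j, (r' ≤ i ∧ i < r' + 2 ^ k) → (r ≤ e ∧ e < r + 2 ^ k) → (c ≤ j ∧ j < c + 2 ^ k) →
      Rel (.T e j) (.V i j e)) :
    AllRef f Fire.rules (some Fire.tv) (triTree s k r c) (boxTree .V c₀ k r' c r) Rel := by
  induction k generalizing r c r' with
  | zero => exact .leaf (h _ _ _ (by simp) (by simp) (by simp))
  | succ k ih =>
    refine .step ?_
    intro q hq
    rw [Fire.rules_tv] at hq
    simp only [Fire.tvClauses, List.mem_cons, List.not_mem_nil, or_false] at hq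
    rw [pow_succ] at h
    rcases hq with rfl | rfl | rfl | rfl | rfl | rfl | rfl | rfl <;>
      simp only [triTree, sub, sub_nil] <;>
      exact ih fun i e j _ _ _ => h i e j (by omega) (by omega) (by omega)

end Source

end OTree

/-! ## The critical path -/

/-- `2 ^ (l + 1) - 1`, where `l` is the position of the highest bit in which `d` and `j` differ;
`0` if they are equal. -/
def sep (d j : ℕ) : ℕ := if d = j then 0 else 2 * sep (d / 2) (j / 2) + 1
termination_by d + j
decreasing_by omega

/-- Since `c` is aligned to `2 ^ (k + 1)`, the highest bit in which `d` and `j` differ is bit `k`.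
So `sep` recovers the level of the box to which a relaxation belongs. -/
theorem sep_eq {k c d j : ℕ} (hc : 2 ^ (k + 1) ∣ c) (hd : c ≤ d) (hd' : d < c + 2 ^ k)
    (hj : c + 2 ^ k ≤ j) (hj' : j < c + 2 ^ (k + 1)) : sep d j = 2 * 2 ^ k - 1 := by
  induction k generalizing c d j with
  | zero =>
    obtain ⟨q, rfl⟩ := hc
    simp only [zero_add, pow_one, pow_zero] at *
    rw [sep, if_neg (by omega), show d / 2 = j / 2 by omega, sep]
    simp
  | succ k ih =>
    obtain ⟨q, rfl⟩ := hc
    have h : 2 ^ (k + 1 + 1) * q / 2 = 2 ^ (k + 1) * q := by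
      rw [pow_succ, mul_right_comm, Nat.mul_div_cancel _ (by norm_num)]
    have h2 : 2 ^ (k + 1 + 1) * q = 2 * (2 ^ (k + 1) * q) := by ring
    have hpos := Nat.one_le_two_pow (n := k)
    have h3 : 2 ^ (k + 1) = 2 * 2 ^ k := pow_succ' 2 k
    have h4 : 2 ^ (k + 1 + 1) = 4 * 2 ^ k := by ring
    have := ih (c := 2 ^ (k + 1) * q) (d := d / 2) (j := j / 2) ⟨q, rfl⟩
      (by omega) (by omega) (by omega) (by omega)
    rw [sep, if_neg (by omega), this, pow_succ]
    omega

theorem sep_lt {K d j : ℕ} (hd : d < 2 ^ K) (hj : j < 2 ^ K) : sep d j < 2 ^ K := by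
  induction K generalizing d j with
  | zero =>
    simp only [pow_zero, Nat.lt_one_iff] at *
    rw [sep, if_pos (by omega)]
  | succ K ih =>
    rw [sep]
    split_ifs
    · positivity
    · rw [pow_succ] at *
      have := ih (d := d / 2) (j := j / 2) (by omega) (by omega)
      omega

/-- A time at which the tasks at a cell in the row (or column) `x` may start, up to the rank. -/
def start (K x : ℕ) : ℕ := ∑ k ∈ Finset.range K, 8 * 2 ^ k * (x / 2 ^ k)

/-- The quotient by `2 ^ k` grows by at least one between the two positions, which contributes `8 *
2 ^ k`; the other terms of `start` are monotone. -/
theorem start_add_le {K k c e j : ℕ} (hk : k < K) (hc : 2 ^ k ∣ c) (he : e < c + 2 ^ k)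
    (hj : c + 2 ^ k ≤ j) : start K e + 8 * 2 ^ k ≤ start K j := by
  have hkm : k ∈ Finset.range K := Finset.mem_range.2 hk
  rw [start, start, ← Finset.add_sum_erase _ _ hkm, ← Finset.add_sum_erase _ _ hkm]
  have h1 : ∑ x ∈ (Finset.range K).erase k, 8 * 2 ^ x * (e / 2 ^ x) ≤
      ∑ x ∈ (Finset.range K).erase k, 8 * 2 ^ x * (j / 2 ^ x) :=
    Finset.sum_le_sum fun x _ => Nat.mul_le_mul_left _ (Nat.div_le_div_right (by omega))
  obtain ⟨q, rfl⟩ := hc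
  have hpos : 0 < 2 ^ k := by positivity
  have h2 : e / 2 ^ k ≤ q := by
    rw [← Nat.lt_succ_iff, Nat.div_lt_iff_lt_mul hpos, Nat.succ_mul, mul_comm q]
    exact he
  have h3 : q + 1 ≤ j / 2 ^ k := by
    rw [Nat.le_div_iff_mul_le hpos, Nat.succ_mul, mul_comm q]
    exact hj
  have h4 : 8 * 2 ^ k * (e / 2 ^ k) + 8 * 2 ^ k ≤ 8 * 2 ^ k * (j / 2 ^ k) :=
    calc _ = 8 * 2 ^ k * (e / 2 ^ k + 1) := by ring
      _ ≤ _ := Nat.mul_le_mul_left _ (by omega)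
  omega

theorem start_le (K x : ℕ) : start K x ≤ 8 * K * x := by
  calc start K x ≤ ∑ _k ∈ Finset.range K, 8 * x := by
        refine Finset.sum_le_sum fun k _ => ?_
        rw [mul_assoc]
        exact Nat.mul_le_mul_left _ (Nat.mul_div_le _ _)
    _ = 8 * K * x := by simp; ring

/-- The order of the tasks at one cell. -/
def Op.rank (K : ℕ) : Op → ℤ
  | .I _ _ => -4 * 2 ^ K - 1
  | .T _ _ => 0
  | .H _ j d => -2 * (sep d j : ℤ) - 2 - (j - d)
  | .V i _ d => -3 * (sep d i : ℤ) - 3 - (i - d)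

/-- Every edge of the DAG increases this time by at least one. -/
def Op.time (K : ℕ) (o : Op) : ℤ := start K o.cell.1 + start K o.cell.2 + o.rank K

namespace Op

variable {K k r c i j e : ℕ}

/-- Here `k` is the level of the box that contains the task. Ranks of horizontal tasks of level `k`
lie strictly between `-6 * 2 ^ k` and `-4 * 2 ^ k`, those of vertical ones strictly between `-8 * 2
^ k` and `-6 * 2 ^ k`, and all lower levels lie above `-4 * 2 ^ k`. This is the order of execution
at a cell, and a gain of `8 * 2 ^ k` in `start` outweighs each of these ranks. -/
theorem rank_H (hc : 2 ^ (k + 1) ∣ c) (he : c ≤ e ∧ e < c + 2 ^ k)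
    (hj : c + 2 ^ k ≤ j ∧ j < c + 2 ^ (k + 1)) :
    (H i j e).rank K = -4 * 2 ^ k - (j - e) := by
  have h := sep_eq hc he.1 he.2 hj.1 hj.2
  have h' : ((sep e j : ℕ) : ℤ) = 2 * 2 ^ k - 1 := by
    rw [h, Nat.cast_sub (by have := Nat.one_le_two_pow (n := k); omega)]
    push_cast; ring
  rw [rank, h']; ring

theorem rank_V (hr : 2 ^ (k + 1) ∣ r) (he : r ≤ e ∧ e < r + 2 ^ k)
    (hi : r + 2 ^ k ≤ i ∧ i < r + 2 ^ (k + 1)) :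
    (V i j e).rank K = -6 * 2 ^ k - (i - e) := by
  have h := sep_eq hr he.1 he.2 hi.1 hi.2
  have h' : ((sep e i : ℕ) : ℤ) = 2 * 2 ^ k - 1 := by
    rw [h, Nat.cast_sub (by have := Nat.one_le_two_pow (n := k); omega)]
    push_cast; ring
  rw [rank, h']; ring

end Op

namespace OTree

theorem dvd_half {k r : ℕ} (h : 2 ^ (k + 1) ∣ r) : 2 ^ k ∣ r ∧ 2 ^ k ∣ r + 2 ^ k := by
  have : 2 ^ k ∣ r := (pow_dvd_pow 2 (Nat.le_succ k)).trans h
  exact ⟨this, this.add dvd_rfl⟩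

theorem cell_firstOp (k r c i j : ℕ) : (firstOp k r c i j).cell = (i, j) := by
  induction k generalizing r c with
  | zero => rfl
  | succ k ih => rw [firstOp]; split_ifs <;> first | rfl | exact ih _ _

/-- The first task in a block of side `2 ^ k` belongs to a box of level at most `k - 1`, whose ranks
exceed `-8 * 2 ^ (k - 1)`, or is a diagonal step of rank `0`. -/
theorem le_rank_firstOp (K : ℕ) {k r c i j : ℕ} (hr : 2 ^ k ∣ r) (hc : 2 ^ k ∣ c)
    (h : InBlock k r c i j) : -4 * 2 ^ k ≤ (firstOp k r c i j).rank K := by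
  induction k generalizing r c with
  | zero => simp [firstOp, Op.rank]
  | succ k ih =>
    have hpos : (0 : ℤ) < 2 ^ k := by positivity
    obtain ⟨⟨h1, h2⟩, h3, h4⟩ := h
    have h2' := h2
    have h4' := h4
    zify at h1 h2 h3 h4
    rw [pow_succ] at h2 h4
    rw [firstOp]
    split_ifs with hi hj
    · refine le_trans ?_ (ih (dvd_half hr).1 (dvd_half hc).1 ?_)
      · rw [pow_succ]; linarith
      · simp only [InBlock]; omega
    · rw [Op.rank_H hc ⟨le_rfl, by simp⟩ ⟨by omega, by omega⟩, pow_succ]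
      linarith
    · rw [Op.rank_V hr ⟨le_rfl, by simp⟩ ⟨by omega, by omega⟩, pow_succ]
      linarith

variable (f : Op → List (Assign ℕ))

theorem allEdges_initTree {R : FireRules (Fin 14)} (k r c : ℕ) (Rel : Op → Op → Prop) :
    AllEdges f R (initTree k r c) Rel := by
  induction k generalizing r c with
  | zero => exact .leaf _ _
  | succ k ih => exact .par (.par (ih _ _) (ih _ _)) (.par (ih _ _) (ih _ _))

theorem allEdges_boxTree {R : FireRules (Fin 14)} {mk : ℕ → ℕ → ℕ → Op} {g : Fin 14}
    (hg : R g = boxClauses lastPath g) {k r c d : ℕ} {Rel : Op → Op → Prop}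
    (h : ∀ i j e, InBlock k r c i j → d ≤ e → e + 1 < d + 2 ^ k →
      Rel (mk i j e) (mk i j (e + 1))) :
    AllEdges f R (boxTree mk (.fire g) k r c d) Rel := by
  induction k generalizing r c d with
  | zero => exact .leaf _ _
  | succ k ih =>
    have key : ∀ x y, AllEdges f R
        (node (.fire g)
          (boxTree mk (.fire g) k (cond x (r + 2 ^ k) r) (cond y (c + 2 ^ k) c) d)
          (boxTree mk (.fire g) k (cond x (r + 2 ^ k) r) (cond y (c + 2 ^ k) c)
            (d + 2 ^ k))) Rel := by
      intro x y
      refine .fire (ih fun i j e hij h1 h2 => ?_) (ih fun i j e hij h1 h2 => ?_)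
        (Grid.allRef hg (grid_boxTree_last _ _ _ _ _ _) (grid_boxTree_first _ _ _ _ _ _)
          fun i j hij => ?_)
      · exact h i j e (hij.of_quadrant x y) h1 (by rw [pow_succ]; omega)
      · exact h i j e (hij.of_quadrant x y) (by omega) (by rw [pow_succ]; omega)
      · have hpos := Nat.one_le_two_pow (n := k)
        have := h i j (d + 2 ^ k - 1) (hij.of_quadrant x y) (by omega) (by rw [pow_succ]; omega)
        rwa [Nat.sub_add_cancel (by omega)] at this
    exact .par (.par (key false false) (key false true)) (.par (key true false) (key true true))

/-- Edges within a cell leave `start` unchanged and increase the rank. Edges from a triangle to a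
box of side `2 ^ k` gain at least `8 * 2 ^ k` in `start` and lose less than this in rank. -/
theorem allEdges_triTree {K k r c : ℕ} (hk : k ≤ K) (hr : 2 ^ k ∣ r) (hc : 2 ^ k ∣ c) :
    AllEdges f Fire.rules (triTree Fire.slots k r c) (fun o o' => o.time K < o'.time K) := by
  induction k generalizing r c with
  | zero => exact .leaf _ _
  | succ k ih =>
    have hr' := dvd_half hr
    have hc' := dvd_half hc
    have hkK : k ≤ K := by omega
    have hpos : (0 : ℤ) < 2 ^ k := by positivity
    have hpos' := Nat.one_le_two_pow (n := k)
    have hp : 2 ^ (k + 1) = 2 ^ k * 2 := pow_succ 2 k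
    have boxH : ∀ r', AllEdges f Fire.rules (boxTree .H (.fire Fire.hh) k r' (c + 2 ^ k) c)
        (fun o o' => o.time K < o'.time K) := by
      intro r'
      refine allEdges_boxTree f Fire.rules_hh fun i j e hij h1 h2 => ?_
      obtain ⟨_, h3, h4⟩ := hij
      have e1 := Op.rank_H (K := K) (i := i) (j := j) (e := e) hc ⟨h1, by omega⟩
        ⟨h3, by omega⟩
      have e2 := Op.rank_H (K := K) (i := i) (j := j) (e := e + 1) hc ⟨by omega, by omega⟩
        ⟨h3, by omega⟩
      simp only [Op.time, Op.cell, e1, e2]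
      push_cast
      linarith
    have boxV : ∀ c', AllEdges f Fire.rules (boxTree .V (.fire Fire.vv) k (r + 2 ^ k) c' r)
        (fun o o' => o.time K < o'.time K) := by
      intro c'
      refine allEdges_boxTree f Fire.rules_vv fun i j e hij h1 h2 => ?_
      obtain ⟨⟨h3, h4⟩, _⟩ := hij
      have e1 := Op.rank_V (K := K) (i := i) (j := j) (e := e) hr ⟨h1, by omega⟩
        ⟨h3, by omega⟩
      have e2 := Op.rank_V (K := K) (i := i) (j := j) (e := e + 1) hr ⟨by omega, by omega⟩
        ⟨h3, by omega⟩
      simp only [Op.time, Op.cell, e1, e2]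
      push_cast
      linarith
    have th : ∀ r' c', AllRef f Fire.rules (some Fire.th) (triTree Fire.slots k r' c)
        (boxTree .H c' k r' (c + 2 ^ k) c) (fun o o' => o.time K < o'.time K) := by
      intro r' c'
      refine allRef_th fun i e j _ h1 h2 => ?_
      have e1 := Op.rank_H (K := K) (i := i) (j := j) (e := e) hc h1 ⟨h2.1, by omega⟩
      have e2 := start_add_le (K := K) (k := k) (by omega) hc'.1 h1.2 h2.1
      rw [Op.time, Op.time, e1]
      simp only [Op.cell, Op.rank]
      zify at e2 h2 h1
      linarith
    have tv : ∀ c' c₀, AllRef f Fire.rules (some Fire.tv) (triTree Fire.slots k r c')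
        (boxTree .V c₀ k (r + 2 ^ k) c' r) (fun o o' => o.time K < o'.time K) := by
      intro c' c₀
      refine allRef_tv fun i e j h2 h1 _ => ?_
      have e1 := Op.rank_V (K := K) (i := i) (j := j) (e := e) hr h1 ⟨h2.1, by omega⟩
      have e2 := start_add_le (K := K) (k := k) (by omega) hr'.1 h1.2 h2.1
      rw [Op.time, Op.time, e1]
      simp only [Op.cell, Op.rank]
      zify at e2 h2 h1
      linarith
    have ht : ∀ r' c₀, 2 ^ k ∣ r' → AllRef f Fire.rules (some Fire.ht)
        (boxTree .H c₀ k r' (c + 2 ^ k) c) (triTree Fire.slots k r' (c + 2 ^ k))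
        (fun o o' => o.time K < o'.time K) := by
      intro r' c₀ hr'
      refine Grid.allRef_tri Fire.rules_ht Fire.rules_hh Fire.rules_hv
        (grid_boxTree_last _ _ _ _ _ _) fun i j hij => ?_
      have e1 := Op.rank_H (K := K) (i := i) (j := j) (e := c + 2 ^ k - 1) hc
        ⟨by omega, by omega⟩ ⟨hij.2.1, by have := hij.2.2; omega⟩
      have e2 := le_rank_firstOp K hr' hc'.2 hij
      have h3 := hij.2.1
      -- The last source lies strictly before the target, so the last horizontal task has rank
      -- strictly below `-4 * 2 ^ k`, the lower bound for what follows.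
      have h4 : c + 2 ^ k - 1 < j := by omega
      rw [Op.time, Op.time, e1, cell_firstOp]
      simp only [Op.cell]
      zify at h4
      linarith
    have vt : ∀ c' c₀, 2 ^ k ∣ c' → AllRef f Fire.rules (some Fire.vt)
        (boxTree .V c₀ k (r + 2 ^ k) c' r) (triTree Fire.slots k (r + 2 ^ k) c')
        (fun o o' => o.time K < o'.time K) := by
      intro c' c₀ hc'
      refine Grid.allRef_tri Fire.rules_vt Fire.rules_vh Fire.rules_vv
        (grid_boxTree_last _ _ _ _ _ _) fun i j hij => ?_
      have e1 := Op.rank_V (K := K) (i := i) (j := j) (e := r + 2 ^ k - 1) hr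
        ⟨by omega, by omega⟩ ⟨hij.1.1, by have := hij.1.2; omega⟩
      have e2 := le_rank_firstOp K hr'.2 hc' hij
      have h3 := hij.1.1
      have h4 : r + 2 ^ k - 1 < i := by omega
      rw [Op.time, Op.time, e1, cell_firstOp]
      simp only [Op.cell]
      zify at h4
      linarith
    have vh : AllRef f Fire.rules (some Fire.vh)
        (boxTree .V (.fire Fire.vv) k (r + 2 ^ k) (c + 2 ^ k) r)
        (boxTree .H (.fire Fire.hh) k (r + 2 ^ k) (c + 2 ^ k) c)
        (fun o o' => o.time K < o'.time K) := by
      refine Grid.allRef Fire.rules_vh (grid_boxTree_last _ _ _ _ _ _)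
        (grid_boxTree_first _ _ _ _ _ _)
        fun i j hij => ?_
      have h3 := hij.1
      have h4 := hij.2
      have e1 := Op.rank_V (K := K) (i := i) (j := j) (e := r + 2 ^ k - 1) hr
        ⟨by omega, by omega⟩ ⟨h3.1, by omega⟩
      have e2 := Op.rank_H (K := K) (i := i) (j := j) (e := c) hc
        ⟨by omega, by omega⟩ ⟨h4.1, by omega⟩
      -- This puts the last vertical rank below `-6 * 2 ^ k`, while `j - c < 2 * 2 ^ k` puts the
      -- first horizontal one above it.
      have h5 : r + 2 ^ k - 1 < i := by omega
      simp only [Op.time, Op.cell, e1, e2]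
      zify at h5 h4
      linarith
    refine .fire (.fire (ih hkK hr'.1 hc'.1) (.par
        (.fire (boxH _) (ih hkK hr'.1 hc'.2) (ht _ _ hr'.1))
        (.fire (boxV _) (ih hkK hr'.2 hc'.1) (vt _ _ hc'.1))) (.step ?_))
      (.fire (.fire (boxV _) (boxH _) vh) (ih hkK hr'.2 hc'.2) (.step_left ?_)) (.step ?_)
    · intro q hq
      rw [Fire.rules_tp] at hq
      simp only [List.mem_cons, List.not_mem_nil, or_false] at hq
      rcases hq with rfl | rfl <;> simp only [sub, sub_nil]
      · exact th _ _
      · exact tv _ _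
    · rw [Fire.rules_bt]
      intro q hq
      obtain rfl := List.mem_singleton.1 hq
      simp only [sub, sub_nil]
      exact ht _ _ hr'.2
    · intro q hq
      rw [Fire.rules_tb] at hq
      simp only [List.mem_cons, List.not_mem_nil, or_false] at hq
      rcases hq with rfl | rfl <;> simp only [sub, sub_nil]
      · exact tv _ _
      · exact th _ _

theorem allEdges_gapTree (K : ℕ) :
    AllEdges f Fire.rules (gapTree Fire.slots K) (fun o o' => o.time K < o'.time K) := by
  refine .fire (allEdges_initTree f K 0 0 _)
    (allEdges_triTree f le_rfl (dvd_zero _) (dvd_zero _))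
    (Grid.allRef_tri Fire.rules_it Fire.rules_ih Fire.rules_iv (grid_initTree _ _ _)
      fun i j hij => ?_)
  have h := le_rank_firstOp K (dvd_zero _) (dvd_zero _) hij
  rw [Op.time, Op.time, cell_firstOp]
  have hI : (Op.I i j).rank K = -4 * 2 ^ K - 1 := rfl
  simp only [hI, Op.cell]
  linarith

theorem time_bounds {φ : Type} {s : Slots φ} {K : ℕ} {o : Op} (ho : o ∈ (gapTree s K).ops) :
    -4 * 2 ^ K - 1 ≤ o.time K ∧ o.time K ≤ 16 * K * 2 ^ K := by
  have hcell : o.cell.1 < 2 ^ K ∧ o.cell.2 < 2 ^ K := by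
    rw [gapTree, ops, List.mem_append, mem_initTree, mem_triTree] at ho
    rcases ho with ⟨i, j, h, rfl⟩ | h
    · simp only [InBlock, zero_add] at h
      exact ⟨h.1.2, h.2.2⟩
    · cases o <;> simp only [InTri, InBlock, zero_add] at h <;> simp only [Op.cell] <;> tauto
  have hrank : -4 * 2 ^ K - 1 ≤ o.rank K ∧ o.rank K ≤ 0 := by
    have hpos : (0 : ℤ) < 2 ^ K := by positivity
    rw [gapTree, ops, List.mem_append, mem_initTree, mem_triTree] at ho
    rcases ho with ⟨i, j, h, rfl⟩ | h
    · simp only [Op.rank]; constructor <;> linarith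
    · cases o with
      | I i j => exact h.elim
      | T i j => simp only [Op.rank]; constructor <;> linarith
      | H i j d =>
        simp only [InTri, InBlock, zero_add] at h
        have := sep_lt (show d < 2 ^ K by omega) (show j < 2 ^ K by omega)
        simp only [Op.rank]
        zify at h this
        constructor <;> linarith
      | V i j d =>
        simp only [InTri, InBlock, zero_add] at h
        have := sep_lt (show d < 2 ^ K by omega) (show i < 2 ^ K by omega)
        simp only [Op.rank]
        zify at h this
        constructor <;> linarith
  have h1 : start K o.cell.1 ≤ 8 * K * 2 ^ K :=
    (start_le _ _).trans (Nat.mul_le_mul_left _ hcell.1.le)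
  have h2 : start K o.cell.2 ≤ 8 * K * 2 ^ K :=
    (start_le _ _).trans (Nat.mul_le_mul_left _ hcell.2.le)
  rw [Op.time]
  zify at h1 h2
  have h3 : (0 : ℤ) ≤ start K o.cell.1 := by positivity
  have h4 : (0 : ℤ) ≤ start K o.cell.2 := by positivity
  constructor <;> linarith

end OTree

theorem workList_opCode_le (m n : ℕ) (o : Op) : workList (opCode m n o) ≤ 6 := by
  unfold opCode
  cases o <;> simp only [] <;> split_ifs <;> simp [workList, Assign.cost, Val.cost]

theorem OTree.sum_strandCost_le {φ : Type} (m n : ℕ) (t : OTree φ) {l : List (List Bool)}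
    (hl : ∀ x ∈ l, x ∈ (t.toTree (opCode m n)).strands) :
    (l.map (t.toTree (opCode m n)).strandCost).sum ≤ l.length * 7 := by
  rw [← List.length_map (f := (t.toTree (opCode m n)).strandCost), ← smul_eq_mul]
  refine List.sum_le_card_nsmul _ _ fun c hc => ?_
  obtain ⟨x, hx, rfl⟩ := List.mem_map.1 hc
  obtain ⟨o, ho⟩ := (OTree.mem_strands_iff _ _ _).1 (hl x hx)
  rw [Tree.strandCost, OTree.code_eq _ ho]
  have := workList_opCode_le m n o
  omega

/-- Along a path the times are strictly increasing integers in the interval of `time_bounds`, so the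
path has no more vertices than the interval has integers. A vertex costs at most 7: six operations
and one unit for the strand. -/
theorem timeLE_gapTree (m n K : ℕ) {b : ℝ} (hb : 7 * (16 * K * 2 ^ K + 4 * 2 ^ K + 2 : ℕ) ≤ b) :
    ((OTree.gapTree Fire.slots K).toTree (opCode m n)).TimeLE Fire.rules b := by
  intro l hl hchain
  refine le_trans ?_ hb
  set t := OTree.gapTree Fire.slots K
  have hlen : l.length ≤ 16 * K * 2 ^ K + 4 * 2 ^ K + 2 := by
    let g : List Bool → ℤ := fun x => (t.lab x).elim 0 (Op.time K)
    have hlt : (l.map g).Pairwise (· < ·) := by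
      rw [← List.isChain_iff_pairwise, List.isChain_map]
      refine hchain.imp fun x y hxy => ?_
      obtain ⟨o, o', h1, h2, h3⟩ := OTree.allEdges_gapTree _ K x y hxy
      simpa [g, t, h1, h2] using h3
    have hsub : (l.map g).toFinset ⊆ Finset.Icc (-4 * 2 ^ K - 1 : ℤ) (16 * K * 2 ^ K) := by
      intro z hz
      rw [List.mem_toFinset, List.mem_map] at hz
      obtain ⟨x, hx, rfl⟩ := hz
      obtain ⟨o, ho⟩ := (OTree.mem_strands_iff _ _ _).1 (hl x hx)
      simp only [g, ho, Option.elim, Finset.mem_Icc]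
      exact OTree.time_bounds ((OTree.mem_ops_iff _ _).2 ⟨x, ho⟩)
    have hcard := Finset.card_le_card hsub
    rw [List.toFinset_card_of_nodup (hlt.imp ne_of_lt), List.length_map, Int.card_Icc] at hcard
    refine hcard.trans (le_of_eq ?_)
    have h : (16 * K * 2 ^ K + 1 - (-4 * 2 ^ K - 1) : ℤ) =
        ((16 * K * 2 ^ K + 4 * 2 ^ K + 2 : ℕ) : ℤ) := by push_cast; ring
    rw [h, Int.toNat_natCast]
  have hcost := OTree.sum_strandCost_le m n t hl
  calc (((l.map (t.toTree (opCode m n)).strandCost).sum : ℕ) : ℝ)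
      ≤ ((l.length * 7 : ℕ) : ℝ) := by exact_mod_cast hcost
    _ ≤ ((7 * (16 * K * 2 ^ K + 4 * 2 ^ K + 2) : ℕ) : ℝ) := by
        exact_mod_cast (by omega)
    _ = _ := by push_cast; ring

/-! ## Dependencies -/

namespace OTree

/-- The tasks at the cell `(i, j)` in a triangle, in the order in which they are executed. -/
def cellOps : ℕ → ℕ → ℕ → ℕ → ℕ → List Op
  | 0, _, _, i, j => [.T i j]
  | k + 1, r, c, i, j =>
    if i < r + 2 ^ k then
      if j < c + 2 ^ k then cellOps k r c i j
      else (List.range' c (2 ^ k)).map (.H i j) ++ cellOps k r (c + 2 ^ k) i j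
    else
      if j < c + 2 ^ k then (List.range' r (2 ^ k)).map (.V i j) ++ cellOps k (r + 2 ^ k) c i j
      else ((List.range' r (2 ^ k)).map (.V i j) ++ (List.range' c (2 ^ k)).map (.H i j)) ++
        cellOps k (r + 2 ^ k) (c + 2 ^ k) i j

theorem head?_map_range' {α : Type} (g : ℕ → α) (d k : ℕ) :
    ((List.range' d (2 ^ k)).map g).head? = some (g d) := by
  simp [List.head?_range']

theorem getLast?_map_range' {α : Type} (g : ℕ → α) (d k : ℕ) :
    ((List.range' d (2 ^ k)).map g).getLast? = some (g (d + 2 ^ k - 1)) := by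
  simp [List.getLast?_range']

theorem head?_cellOps (k r c i j : ℕ) : (cellOps k r c i j).head? = some (firstOp k r c i j) := by
  induction k generalizing r c with
  | zero => rfl
  | succ k ih =>
    rw [cellOps, firstOp]
    split_ifs
    · exact ih _ _
    all_goals simp [List.head?_append, List.head?_range']

theorem getLast?_cellOps (k r c i j : ℕ) : (cellOps k r c i j).getLast? = some (.T i j) := by
  induction k generalizing r c with
  | zero => rfl
  | succ k ih =>
    rw [cellOps]
    split_ifs <;> simp [List.getLast?_append, ih]

theorem mem_cellOps {k r c i j : ℕ} (h : InBlock k r c i j) (o : Op) :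
    o ∈ cellOps k r c i j ↔ InTri k r c o ∧ o.cell = (i, j) := by
  induction k generalizing r c with
  | zero =>
    simp only [InBlock, pow_zero] at h
    cases o <;> simp [cellOps, InTri, Op.cell, InBlock] <;> omega
  | succ k ih =>
    rw [cellOps]
    simp only [InBlock, pow_succ] at h
    have eH : ∀ p q i' j' d, (∃ a, (p ≤ a ∧ a < q) ∧ Op.H i j a = Op.H i' j' d) ↔
        (i = i' ∧ j = j') ∧ p ≤ d ∧ d < q := fun p q i' j' d =>
      ⟨by rintro ⟨_, h, ⟨⟩⟩; exact ⟨⟨rfl, rfl⟩, h⟩, by rintro ⟨⟨rfl, rfl⟩, h⟩; exact ⟨d, h, rfl⟩⟩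
    have eV : ∀ p q i' j' d, (∃ a, (p ≤ a ∧ a < q) ∧ Op.V i j a = Op.V i' j' d) ↔
        (i = i' ∧ j = j') ∧ p ≤ d ∧ d < q := fun p q i' j' d =>
      ⟨by rintro ⟨_, h, ⟨⟩⟩; exact ⟨⟨rfl, rfl⟩, h⟩, by rintro ⟨⟨rfl, rfl⟩, h⟩; exact ⟨d, h, rfl⟩⟩
    split_ifs with h1 h2 h2
    all_goals
      rw [← List.append_nil (cellOps k _ _ _ _)]
      simp only [List.mem_append, List.mem_map, List.mem_range'_1, List.not_mem_nil, or_false]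
      rw [ih (by simp only [InBlock]; omega)]
      cases o <;> simp only [InTri, InBlock, Op.cell, pow_succ, Prod.mk.injEq, reduceCtorEq,
        and_false, exists_false, false_or, false_and, or_false, eH, eV] <;> omega

variable {f : Op → List (Assign ℕ)}

/-- At a fixed cell a box runs through its sources in increasing order; its fire construct links the
last source of the first half to the first source of the second half. -/
theorem isChain_boxTree {R : FireRules (Fin 14)} {mk : ℕ → ℕ → ℕ → Op} {g : Fin 14}
    (hg : R g = boxClauses lastPath g) {k r c d i j : ℕ} (h : InBlock k r c i j) :
    ((List.range' d (2 ^ k)).map (mk i j)).IsChain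
      (OEdge f R (boxTree mk (.fire g) k r c d)) := by
  induction k generalizing r c d with
  | zero => simp
  | succ k ih =>
    obtain ⟨x, y, hxy⟩ := h.split
    have hemb : ∀ o o', OEdge f R (node (.fire g)
          (boxTree mk (.fire g) k (cond x (r + 2 ^ k) r) (cond y (c + 2 ^ k) c) d)
          (boxTree mk (.fire g) k (cond x (r + 2 ^ k) r) (cond y (c + 2 ^ k) c) (d + 2 ^ k))) o o' →
        OEdge f R (boxTree mk (.fire g) (k + 1) r c d) o o' := by
      intro o o' ho
      cases x <;> cases y
      · exact .left (.left ho)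
      · exact .left (.right ho)
      · exact .right (.left ho)
      · exact .right (.right ho)
    rw [pow_succ, mul_two, ← List.range'_append_1, List.map_append]
    refine List.IsChain.imp (fun o o' => hemb o o') ?_
    rw [List.isChain_append]
    refine ⟨(ih hxy).imp fun _ _ => .left, (ih hxy).imp fun _ _ => .right, ?_⟩
    rw [getLast?_map_range', head?_map_range']
    rintro _ ⟨⟩ _ ⟨⟩
    exact .fire (Grid.oRef hg (grid_boxTree_last _ _ _ _ _ _) (grid_boxTree_first _ _ _ _ _ _) hxy)

/-- The pieces of `cellOps` are chains inside boxes and smaller triangles; at each joint, `vh`,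
`ht`, `vt` or `bt` supplies an edge between the last task of one piece and the first task of the
next. -/
theorem isChain_triTree {k r c i j : ℕ} (h : InBlock k r c i j) :
    (cellOps k r c i j).IsChain (OEdge f Fire.rules (triTree Fire.slots k r c)) := by
  induction k generalizing r c with
  | zero => simp [cellOps]
  | succ k ih =>
    have hH := fun {d} {r c : ℕ} (h : InBlock k r c i j) =>
      isChain_boxTree (f := f) (mk := .H) (d := d) Fire.rules_hh h
    have hV := fun {d} {r c : ℕ} (h : InBlock k r c i j) =>
      isChain_boxTree (f := f) (mk := .V) (d := d) Fire.rules_vv h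
    simp only [InBlock, pow_succ] at h
    rw [cellOps]
    split_ifs with h1 h2 h2
    · exact (ih (by simp only [InBlock]; omega)).imp fun _ _ h => .left (.left h)
    · have hb : InBlock k r (c + 2 ^ k) i j := by simp only [InBlock]; omega
      rw [List.isChain_append]
      refine ⟨(hH hb).imp fun _ _ h => .left (.right (.left (.left h))),
        (ih hb).imp fun _ _ h => .left (.right (.left (.right h))), ?_⟩
      rw [getLast?_map_range', head?_cellOps]
      rintro _ ⟨⟩ _ ⟨⟩
      exact .left (.right (.left (.fire (Grid.oRef_tri Fire.rules_ht Fire.rules_hh Fire.rules_hv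
        (grid_boxTree_last _ _ _ _ _ _) hb))))
    · have hb : InBlock k (r + 2 ^ k) c i j := by simp only [InBlock]; omega
      rw [List.isChain_append]
      refine ⟨(hV hb).imp fun _ _ h => .left (.right (.right (.left h))),
        (ih hb).imp fun _ _ h => .left (.right (.right (.right h))), ?_⟩
      rw [getLast?_map_range', head?_cellOps]
      rintro _ ⟨⟩ _ ⟨⟩
      exact .left (.right (.right (.fire (Grid.oRef_tri Fire.rules_vt Fire.rules_vh Fire.rules_vv
        (grid_boxTree_last _ _ _ _ _ _) hb))))
    · have hb : InBlock k (r + 2 ^ k) (c + 2 ^ k) i j := by simp only [InBlock]; omega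
      rw [List.isChain_append, List.isChain_append]
      refine ⟨⟨(hV hb).imp fun _ _ h => .right (.left (.left h)),
        (hH hb).imp fun _ _ h => .right (.left (.right h)), ?_⟩,
        (ih hb).imp fun _ _ h => .right (.right h), ?_⟩
      · rw [getLast?_map_range', head?_map_range']
        rintro _ ⟨⟩ _ ⟨⟩
        exact .right (.left (.fire (Grid.oRef Fire.rules_vh (grid_boxTree_last _ _ _ _ _ _)
          (grid_boxTree_first _ _ _ _ _ _) hb)))
      · rw [List.getLast?_append, getLast?_map_range', head?_cellOps]
        rintro _ ⟨⟩ _ ⟨⟩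
        refine .right (.fire (.step ⟨[true], [], some Fire.ht⟩ (by simp [Fire.rules_bt]) ?_))
        simp only [sub, sub_nil]
        exact Grid.oRef_tri Fire.rules_ht Fire.rules_hh Fire.rules_hv
          (grid_boxTree_last _ _ _ _ _ _) hb

/-- Descend to the triangle whose middle separates `d` from `j`. There the edge is supplied by `tp`
if the row is in the upper half, and by `tb` if it is in the lower half. -/
theorem oEdge_H {k r c i j d : ℕ} (h : InTri k r c (.H i j d)) :
    OEdge f Fire.rules (triTree Fire.slots k r c) (.T i d) (.H i j d) := by
  induction k generalizing r c with
  | zero => simp only [InTri, InBlock, pow_zero] at h; omega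
  | succ k ih =>
    simp only [InTri, InBlock, pow_succ] at h
    rcases lt_or_ge i (r + 2 ^ k) with hi | hi <;> rcases lt_or_ge j (c + 2 ^ k) with hj | hj
    · exact .left (.left (ih (by simp only [InTri, InBlock]; omega)))
    · rcases lt_or_ge d (c + 2 ^ k) with hd | hd
      · refine .left (.fire (.step ⟨[], [false, false], some Fire.th⟩ (by simp [Fire.rules_tp]) ?_))
        simp only [sub, sub_nil]
        exact oRef_th (by omega) (by omega) (by omega)
      · exact .left (.right (.left (.right (ih (by simp only [InTri, InBlock]; omega)))))
    · exact .left (.right (.right (.right (ih (by simp only [InTri, InBlock]; omega)))))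
    · rcases lt_or_ge d (c + 2 ^ k) with hd | hd
      · refine .fire (.step ⟨[true, true, true], [false, true], some Fire.th⟩
          (by simp [Fire.rules_tb]) ?_)
        simp only [sub, sub_nil]
        exact oRef_th (by omega) (by omega) (by omega)
      · exact .right (.right (ih (by simp only [InTri, InBlock]; omega)))

theorem oEdge_V {k r c i j d : ℕ} (h : InTri k r c (.V i j d)) :
    OEdge f Fire.rules (triTree Fire.slots k r c) (.T d j) (.V i j d) := by
  induction k generalizing r c with
  | zero => simp only [InTri, InBlock, pow_zero] at h; omega
  | succ k ih =>
    simp only [InTri, InBlock, pow_succ] at h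
    rcases lt_or_ge j (c + 2 ^ k) with hj | hj <;> rcases lt_or_ge i (r + 2 ^ k) with hi | hi
    · exact .left (.left (ih (by simp only [InTri, InBlock]; omega)))
    · rcases lt_or_ge d (r + 2 ^ k) with hd | hd
      · refine .left (.fire (.step ⟨[], [true, false], some Fire.tv⟩ (by simp [Fire.rules_tp]) ?_))
        simp only [sub, sub_nil]
        exact oRef_tv (by omega) (by omega) (by omega)
      · exact .left (.right (.right (.right (ih (by simp only [InTri, InBlock]; omega)))))
    · exact .left (.right (.left (.right (ih (by simp only [InTri, InBlock]; omega)))))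
    · rcases lt_or_ge d (r + 2 ^ k) with hd | hd
      · refine .fire (.step ⟨[true, false, true], [false, false], some Fire.tv⟩
          (by simp [Fire.rules_tb]) ?_)
        simp only [sub, sub_nil]
        exact oRef_tv (by omega) (by omega) (by omega)
      · exact .right (.right (ih (by simp only [InTri, InBlock]; omega)))

variable (f)

/-- The task `o` precedes the task `o'` in the DAG. -/
abbrev Prec (K : ℕ) : Op → Op → Prop :=
  Relation.TransGen (OEdge f Fire.rules (gapTree Fire.slots K))

variable {f}

theorem mem_gapTree {φ : Type} {s : Slots φ} {K : ℕ} {o : Op} : o ∈ (gapTree s K).ops ↔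
    (∃ i j, (i < 2 ^ K ∧ j < 2 ^ K) ∧ o = .I i j) ∨ InTri K 0 0 o := by
  simp [gapTree, ops, mem_initTree, mem_triTree, InBlock]

theorem pairwise_prec {K i j : ℕ} (hi : i < 2 ^ K) (hj : j < 2 ^ K) :
    (Op.I i j :: cellOps K 0 0 i j).Pairwise (Prec f K) := by
  have hb : InBlock K 0 0 i j := by simp only [InBlock]; omega
  rw [← List.isChain_iff_pairwise]
  refine List.IsChain.imp (fun _ _ h => Relation.TransGen.single h) ?_
  rw [← List.singleton_append, List.isChain_append]
  refine ⟨.singleton _, (isChain_triTree hb).imp fun _ _ h => .right h, ?_⟩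
  rw [head?_cellOps]
  rintro _ ⟨⟩ _ ⟨⟩
  exact .fire (Grid.oRef_tri Fire.rules_it Fire.rules_ih Fire.rules_iv (grid_initTree _ _ _) hb)

theorem mem_cons_cellOps {φ : Type} {s : Slots φ} {K i j : ℕ} {o : Op}
    (ho : o ∈ (gapTree s K).ops)
    (h : o.cell = (i, j)) : (i < 2 ^ K ∧ j < 2 ^ K) ∧ o ∈ Op.I i j :: cellOps K 0 0 i j := by
  rw [mem_gapTree] at ho
  rcases ho with ⟨i', j', hij, rfl⟩ | ho
  · simp only [Op.cell, Prod.mk.injEq] at h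
    obtain ⟨rfl, rfl⟩ := h
    exact ⟨hij, by simp⟩
  · have hb : InBlock K 0 0 i j := by
      cases o with
      | I => exact ho.elim
      | T => cases h; exact ho
      | H => cases h; exact ho.1
      | V => cases h; exact ho.1
    refine ⟨by simp only [InBlock] at hb; omega, List.mem_cons_of_mem _ ?_⟩
    exact (mem_cellOps hb _).2 ⟨ho, h⟩

/-- The tasks at a cell are totally ordered. -/
theorem prec_or_prec {K : ℕ} {o o' : Op} (ho : o ∈ (gapTree Fire.slots K).ops)
    (ho' : o' ∈ (gapTree Fire.slots K).ops) (h : o.cell = o'.cell) (hne : o ≠ o') :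
    Prec f K o o' ∨ Prec f K o' o := by
  obtain ⟨⟨hi, hj⟩, hm⟩ := mem_cons_cellOps ho (i := o'.cell.1) (j := o'.cell.2) h
  obtain ⟨_, hm'⟩ := mem_cons_cellOps ho' (i := o'.cell.1) (j := o'.cell.2) rfl
  have := (pairwise_prec (f := f) hi hj).imp (S := fun a b => Prec f K a b ∨ Prec f K b a)
    fun h => Or.inl h
  have : Std.Symm fun a b => Prec f K a b ∨ Prec f K b a := ⟨fun a b => Or.symm⟩
  exact List.Pairwise.forall (by assumption) hm hm' hne

theorem prec_I {K i j : ℕ} {o : Op} (ho : o ∈ (gapTree Fire.slots K).ops)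
    (h : o.cell = (i, j)) (hne : o ≠ .I i j) : Prec f K (.I i j) o := by
  obtain ⟨⟨hi, hj⟩, hm⟩ := mem_cons_cellOps ho h
  exact (List.pairwise_cons.1 (pairwise_prec hi hj)).1 o
    ((List.mem_cons.1 hm).resolve_left hne)

theorem prec_T {K i j : ℕ} {o : Op} (ho : o ∈ (gapTree Fire.slots K).ops)
    (h : o.cell = (i, j)) (hne : o ≠ .T i j) : Prec f K o (.T i j) := by
  obtain ⟨⟨hi, hj⟩, hm⟩ := mem_cons_cellOps ho h
  have hp := pairwise_prec (f := f) hi hj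
  have hl : (Op.I i j :: cellOps K 0 0 i j).getLast? = some (.T i j) := by
    simp [List.getLast?_cons, getLast?_cellOps]
  obtain ⟨l, hl⟩ := List.getLast?_eq_some_iff.1 hl
  rw [hl] at hp hm
  exact (List.pairwise_append.1 hp).2.2 o
    ((List.mem_append.1 hm).resolve_right (by simpa using hne)) _ (by simp)

theorem prec_H {K i j d : ℕ} (hi : i < 2 ^ K) (hj : j < 2 ^ K) (hd : d < j) :
    Prec f K (.T i d) (.H i j d) :=
  .single (.right (oEdge_H (by simp only [InTri, InBlock]; omega)))

theorem prec_V {K i j d : ℕ} (hi : i < 2 ^ K) (hj : j < 2 ^ K) (hd : d < i) :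
    Prec f K (.T d j) (.V i j d) :=
  .single (.right (oEdge_V (by simp only [InTri, InBlock]; omega)))

/-- No fire rule concerns diagonal reads. The path goes through the cell `(i, j + 1)`: its
relaxation from `(i, j)`, its diagonal step, then the vertical relaxation of `(i + 1, j + 1)`. -/
theorem prec_diag {K i j : ℕ} (hi : i + 1 < 2 ^ K) (hj : j + 1 < 2 ^ K) :
    Prec f K (.T i j) (.T (i + 1) (j + 1)) := by
  have h1 : InTri K 0 0 (.H i (j + 1) j) := by simp only [InTri, InBlock]; omega
  have h2 : InTri K 0 0 (.V (i + 1) (j + 1) i) := by simp only [InTri, InBlock]; omega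
  exact (((prec_H (by omega) hj (by omega)).trans
    (prec_T (mem_gapTree.2 (.inr h1)) rfl (by simp))).trans
    (prec_V hi hj (by omega))).trans (prec_T (mem_gapTree.2 (.inr h2)) rfl (by simp))

theorem transGen_edge {φ : Type} {R : FireRules φ} {t : OTree φ} (hn : t.ops.Nodup) {o o' : Op}
    (h : Relation.TransGen (OEdge f R t) o o') {x y : List Bool} (hx : t.lab x = some o)
    (hy : t.lab y = some o') : Relation.TransGen (Edge R (t.toTree f)) x y := by
  induction h generalizing y with
  | single h =>
    obtain ⟨x', y', hx', hy', he⟩ := h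
    rw [lab_inj hn hx hx', lab_inj hn hy hy']
    exact .single he
  | tail _ h ih =>
    obtain ⟨x', y', hx', hy', he⟩ := h
    rw [lab_inj hn hy hy']
    exact (ih hx').tail he

end OTree

/-! ## Solutions of the GAP recurrence -/

section Solution

noncomputable section

/-- The solution of the GAP recurrence. -/
def gapSolution (W : Weights) (i j : ℕ) : ℝ :=
  if i = 0 ∧ j = 0 then 0 else
    sInf ((if _h : 1 ≤ i ∧ 1 ≤ j then {gapSolution W (i - 1) (j - 1) + W.s i j} else ∅) ∪
      Set.range (fun q : Fin j => gapSolution W i q + W.w q j) ∪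
      Set.range (fun p : Fin i => gapSolution W p j + W.w' p i))
termination_by i + j
decreasing_by
  · omega
  · have := q.2; omega
  · have := p.2; omega

end

/-- The set of candidates is finite, and nonempty away from the origin, so its infimum is attained.
-/
theorem isGapSolution_gapSolution (m n : ℕ) (W : Weights) :
    IsGapSolution m n W (gapSolution W) := by
  refine ⟨by rw [gapSolution]; simp, fun i j _ _ hij => ?_⟩
  have hset : gapCandidates W (gapSolution W) i j =
      (if _h : 1 ≤ i ∧ 1 ≤ j then {gapSolution W (i - 1) (j - 1) + W.s i j} else ∅) ∪
      Set.range (fun q : Fin j => gapSolution W i q + W.w q j) ∪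
      Set.range (fun p : Fin i => gapSolution W p j + W.w' p i) := by
    ext x
    simp only [gapCandidates, Set.mem_union, Set.mem_ofPred_eq, Set.mem_range]
    refine or_congr (or_congr ?_ ?_) ?_
    · split_ifs with h
      · simp [h]
      · simp only [Set.mem_empty_iff_false, iff_false]; tauto
    · exact ⟨fun ⟨q, hq, h⟩ => ⟨⟨q, hq⟩, h.symm⟩, fun ⟨q, h⟩ => ⟨q, q.2, h.symm⟩⟩
    · exact ⟨fun ⟨q, hq, h⟩ => ⟨⟨q, hq⟩, h.symm⟩, fun ⟨q, h⟩ => ⟨q, q.2, h.symm⟩⟩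
  have hfin : (gapCandidates W (gapSolution W) i j).Finite := by
    rw [hset]
    refine ((Set.Finite.union ?_ (Set.finite_range _)).union (Set.finite_range _))
    split_ifs <;> simp
  have hne : (gapCandidates W (gapSolution W) i j).Nonempty := by
    by_cases hj : j = 0
    · have hi : 0 < i := by
        rcases Nat.eq_zero_or_pos i with rfl | h
        · simp [hj] at hij
        · exact h
      exact ⟨_, .inr ⟨0, hi, rfl⟩⟩
    · exact ⟨_, .inl (.inr ⟨0, by omega, rfl⟩)⟩
  have hval : gapSolution W i j = sInf (gapCandidates W (gapSolution W) i j) := by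
    rw [hset]
    conv_lhs => rw [gapSolution]
    rw [if_neg]
    rintro ⟨rfl, rfl⟩
    exact hij rfl
  rw [hval]
  exact ⟨hne.csInf_mem hfin, fun x hx => csInf_le hfin.bddBelow hx⟩

end Solution

theorem rowMajor_inj {n i j i' j' : ℕ} (hj : j ≤ n) (hj' : j' ≤ n)
    (h : rowMajor n i j = rowMajor n i' j') : i = i' ∧ j = j' := by
  unfold rowMajor at h
  have h1 : i = i' := by
    have := congrArg (· / (n + 1)) h
    simpa [add_comm, Nat.add_mul_div_right, Nat.div_eq_of_lt (show j < n + 1 by omega),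
      Nat.div_eq_of_lt (show j' < n + 1 by omega)] using this
  subst h1
  exact ⟨rfl, by omega⟩

/-! ## Every schedule computes the solution -/

section Correctness

open OTree

/-- The value with which the task `o` is to update its cell. -/
noncomputable def candidate (W : Weights) (D : ℕ → ℕ → ℝ) : Op → WithTop ℝ
  | .I i j => if i + j < 1 then 0 else ⊤
  | .T i j => if i < 1 then ⊤ else if j < 1 then ⊤ else (D (i - 1) (j - 1) : ℝ) + (W.s i j : ℝ)
  | .H i j d => (D i d : ℝ) + (W.w d j : ℝ)
  | .V i j d => (D d j : ℝ) + (W.w' d i : ℝ)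

/-- The values from the tasks in `pre` at the cell `(i, j)`. -/
def candidates (W : Weights) (D : ℕ → ℕ → ℝ) (pre : List Op) (i j : ℕ) : Set (WithTop ℝ) :=
  {x | ∃ o ∈ pre, o.cell = (i, j) ∧ x = candidate W D o}

/-- The tasks in `pre` have been executed correctly. -/
def Executed (m n : ℕ) (W : Weights) (D : ℕ → ℕ → ℝ) (pre : List Op) (μ : Mem) : Prop :=
  ∀ i j, i ≤ m → j ≤ n → .I i j ∈ pre → IsGLB (candidates W D pre i j) (μ (rowMajor n i j))

/-- An order of the tasks that respects the DAG. -/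
structure Ordered (f : Op → List (Assign ℕ)) (K : ℕ) (os : List Op) : Prop where
  nodup : os.Nodup
  mem_iff : ∀ o, o ∈ os ↔ o ∈ (gapTree Fire.slots K).ops
  mem_of_prec : ∀ pre suf o o', os = pre ++ o' :: suf → Prec f K o o' → o ∈ pre

variable {m n K : ℕ} {W : Weights} {D : ℕ → ℕ → ℝ} {f : Op → List (Assign ℕ)} {os : List Op}

theorem Ordered.mem_of_prec' (ho : Ordered f K os) {pre suf : List Op} (h : os = pre ++ suf)
    {o o' : Op} (ho' : o' ∈ pre) (hp : Prec f K o o') : o ∈ pre := by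
  obtain ⟨l₁, l₂, rfl⟩ := List.append_of_mem ho'
  have := ho.mem_of_prec l₁ (l₂ ++ suf) o o' (by simp [h]) hp
  simp [this]

theorem Ordered.lt (ho : Ordered f K os) {o : Op} (h : o ∈ os) :
    o.cell.1 < 2 ^ K ∧ o.cell.2 < 2 ^ K :=
  (mem_cons_cellOps ((ho.mem_iff o).1 h) (i := o.cell.1) (j := o.cell.2) rfl).1

/-- As `T` is the last task at its cell, its presence implies that all tasks of the cell are in
`pre`. Their candidates are those of the recurrence, apart from harmless values `⊤` and the `0` of
the origin. -/
theorem isLeast_candidates (hD : IsGapSolution m n W D) (ho : Ordered f K os) {pre suf : List Op}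
    (h : os = pre ++ suf) {i j : ℕ} (hi : i ≤ m) (hj : j ≤ n) (hT : .T i j ∈ pre) :
    IsLeast (candidates W D pre i j) (D i j : ℝ) := by
  have hmem : ∀ o ∈ pre, o ∈ (gapTree Fire.slots K).ops := fun o ho' =>
    (ho.mem_iff o).1 (by rw [h]; exact List.mem_append_left _ ho')
  have hij := ho.lt (o := .T i j) (by rw [h]; exact List.mem_append_left _ hT)
  simp only [Op.cell] at hij
  have hall : ∀ o ∈ (gapTree Fire.slots K).ops, o.cell = (i, j) → o ∈ pre := by
    intro o ho' hc
    by_cases hne : o = .T i j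
    · rwa [hne]
    · exact ho.mem_of_prec' h hT (prec_T ho' hc hne)
  constructor
  · by_cases h0 : (i, j) = (0, 0)
    · cases h0
      refine ⟨.I 0 0, hall _ (mem_gapTree.2 (.inl ⟨0, 0, hij, rfl⟩)) rfl, ?_⟩
      simp [candidate, hD.1, Op.cell]
    · rcases (hD.2 i j hi hj h0).1 with (⟨h1, h2, hx⟩ | ⟨q, hq, hx⟩) | ⟨p, hp, hx⟩
      · refine ⟨.T i j, hT, rfl, ?_⟩
        rw [candidate, if_neg (by omega), if_neg (by omega), hx]
        rfl
      · refine ⟨.H i j q, hall _ (mem_gapTree.2 (.inr ?_)) rfl, ?_⟩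
        · simp only [InTri, InBlock]; omega
        · rw [candidate, hx]; exact ⟨rfl, rfl⟩
      · refine ⟨.V i j p, hall _ (mem_gapTree.2 (.inr ?_)) rfl, ?_⟩
        · simp only [InTri, InBlock]; omega
        · rw [candidate, hx]; exact ⟨rfl, rfl⟩
  · rintro _ ⟨o, ho', hc, rfl⟩
    have hm := mem_gapTree.1 (hmem o ho')
    have hle : ∀ x ∈ gapCandidates W D i j, (i, j) ≠ (0, 0) → ((D i j : ℝ) : WithTop ℝ) ≤ (x : ℝ) :=
      fun x hx h0 => WithTop.coe_le_coe.2 ((hD.2 i j hi hj h0).2 hx)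
    cases o with
    | I i' j' =>
      cases hc
      simp only [candidate]
      split_ifs with h0
      · obtain rfl : i = 0 := by omega
        obtain rfl : j = 0 := by omega
        simp [hD.1]
      · exact le_top
    | T i' j' =>
      cases hc
      simp only [candidate]
      split_ifs with h1 h2
      · exact le_top
      · exact le_top
      · exact hle _ (.inl (.inl ⟨by omega, by omega, rfl⟩)) (by simp; omega)
    | H i' j' d =>
      cases hc
      have hd : d < j := by simpa [InTri] using (hm.resolve_left (by simp)).2.2
      exact hle _ (.inl (.inr ⟨d, hd, rfl⟩)) (by simp; omega)
    | V i' j' d =>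
      cases hc
      have hd : d < i := by simpa [InTri] using (hm.resolve_left (by simp)).2.2
      exact hle _ (.inr ⟨d, hd, rfl⟩) (by simp; omega)

theorem candidates_append_of_ne {pre : List Op} {o : Op} {i j : ℕ} (h : o.cell ≠ (i, j)) :
    candidates W D (pre ++ [o]) i j = candidates W D pre i j := by
  ext x
  simp only [candidates, List.mem_append, List.mem_singleton, Set.mem_ofPred_eq]
  constructor
  · rintro ⟨o', h1 | rfl, h2, h3⟩
    · exact ⟨o', h1, h2, h3⟩
    · exact absurd h2 h
  · rintro ⟨o', h1, h2, h3⟩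
    exact ⟨o', .inl h1, h2, h3⟩

theorem candidates_append {pre : List Op} {o : Op} {i j : ℕ} (h : o.cell = (i, j)) :
    candidates W D (pre ++ [o]) i j = insert (candidate W D o) (candidates W D pre i j) := by
  ext x
  simp only [candidates, List.mem_append, List.mem_singleton, Set.mem_ofPred_eq, Set.mem_insert_iff]
  constructor
  · rintro ⟨o', h1 | rfl, h2, h3⟩
    · exact .inr ⟨o', h1, h2, h3⟩
    · exact .inl h3
  · rintro (rfl | ⟨o', h1, h2, h3⟩)
    · exact ⟨o, .inr rfl, h, rfl⟩
    · exact ⟨o', .inl h1, h2, h3⟩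

theorem execList_opCode_of_ne (μ : Mem) {o : Op} {i j : ℕ} (hj : j ≤ n)
    (h : o.cell ≠ (i, j)) :
    execList W μ (opCode m n o) (rowMajor n i j) = μ (rowMajor n i j) := by
  have key : ∀ v, o.cell.2 ≤ n → execList W μ [⟨rowMajor n o.cell.1 o.cell.2, v⟩] (rowMajor n i j) =
      μ (rowMajor n i j) := by
    intro v hn
    simp only [execList, List.foldl, Assign.exec]
    refine Function.update_of_ne (fun he => h ?_) _ _
    obtain ⟨h1, h2⟩ := rowMajor_inj hj hn he
    exact Prod.ext h1.symm h2.symm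
  unfold opCode
  split_ifs with h1 h2
  · rfl
  · rfl
  · have hn : o.cell.2 ≤ n := by omega
    cases o <;> simp only [] <;> (try split_ifs) <;> first | exact key _ hn | rfl

/-- Besides its own cell, `o` reads only a cell whose `T` precedes `o`; that word is already final
by `isLeast_candidates`. The own cell is initialized before any relaxation, so updating it adds one
candidate to the infimum. -/
theorem executed_append (hD : IsGapSolution m n W D) (ho : Ordered f K os) {pre suf : List Op}
    {o : Op} (h : os = pre ++ o :: suf) {μ : Mem} (hpre : Executed m n W D pre μ) :
    Executed m n W D (pre ++ [o]) (execList W μ (opCode m n o)) := by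
  intro i j hi hj hI
  by_cases hc : o.cell = (i, j)
  swap
  · rw [execList_opCode_of_ne μ hj hc, candidates_append_of_ne hc]
    refine hpre i j hi hj ?_
    rcases List.mem_append.1 hI with hI | hI
    · exact hI
    · exact absurd (by rw [← List.mem_singleton.1 hI]; rfl) hc
  rw [candidates_append hc]
  have hom : o ∈ (gapTree Fire.slots K).ops := (ho.mem_iff o).1 (by simp [h])
  have hval : ∀ i' j', i' ≤ m → j' ≤ n → Prec f K (.T i' j') o →
      μ (rowMajor n i' j') = (D i' j' : ℝ) := by
    intro i' j' hi' hj' hp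
    have hT := ho.mem_of_prec pre suf _ _ h hp
    have hlt := ho.lt (o := .T i' j') (by rw [h]; exact List.mem_append_left _ hT)
    have hI' := ho.mem_of_prec' h hT (prec_I (o := .T i' j')
      ((ho.mem_iff _).1 (by rw [h]; exact List.mem_append_left _ hT)) rfl (by simp))
    exact (hpre i' j' hi' hj' hI').unique
      (isLeast_candidates hD ho h hi' hj' hT).isGLB
  have hlt := ho.lt (o := o) (by simp [h])
  rw [hc] at hlt
  have hm1 : ¬ m < o.cell.1 := by rw [hc]; exact not_lt.2 hi
  have hn1 : ¬ n < o.cell.2 := by rw [hc]; exact not_lt.2 hj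
  have hupd : o ≠ .I i j → execList W μ (opCode m n o) (rowMajor n i j) =
      candidate W D o ⊓ μ (rowMajor n i j) →
      IsGLB (insert (candidate W D o) (candidates W D pre i j))
        (execList W μ (opCode m n o) (rowMajor n i j)) := by
    intro hne he
    rw [he]
    exact (hpre i j hi hj (ho.mem_of_prec pre suf _ _ h (prec_I hom hc hne))).insert _
  cases o with
  | I i' j' =>
    cases hc
    -- An initialization precedes all tasks at its cell, so none of them is in `pre`, and the
    -- arbitrary old content is overwritten before it matters.
    have hempty : candidates W D pre i j = ∅ := by
      refine Set.eq_empty_of_forall_notMem ?_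
      rintro _ ⟨o', ho', hc', -⟩
      have hn := ho.nodup
      rw [h] at hn
      have hd := (List.nodup_append.1 hn).2.2
      have hne : o' ≠ .I i j := hd o' ho' _ (by simp)
      have : Op.I i j ∈ pre := ho.mem_of_prec' h ho'
        (prec_I ((ho.mem_iff _).1 (by rw [h]; exact List.mem_append_left _ ho')) hc' hne)
      exact hd _ this _ (by simp) rfl
    rw [hempty, insert_empty_eq]
    have : execList W μ (opCode m n (.I i j)) (rowMajor n i j) = candidate W D (.I i j) := by
      simp only [opCode, hm1, hn1, if_false, candidate]
      split_ifs <;> simp [execList, Assign.exec, Val.eval]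
    rw [this]
    exact isGLB_singleton
  | T i' j' =>
    cases hc
    refine hupd (by simp) ?_
    simp only [opCode, hm1, hn1, if_false, candidate]
    split_ifs with h1 h2
    · simp [execList]
    · simp [execList]
    · obtain ⟨a, rfl⟩ : ∃ a, i = a + 1 := ⟨i - 1, by omega⟩
      obtain ⟨b, rfl⟩ : ∃ b, j = b + 1 := ⟨j - 1, by omega⟩
      simp only [execList, List.foldl, Assign.exec, Function.update_self, Val.eval,
        Nat.add_sub_cancel]
      rw [hval a b (by omega) (by omega) (prec_diag hlt.1 hlt.2), inf_comm]
  | H i' j' d =>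
    cases hc
    refine hupd (by simp) ?_
    have hd : d < j := by
      simpa [InTri] using ((mem_gapTree.1 hom).resolve_left (by simp)).2.2
    simp only [opCode, hm1, hn1, if_false, candidate]
    simp only [execList, List.foldl, Assign.exec, Function.update_self, Val.eval]
    rw [hval i d hi (by omega) (prec_H hlt.1 hlt.2 hd), inf_comm]
  | V i' j' d =>
    cases hc
    refine hupd (by simp) ?_
    have hd : d < i := by
      simpa [InTri] using ((mem_gapTree.1 hom).resolve_left (by simp)).2.2
    simp only [opCode, hm1, hn1, if_false, candidate]
    simp only [execList, List.foldl, Assign.exec, Function.update_self, Val.eval]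
    rw [hval d j (by omega) hj (prec_V hlt.1 hlt.2 hd), inf_comm]

theorem executed_of_prefix (hD : IsGapSolution m n W D) (ho : Ordered f K os) (μ : Mem)
    (pre suf : List Op) (h : os = pre ++ suf) :
    Executed m n W D pre (execList W μ (pre.flatMap (opCode m n))) := by
  induction pre using List.reverseRecOn generalizing suf with
  | nil => intro i j _ _ hI; simp at hI
  | append_singleton pre o ih =>
    have h' : os = pre ++ o :: suf := by rw [h]; simp
    have := executed_append hD ho h' (ih _ h')
    rw [List.flatMap_append, List.flatMap_singleton, execList, List.foldl_append]
    exact this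

theorem Ordered.seriallySolves (ho : Ordered f K os) (hm : m < 2 ^ K) (hn : n < 2 ^ K) :
    SeriallySolves m n (rowMajor n) (os.flatMap (opCode m n)) := by
  intro W μ
  have hD := isGapSolution_gapSolution m n W
  refine ⟨gapSolution W, hD, fun i j hi hj => ?_⟩
  have hT : Op.T i j ∈ os := (ho.mem_iff _).2 (mem_gapTree.2 (.inr (by
    simp only [InTri, InBlock]; omega)))
  have hI : Op.I i j ∈ os := (ho.mem_iff _).2 (mem_gapTree.2 (.inl ⟨i, j, by omega, rfl⟩))
  exact (executed_of_prefix hD ho μ os [] (by simp) i j hi hj hI).unique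
    (isLeast_candidates hD ho (suf := []) (by simp) hi hj hT).isGLB

end Correctness

/-! ### Schedules as orders of tasks -/

section Schedule

open OTree

/-- A schedule contains every strand and has no edge pointing backwards, so the source of an edge
occurs before its target; the claim for paths follows by induction. -/
theorem ordered_of_isSchedule {f : Op → List (Assign ℕ)} {K : ℕ} {σ : List (List Bool)}
    (hσ : ((gapTree Fire.slots K).toTree f).IsSchedule Fire.rules σ) :
    Ordered f K (σ.filterMap (gapTree Fire.slots K).lab) := by
  set t := gapTree Fire.slots K
  have hperm : (σ.filterMap t.lab).Perm t.ops := by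
    have h := hσ.1.filterMap t.lab
    have h' : (t.toTree f).strands.filterMap t.lab = t.ops := by
      have := congrArg (List.filterMap id) (map_lab_strands f t)
      simpa [List.filterMap_map] using this
    rwa [h'] at h
  have hn : t.ops.Nodup := nodup_gapTree _ K
  have hpw : (σ.filterMap t.lab).Pairwise (fun a b => ¬ OEdge f Fire.rules t b a) := by
    rw [List.pairwise_filterMap]
    refine hσ.2.imp fun {x y} hxy o ho o' ho' => ?_
    rintro ⟨y', x', hy', hx', he⟩
    rw [lab_inj hn hy' ho', lab_inj hn hx' ho] at he
    exact hxy he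
  refine ⟨hperm.nodup_iff.2 hn, fun o => hperm.mem_iff, ?_⟩
  have hstep : ∀ pre suf o o', σ.filterMap t.lab = pre ++ o' :: suf → OEdge f Fire.rules t o o' →
      o ∈ pre := by
    intro pre suf o o' h he
    have hmem : o ∈ pre ++ o' :: suf := by
      rw [← h, hperm.mem_iff, mem_ops_iff]
      obtain ⟨x, _, hx, _⟩ := he
      exact ⟨x, hx⟩
    rw [h, List.pairwise_append, List.pairwise_cons] at hpw
    rcases List.mem_append.1 hmem with hmem | hmem
    · exact hmem
    · rcases List.mem_cons.1 hmem with rfl | hmem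
      · obtain ⟨x, y, hx, hy, hxy⟩ := he
        exact absurd (lab_inj hn hx hy) hxy.ne
      · exact absurd he (hpw.2.1.1 _ hmem)
  intro pre suf o o' h hp
  induction hp generalizing pre suf with
  | single he => exact hstep _ _ _ _ h he
  | tail _ he ih =>
    obtain ⟨l₁, l₂, rfl⟩ := List.append_of_mem (hstep _ _ _ _ h he)
    have := ih l₁ (l₂ ++ _ :: suf) (by rw [h]; simp; rfl)
    simp [this]

theorem solves_gapTree (m n : ℕ) :
    ((gapTree Fire.slots (gapExp m n)).toTree (opCode m n)).Solves Fire.rules m n (rowMajor n) := by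
  intro σ hσ
  have hcode : σ.flatMap ((gapTree Fire.slots (gapExp m n)).toTree (opCode m n)).code =
      (σ.filterMap (gapTree Fire.slots (gapExp m n)).lab).flatMap (opCode m n) := by
    have hmem : ∀ x ∈ σ, ∃ o, (gapTree Fire.slots (gapExp m n)).lab x = some o := fun x hx =>
      (mem_strands_iff (opCode m n) _ x).1 (hσ.1.mem_iff.1 hx)
    clear hσ
    induction σ with
    | nil => rfl
    | cons x σ ih =>
      obtain ⟨o, ho⟩ := hmem x (by simp)
      rw [List.flatMap_cons, ih fun y hy => hmem y (List.mem_cons_of_mem _ hy), code_eq _ ho,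
        List.filterMap_cons_some ho, List.flatMap_cons]
  rw [hcode]
  exact (ordered_of_isSchedule hσ).seriallySolves (lt_two_pow_gapExp m n).1
    (lt_two_pow_gapExp m n).2

/-! ## Race freedom -/

theorem dst_of_mem_opCode {m n : ℕ} {o : Op} {A : Assign ℕ} (h : A ∈ opCode m n o) :
    o.cell.2 ≤ n ∧ A.dst = rowMajor n o.cell.1 o.cell.2 := by
  unfold opCode at h
  split_ifs at h with h1 h2
  · simp at h
  · simp at h
  · refine ⟨by omega, ?_⟩
    cases o <;> simp only [] at h <;> (try split_ifs at h) <;> simp at h <;> subst h <;> rfl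

/-- Every word accessed is either the task's own cell or a cell already closed by its `T`. Both the
absence of races and the bound on the addresses rest on this. -/
theorem mem_trace_opCode {m n K : ℕ} {o : Op} (ho : o ∈ (gapTree Fire.slots K).ops) {a : ℕ}
    (h : a ∈ traceList (opCode m n o)) : (o.cell.1 ≤ m ∧ o.cell.2 ≤ n) ∧
      (a = rowMajor n o.cell.1 o.cell.2 ∨ ∃ i j, i ≤ m ∧ j ≤ n ∧ a = rowMajor n i j ∧
        ∀ f, Prec f K (.T i j) o) := by
  have hlt := (mem_cons_cellOps ho (i := o.cell.1) (j := o.cell.2) rfl).1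
  unfold opCode at h
  split_ifs at h with h1 h2
  · simp [traceList] at h
  · simp [traceList] at h
  · refine ⟨by omega, ?_⟩
    cases o with
    | I i j =>
      simp only [] at h
      split_ifs at h <;> simp [traceList, Assign.trace, Val.reads] at h <;> exact .inl h
    | T i j =>
      simp only [] at h
      split_ifs at h with h3 h4
      · simp [traceList] at h
      · simp [traceList] at h
      · simp [traceList, Assign.trace, Val.reads] at h
        rcases h with h | h | h
        · exact .inl h
        · simp only [Op.cell] at *
          refine .inr ⟨i - 1, j - 1, by omega, by omega, h, fun f => ?_⟩
          have := prec_diag (f := f) (i := i - 1) (j := j - 1) (K := K) (by omega) (by omega)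
          rwa [Nat.sub_add_cancel (by omega), Nat.sub_add_cancel (by omega)] at this
        · exact .inl h
    | H i j d =>
      simp [traceList, Assign.trace, Val.reads] at h
      have hd : d < j := by
        simpa [InTri] using ((mem_gapTree.1 ho).resolve_left (by simp)).2.2
      simp only [Op.cell] at *
      rcases h with h | h | h
      · exact .inl h
      · exact .inr ⟨i, d, by omega, by omega, h, fun f => prec_H hlt.1 hlt.2 hd⟩
      · exact .inl h
    | V i j d =>
      simp [traceList, Assign.trace, Val.reads] at h
      have hd : d < i := by
        simpa [InTri] using ((mem_gapTree.1 ho).resolve_left (by simp)).2.2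
      simp only [Op.cell] at *
      rcases h with h | h | h
      · exact .inl h
      · exact .inr ⟨d, j, by omega, by omega, h, fun f => prec_V hlt.1 hlt.2 hd⟩
      · exact .inl h

/-- Two tasks at the same cell are comparable. If the other task reads the cell from outside, it
comes after the `T` of the cell, and every task that writes the cell precedes or equals this `T`. -/
theorem raceFree_gapTree (m n K : ℕ) :
    ((gapTree Fire.slots K).toTree (opCode m n)).RaceFree Fire.rules := by
  intro x hx y hy hxy A hA hdst
  obtain ⟨o, ho⟩ := (mem_strands_iff _ _ _).1 hx
  obtain ⟨o', ho'⟩ := (mem_strands_iff _ _ _).1 hy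
  have hm := (mem_ops_iff _ _).2 ⟨x, ho⟩
  have hm' := (mem_ops_iff _ _).2 ⟨y, ho'⟩
  have hn := nodup_gapTree Fire.slots K
  rw [code_eq _ ho] at hA
  rw [code_eq _ ho'] at hdst
  have hne : o ≠ o' := by
    rintro rfl
    exact hxy (lab_inj hn ho ho')
  obtain ⟨hn1, hd⟩ := dst_of_mem_opCode hA
  rw [hd] at hdst
  obtain ⟨⟨h1, h2⟩, h | ⟨i, j, hi, hj, h, hp⟩⟩ := mem_trace_opCode hm' hdst
  · obtain ⟨e1, e2⟩ := rowMajor_inj hn1 h2 h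
    exact (prec_or_prec (f := opCode m n) hm hm' (Prod.ext e1 e2) hne).imp
      (fun h => transGen_edge hn h ho ho') (fun h => transGen_edge hn h ho' ho)
  · obtain ⟨e1, e2⟩ := rowMajor_inj hn1 hj h
    refine .inl (transGen_edge hn ?_ ho ho')
    by_cases hT : o = .T i j
    · rw [hT]; exact hp _
    · exact (prec_T hm (Prod.ext e1 e2) hT).trans (hp _)

end Schedule

/-! ## Cache misses -/

/-- The accesses `tr`, followed by any others, cause at most `b` additional misses, from whatever
state of the cache. -/
def MissesLE (Z : ℕ) (tr : List ℕ) (b : ℕ) : Prop :=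
  ∀ (l : List ℕ) (b' : ℕ), (∀ S, ∃ q ≤ b', CacheRun Z S l q) →
    ∀ S, ∃ q ≤ b + b', CacheRun Z S (tr ++ l) q

namespace MissesLE

variable {Z : ℕ}

theorem append {tr tr' : List ℕ} {b b' : ℕ} (h : MissesLE Z tr b) (h' : MissesLE Z tr' b') :
    MissesLE Z (tr ++ tr') (b + b') := by
  intro l c hl S
  rw [List.append_assoc, add_assoc]
  exact h _ _ (h' l c hl) S

theorem mono {tr : List ℕ} {b b' : ℕ} (h : MissesLE Z tr b) (hb : b ≤ b') : MissesLE Z tr b' := by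
  intro l c hl S
  obtain ⟨q, hq, hr⟩ := h l c hl S
  exact ⟨q, by omega, hr⟩

theorem exists_cacheRun {tr : List ℕ} {b : ℕ} (h : MissesLE Z tr b) :
    ∃ q ≤ b, CacheRun Z ∅ tr q := by
  simpa using h [] 0 (fun S => ⟨0, le_rfl, .nil S⟩) ∅

/-- If all lines that are accessed fit into the cache, then each of them is missed at most once. -/
theorem of_subset {F : Finset ℕ} (hF : F.card ≤ Z) {tr : List ℕ} (h : ∀ x ∈ tr, x ∈ F) :
    MissesLE Z tr F.card := by
  intro l b hl
  -- The lines of `F` that are not in the cache are counted; a hit leaves this number unchanged and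
  -- a miss lowers it by one.
  have key : ∀ S, ∃ q ≤ (F \ S).card + b, CacheRun Z S (tr ++ l) q := by
    induction tr with
    | nil =>
      intro S
      obtain ⟨q, hq, hr⟩ := hl S
      exact ⟨q, by omega, hr⟩
    | cons x tr ih =>
      intro S
      have hx := h x (by simp)
      have ih := ih fun y hy => h y (by simp [hy])
      by_cases hxS : x ∈ S
      · obtain ⟨q, hq, hr⟩ := ih S
        exact ⟨q, hq, .hit hxS hr⟩
      -- All lines outside `F` are evicted. What remains is a subset of `F` and fits, even if the
      -- initial state exceeded the capacity.
      · obtain ⟨q, hq, hr⟩ := ih (insert x (S ∩ F))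
        refine ⟨q + 1, ?_, .miss hxS (Finset.insert_subset_insert _ Finset.inter_subset_left)
          (Finset.mem_insert_self _ _) ((Finset.card_le_card ?_).trans hF) hr⟩
        · have h1 : F \ insert x (S ∩ F) = (F \ S).erase x := by ext; simp; tauto
          have h2 := Finset.card_erase_add_one (Finset.mem_sdiff.2 ⟨hx, hxS⟩)
          rw [h1] at hq
          omega
        · exact Finset.insert_subset hx Finset.inter_subset_right
  intro S
  obtain ⟨q, hq, hr⟩ := key S
  exact ⟨q, hq.trans (Nat.add_le_add_right (Finset.card_le_card Finset.sdiff_subset) _), hr⟩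

theorem length (hZ : 1 ≤ Z) (tr : List ℕ) : MissesLE Z tr tr.length := by
  induction tr with
  | nil => exact fun l b hl S => by simpa using hl S
  | cons x tr ih =>
    have := (of_subset (Z := Z) (F := {x}) (tr := [x]) (by simpa using hZ) (by simp)).append ih
    rw [List.length_cons, add_comm]
    simpa using this

end MissesLE

/-- The lines that are accessed. -/
def lineTrace (B : ℕ) (L : List (Assign ℕ)) : List ℕ := (traceList L).map (fun a => a / B)

theorem lineTrace_append (B : ℕ) (L L' : List (Assign ℕ)) :
    lineTrace B (L ++ L') = lineTrace B L ++ lineTrace B L' := by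
  simp [lineTrace, traceList]

/-- The lines of the cells in a square with side `s` and top-left cell `(r, c)`. -/
def squareLines (n B r c s : ℕ) : Finset ℕ :=
  (Finset.range s).biUnion fun x =>
    Finset.Icc (rowMajor n (r + x) c / B) ((rowMajor n (r + x) c + s) / B)

/-- In each row, `s + 1` consecutive words meet at most `s / B + 2` lines, whatever their alignment.
-/
theorem card_squareLines_le (n B r c s : ℕ) :
    (squareLines n B r c s).card ≤ s * (s / B + 2) := by
  rw [squareLines]
  refine Finset.card_biUnion_le.trans ?_
  refine (Finset.sum_le_card_nsmul _ _ (s / B + 2) fun x _ => ?_).trans (by simp)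
  rw [Nat.card_Icc]
  rcases Nat.eq_zero_or_pos B with rfl | hB
  · simp
  · have := Nat.add_div (a := rowMajor n (r + x) c) (b := s) hB
    generalize s / B = u at *
    generalize rowMajor n (r + x) c / B = v at *
    split_ifs at this <;> omega

theorem mem_squareLines {n B r c s i j : ℕ} (hi : r ≤ i ∧ i < r + s) (hj : c ≤ j ∧ j < c + s) :
    rowMajor n i j / B ∈ squareLines n B r c s := by
  simp only [squareLines, Finset.mem_biUnion, Finset.mem_range, Finset.mem_Icc]
  refine ⟨i - r, by omega, ?_⟩
  rw [show r + (i - r) = i by omega]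
  unfold rowMajor
  exact ⟨Nat.div_le_div_right (by omega), Nat.div_le_div_right (by omega)⟩

theorem mem_trace_opCode_cases {m n : ℕ} {o : Op} {a : ℕ} (h : a ∈ traceList (opCode m n o)) :
    a = rowMajor n o.cell.1 o.cell.2 ∨
      match o with
      | .I _ _ => False
      | .T i j => a = rowMajor n (i - 1) (j - 1)
      | .H i _ d => a = rowMajor n i d
      | .V _ j d => a = rowMajor n d j := by
  unfold opCode at h
  split_ifs at h with h1 h2
  · simp [traceList] at h
  · simp [traceList] at h
  · cases o <;> simp only [] at h <;> (try split_ifs at h) <;>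
      simp [traceList, Assign.trace, Val.reads] at h <;> simp only [Op.cell] <;> tauto

theorem mem_lineTrace {m n B : ℕ} {l : List Op} {x : ℕ}
    (h : x ∈ lineTrace B (l.flatMap (opCode m n))) :
    ∃ o ∈ l, ∃ a ∈ traceList (opCode m n o), x = a / B := by
  simp only [lineTrace, traceList, List.mem_map, List.mem_flatMap] at h
  obtain ⟨a, ⟨A, ⟨o, ho, hA⟩, ha⟩, rfl⟩ := h
  exact ⟨o, ho, a, List.mem_flatMap.2 ⟨A, hA, ha⟩, rfl⟩

theorem length_traceList_opCode_le (m n : ℕ) (o : Op) : (traceList (opCode m n o)).length ≤ 3 := by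
  unfold opCode
  cases o <;> simp only [] <;> split_ifs <;> simp [traceList, Assign.trace, Val.reads]

theorem length_lineTrace_le (m n B : ℕ) (l : List Op) :
    (lineTrace B (l.flatMap (opCode m n))).length ≤ 3 * l.length := by
  induction l with
  | nil => simp [lineTrace, traceList]
  | cons o l ih =>
    rw [List.flatMap_cons, lineTrace_append, List.length_append, List.length_cons]
    have : (lineTrace B (opCode m n o)).length ≤ 3 := by
      rw [lineTrace, List.length_map]; exact length_traceList_opCode_le m n o
    omega

namespace OTree

variable {φ : Type} (s : Slots φ) (m n B Z : ℕ)

/-- Misses of the serial execution of a labelled tree. -/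
def Misses (t : OTree φ) (b : ℕ) : Prop :=
  MissesLE Z (lineTrace B (t.ops.flatMap (opCode m n))) b

variable {m n B Z}

theorem Misses.node {c : Comp φ} {t u : OTree φ} {b b' : ℕ} (ht : Misses m n B Z t b)
    (hu : Misses m n B Z u b') : Misses m n B Z (.node c t u) (b + b') := by
  rw [Misses, ops, List.flatMap_append, lineTrace_append]
  exact ht.append hu

theorem Misses.of_subset {t : OTree φ} {F : Finset ℕ} {b : ℕ} (hZ : b ≤ Z) (hF : F.card ≤ b)
    (h : ∀ o ∈ t.ops, ∀ a ∈ traceList (opCode m n o), a / B ∈ F) : Misses m n B Z t b := by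
  refine (MissesLE.of_subset (hF.trans hZ) fun x hx => ?_).mono hF
  obtain ⟨o, ho, a, ha, rfl⟩ := mem_lineTrace hx
  exact h o ho a ha

/-- A bound for the number of lines that are accessed in blocks of side `2 ^ k`. -/
def blockLines (B k : ℕ) : ℕ := 2 * ((2 ^ k + 1) * ((2 ^ k + 1) / B + 2))

theorem misses_initTree_base {k : ℕ} (hZ : blockLines B k ≤ Z) (r c : ℕ) :
    Misses m n B Z (initTree k r c : OTree φ) (blockLines B k) := by
  refine .of_subset (F := squareLines n B r c (2 ^ k + 1)) hZ ?_ fun o ho a ha => ?_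
  · exact (card_squareLines_le _ _ _ _ _).trans (by unfold blockLines; omega)
  · obtain ⟨i, j, h, rfl⟩ := (mem_initTree _ _ _ _).1 ho
    rcases mem_trace_opCode_cases ha with rfl | h'
    · simp only [InBlock] at h
      exact mem_squareLines (by simp only [Op.cell]; omega) (by simp only [Op.cell]; omega)
    · exact h'.elim

theorem misses_boxTree_base {mk : ℕ → ℕ → ℕ → Op} (hmk : mk = .H ∨ mk = .V) (c₀ : Comp φ) {k : ℕ}
    (hZ : blockLines B k ≤ Z) (r c d : ℕ) :
    Misses m n B Z (boxTree mk c₀ k r c d) (blockLines B k) := by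
  rcases hmk with rfl | rfl
  · refine .of_subset (F := squareLines n B r c (2 ^ k + 1) ∪ squareLines n B r d (2 ^ k + 1))
      hZ ?_ fun o ho a ha => ?_
    · have h1 := card_squareLines_le n B r c (2 ^ k + 1)
      have h2 := card_squareLines_le n B r d (2 ^ k + 1)
      exact (Finset.card_union_le _ _).trans (by unfold blockLines; omega)
    · obtain ⟨i, j, e, h, he, rfl⟩ := (mem_boxTree _ _ _ _ _ _ _).1 ho
      simp only [InBlock] at h
      rcases mem_trace_opCode_cases ha with rfl | h'
      · exact Finset.mem_union_left _
          (mem_squareLines (by simp only [Op.cell]; omega) (by simp only [Op.cell]; omega))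
      · simp only [] at h'
        rw [h']
        exact Finset.mem_union_right _ (mem_squareLines (by omega) (by omega))
  · refine .of_subset (F := squareLines n B r c (2 ^ k + 1) ∪ squareLines n B d c (2 ^ k + 1))
      hZ ?_ fun o ho a ha => ?_
    · have h1 := card_squareLines_le n B r c (2 ^ k + 1)
      have h2 := card_squareLines_le n B d c (2 ^ k + 1)
      exact (Finset.card_union_le _ _).trans (by unfold blockLines; omega)
    · obtain ⟨i, j, e, h, he, rfl⟩ := (mem_boxTree _ _ _ _ _ _ _).1 ho
      simp only [InBlock] at h
      rcases mem_trace_opCode_cases ha with rfl | h'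
      · exact Finset.mem_union_left _
          (mem_squareLines (by simp only [Op.cell]; omega) (by simp only [Op.cell]; omega))
      · simp only [] at h'
        rw [h']
        exact Finset.mem_union_right _ (mem_squareLines (by omega) (by omega))

/-- Diagonal steps also read the row above and the column to the left of the block, so the square
has its corner at `(r - 1, c - 1)` and side `2 ^ k + 1`. At the border of the table the truncated
subtraction does no harm. -/
theorem misses_triTree_base {k : ℕ} (hZ : blockLines B k ≤ Z) (r c : ℕ) :
    Misses m n B Z (triTree s k r c) (blockLines B k) := by
  refine .of_subset (F := squareLines n B (r - 1) (c - 1) (2 ^ k + 1)) hZ ?_ fun o ho a ha => ?_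
  · exact (card_squareLines_le _ _ _ _ _).trans (by unfold blockLines; omega)
  · have h := (mem_triTree _ _ _ _ _).1 ho
    rcases mem_trace_opCode_cases ha with rfl | h'
    · cases o <;> simp only [InTri, InBlock] at h <;>
        exact mem_squareLines (by simp only [Op.cell]; omega) (by simp only [Op.cell]; omega)
    · cases o <;> simp only [InTri, InBlock] at h h' <;> rw [h'] <;>
        exact mem_squareLines (by omega) (by omega)

theorem misses_initTree {k e : ℕ} (hZ : blockLines B k ≤ Z) (r c : ℕ) :
    Misses m n B Z (initTree (k + e) r c : OTree φ) (4 ^ e * blockLines B k) := by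
  induction e generalizing r c with
  | zero => simpa using misses_initTree_base hZ r c
  | succ e ih =>
    have := ((ih r c).node (c := .par) (ih r (c + 2 ^ (k + e)))).node (c := .par)
      ((ih (r + 2 ^ (k + e)) c).node (c := .par) (ih (r + 2 ^ (k + e)) (c + 2 ^ (k + e))))
    rw [← add_assoc, initTree]
    refine this.mono (le_of_eq ?_)
    ring

theorem misses_boxTree {mk : ℕ → ℕ → ℕ → Op} (hmk : mk = .H ∨ mk = .V) (c₀ : Comp φ) {k e : ℕ}
    (hZ : blockLines B k ≤ Z) (r c d : ℕ) :
    Misses m n B Z (boxTree mk c₀ (k + e) r c d) (8 ^ e * blockLines B k) := by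
  induction e generalizing r c d with
  | zero => simpa using misses_boxTree_base hmk c₀ hZ r c d
  | succ e ih =>
    have key := fun r c => (ih r c d).node (c := c₀) (ih r c (d + 2 ^ (k + e)))
    have := ((key r c).node (c := .par) (key r (c + 2 ^ (k + e)))).node (c := .par)
      ((key (r + 2 ^ (k + e)) c).node (c := .par) (key (r + 2 ^ (k + e)) (c + 2 ^ (k + e))))
    rw [← add_assoc, boxTree]
    refine this.mono (le_of_eq ?_)
    ring

/-- A triangle splits into four triangles and four boxes of half the side, and a box into eight
boxes; in both cases there are `8 ^ e` base pieces. -/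
theorem misses_triTree {k e : ℕ} (hZ : blockLines B k ≤ Z) (r c : ℕ) :
    Misses m n B Z (triTree s (k + e) r c) (8 ^ e * blockLines B k) := by
  induction e generalizing r c with
  | zero => simpa using misses_triTree_base s hZ r c
  | succ e ih =>
    have hH := fun r c d => misses_boxTree (m := m) (n := n) (e := e) (mk := .H) (.inl rfl)
      s.hh hZ r c d
    have hV := fun r c d => misses_boxTree (m := m) (n := n) (e := e) (mk := .V) (.inr rfl)
      s.vv hZ r c d
    rw [← add_assoc, triTree]
    refine MissesLE.mono (((ih _ _).node (((hH _ _ _).node (ih _ _)).node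
      ((hV _ _ _).node (ih _ _)))).node (((hV _ _ _).node (hH _ _ _)).node (ih _ _))) (le_of_eq ?_)
    ring

theorem misses_gapTree {k K : ℕ} (hk : k ≤ K) (hZ : blockLines B k ≤ Z) :
    Misses m n B Z (gapTree s K) (2 * 8 ^ (K - k) * blockLines B k) := by
  obtain ⟨e, rfl⟩ := Nat.exists_eq_add_of_le hk
  rw [Nat.add_sub_cancel_left]
  refine MissesLE.mono ((misses_initTree hZ 0 0).node (misses_triTree s hZ 0 0)) ?_
  rw [mul_assoc, two_mul]
  exact Nat.add_le_add_right (Nat.mul_le_mul_right _ (Nat.pow_le_pow_left (by norm_num) _)) _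

end OTree

section Bounds

/-! ## Bounds in terms of the dimensions -/

open OTree

/-- The exponent is minimal, so half the side is at most `max m n`. -/
theorem two_pow_gapExp_le {m n κ : ℕ} (hn : 2 ≤ n) (hm : m ≤ κ * n) :
    2 ^ gapExp m n ≤ 2 * (κ + 1) * n := by
  have hmax : max m n ≤ (κ + 1) * n := max_le (hm.trans (by nlinarith)) (by nlinarith)
  rcases Nat.eq_zero_or_pos (gapExp m n) with h | h
  · rw [h, pow_zero]; nlinarith
  · obtain ⟨e, he⟩ : ∃ e, gapExp m n = e + 1 := ⟨gapExp m n - 1, by omega⟩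
    have := two_pow_le_of_lt_gapExp m n (show e < gapExp m n by omega)
    rw [he, pow_succ]
    nlinarith

theorem work_gapTree_le (m n K : ℕ) :
    ((gapTree Fire.slots K).toTree (opCode m n)).work ≤ 14 * (2 ^ K) ^ 3 := by
  rw [work_eq]
  have h1 : ((gapTree Fire.slots K).ops.map fun o => workList (opCode m n o) + 1).sum ≤
      (gapTree Fire.slots K).ops.length * 7 := by
    rw [← List.length_map (f := fun o => workList (opCode m n o) + 1), ← smul_eq_mul]
    refine List.sum_le_card_nsmul _ _ fun c hc => ?_
    obtain ⟨o, _, rfl⟩ := List.mem_map.1 hc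
    have := workList_opCode_le m n o
    omega
  have h2 := length_gapTree_le Fire.slots K
  have h3 : (2 ^ K) ^ 3 = 8 ^ K := by rw [← pow_mul, mul_comm, pow_mul]; norm_num
  omega

theorem rowMajor_lt {m n i j : ℕ} (hi : i ≤ m) (hj : j ≤ n) :
    rowMajor n i j < (m + 1) * (n + 1) := by
  unfold rowMajor
  nlinarith

theorem mem_trace_gapTree {m n K a : ℕ} {o : Op} (ho : o ∈ (gapTree Fire.slots K).ops)
    (ha : a ∈ traceList (opCode m n o)) : a < (m + 1) * (n + 1) := by
  obtain ⟨⟨h1, h2⟩, rfl | ⟨i, j, hi, hj, rfl, -⟩⟩ := mem_trace_opCode ho ha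
  · exact rowMajor_lt h1 h2
  · exact rowMajor_lt hi hj

theorem space_gapTree_le (m n K : ℕ) :
    ((gapTree Fire.slots K).toTree (opCode m n)).space ≤ (m + 1) * (n + 1) := by
  rw [Tree.space, serial_eq]
  calc _ ≤ (Finset.range ((m + 1) * (n + 1))).card := by
        refine Finset.card_le_card fun a ha => ?_
        rw [footprint, List.mem_toFinset, traceList, List.mem_flatMap] at ha
        obtain ⟨A, hA, ha⟩ := ha
        obtain ⟨o, ho, hA⟩ := List.mem_flatMap.1 hA
        exact Finset.mem_range.2 (mem_trace_gapTree ho (List.mem_flatMap.2 ⟨A, hA, ha⟩))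
    _ = _ := Finset.card_range _

/-- A side for which the blocks fit into the cache. -/
theorem exists_block {M B τ : ℕ} (hτ : 1 ≤ τ) (hB : 1 ≤ B) (hBM : B ^ 2 ≤ τ * M)
    (hM : 256 * τ ≤ M) : ∃ k, 256 * τ * (2 ^ k) ^ 2 ≤ M ∧ M < 1024 * τ * (2 ^ k) ^ 2 ∧
      blockLines B k ≤ M / B := by
  have hτ' : 0 < 256 * τ := by omega
  have h4 : ∀ k : ℕ, (2 ^ k) ^ 2 = 4 ^ k := fun k => by
    rw [← pow_mul, mul_comm, pow_mul]; norm_num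
  refine ⟨Nat.log 4 (M / (256 * τ)), ?_⟩
  set k := Nat.log 4 (M / (256 * τ))
  have h1 : 4 ^ k ≤ M / (256 * τ) :=
    Nat.pow_log_le_self 4 (Nat.div_pos hM hτ').ne'
  have h2 : M / (256 * τ) < 4 ^ (k + 1) := Nat.lt_pow_succ_log_self (by norm_num) _
  have h1' : 256 * τ * (2 ^ k) ^ 2 ≤ M := by
    rw [h4, mul_comm]; exact (Nat.le_div_iff_mul_le hτ').1 h1
  have h2' : M < 1024 * τ * (2 ^ k) ^ 2 := by
    rw [Nat.div_lt_iff_lt_mul hτ', pow_succ] at h2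
    rw [h4]; linarith
  refine ⟨h1', h2', ?_⟩
  rw [Nat.le_div_iff_mul_le hB]
  have hl : 1 ≤ 2 ^ k := Nat.one_le_two_pow
  unfold blockLines
  set l := 2 ^ k
  have h3 : (l + 1) / B * B ≤ l + 1 := Nat.div_mul_le_self _ _
  -- This is where the tall cache enters: it makes `l * B` of order `M`, so that the two partial
  -- lines per row also fit.
  have h5 : 8 * l * B * 2 ≤ M := by
    have h6 : (8 * l * B * 2) ^ 2 ≤ M ^ 2 := by
      calc (8 * l * B * 2) ^ 2 = 256 * l ^ 2 * B ^ 2 := by ring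
        _ ≤ 256 * l ^ 2 * (τ * M) := Nat.mul_le_mul_left _ hBM
        _ = (256 * τ * l ^ 2) * M := by ring
        _ ≤ M * M := Nat.mul_le_mul_right _ h1'
        _ = M ^ 2 := by ring
    exact (Nat.pow_le_pow_iff_left (by norm_num)).1 h6
  have h6 : 256 * l ^ 2 ≤ M := (Nat.mul_le_mul_right _ (by omega)).trans h1'
  calc 2 * ((l + 1) * ((l + 1) / B + 2)) * B
      = 2 * (l + 1) * ((l + 1) / B * B) + 4 * (l + 1) * B := by ring
    _ ≤ 2 * (l + 1) * (l + 1) + 4 * (l + 1) * B :=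
        Nat.add_le_add_right (Nat.mul_le_mul_left _ h3) _
    _ ≤ 8 * l ^ 2 + 8 * l * B := by nlinarith
    _ ≤ M := by omega

/-- For blocks of side comparable to √M, the tall cache gives `B ≤ 32 * τ * 2 ^ k`, so the partial
lines of the rows are absorbed into the area of the block divided by `B`. -/
theorem blockLines_le {M B τ k : ℕ} (hB : 1 ≤ B) (hBM : B ^ 2 ≤ τ * M)
    (hM : M < 1024 * τ * (2 ^ k) ^ 2) (hτ : 1 ≤ τ) :
    (blockLines B k : ℝ) ≤ 264 * τ * (2 ^ k) ^ 2 / B := by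
  have hl : (1 : ℝ) ≤ 2 ^ k := one_le_pow₀ (by norm_num)
  have hB' : (0 : ℝ) < B := by exact_mod_cast hB
  have hτ' : (1 : ℝ) ≤ τ := by exact_mod_cast hτ
  have hBl : (B : ℝ) ≤ 32 * τ * 2 ^ k := by
    have : B ≤ 32 * τ * 2 ^ k := by
      refine (Nat.pow_le_pow_iff_left (n := 2) (by norm_num)).1 ?_
      calc B ^ 2 ≤ τ * M := hBM
        _ ≤ τ * (1024 * τ * (2 ^ k) ^ 2) := Nat.mul_le_mul_left _ hM.le
        _ = (32 * τ * 2 ^ k) ^ 2 := by ring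
    exact_mod_cast this
  have hdiv : (((2 ^ k + 1) / B : ℕ) : ℝ) ≤ (2 ^ k + 1) / B := by
    refine Nat.cast_div_le.trans ?_
    push_cast; exact le_rfl
  rw [le_div_iff₀ hB']
  unfold blockLines
  push_cast
  have h1 : (((2 ^ k + 1) / B : ℕ) : ℝ) * B ≤ 2 ^ k + 1 := (le_div_iff₀ hB').1 hdiv
  set l : ℝ := 2 ^ k
  have h2 : 2 * ((l + 1) * ((((2 ^ k + 1) / B : ℕ) : ℝ) + 2)) * B =
      2 * (l + 1) * ((((2 ^ k + 1) / B : ℕ) : ℝ) * B) + 4 * (l + 1) * B := by ring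
  rw [h2]
  have h3 : 2 * (l + 1) * ((((2 ^ k + 1) / B : ℕ) : ℝ) * B) ≤ 2 * (l + 1) * (l + 1) :=
    mul_le_mul_of_nonneg_left h1 (by linarith)
  have h4 : 4 * (l + 1) * B ≤ 8 * l * (32 * τ * l) :=
    mul_le_mul (by linarith) hBl hB'.le (by linarith)
  have h5 : 2 * (l + 1) * (l + 1) ≤ 8 * l ^ 2 := by nlinarith
  have h6 : 8 * l ^ 2 ≤ 8 * τ * l ^ 2 := by nlinarith [sq_nonneg l]
  nlinarith

/-! ### Cache misses in the different ranges of the cache size -/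

section Cache

variable {m n M B κ τ : ℕ}

theorem cacheMissesLE_of_misses {K b : ℕ} {c : ℝ}
    (h : Misses m n B (M / B) (gapTree Fire.slots K) b) (hb : (b : ℝ) ≤ c) :
    CacheMissesLE M B ((gapTree Fire.slots K).toTree (opCode m n)).serial c := by
  obtain ⟨q, hq, hr⟩ := MissesLE.exists_cacheRun h
  refine ⟨q, ?_, (Nat.cast_le.2 hq).trans hb⟩
  rw [serial_eq]
  exact hr

theorem misses_gapTree_trivial (hB : 1 ≤ B) (hBM : B ≤ M) (K : ℕ) :
    Misses m n B (M / B) (gapTree Fire.slots K) (6 * (2 ^ K) ^ 3) := by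
  refine (MissesLE.length (Nat.div_pos hBM hB) _).mono ((length_lineTrace_le _ _ _ _).trans ?_)
  have h2 := length_gapTree_le Fire.slots K
  have h3 : (2 ^ K) ^ 3 = 8 ^ K := by rw [← pow_mul, mul_comm, pow_mul]; norm_num
  omega

theorem misses_gapTree_of_fits (hB : 1 ≤ B) (hBM : B ≤ M) (hM : 2 * ((m + 1) * (n + 1)) ≤ M)
    (K : ℕ) :
    Misses m n B (M / B) (gapTree Fire.slots K) ((m + 1) * (n + 1) / B + 1) := by
  set A := (m + 1) * (n + 1)
  have hA : 1 ≤ A := Nat.mul_pos (by omega) (by omega)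
  refine MissesLE.mono (b := (A - 1) / B + 1) ?_
    (Nat.add_le_add_right (Nat.div_le_div_right (by omega)) _)
  refine Misses.of_subset (F := Finset.range ((A - 1) / B + 1)) ?_ (by simp) fun o ho a ha => ?_
  · rw [Nat.le_div_iff_mul_le hB]
    rcases le_or_gt B (A - 1) with h | h
    · have := Nat.div_mul_le_self (A - 1) B
      rw [Nat.add_mul, one_mul]
      omega
    · rw [Nat.div_eq_of_lt h]
      omega
  · have := mem_trace_gapTree ho ha
    rw [Finset.mem_range, Nat.lt_succ_iff]
    exact Nat.div_le_div_right (by omega)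

/-- At most `2 * 8 ^ (K - k)` pieces miss at most `264 * τ * 4 ^ k / B` lines each. Since √M is at
most `32 * τ * 2 ^ k`, the constant is 2 · 264 · 32 = 16896. -/
theorem cacheMissesLE_of_block {k K : ℕ} (hk : k ≤ K) (hτ : 1 ≤ τ) (hB : 1 ≤ B)
    (hBM : B ^ 2 ≤ τ * M) (hM : M < 1024 * τ * (2 ^ k) ^ 2) (hZ : blockLines B k ≤ M / B)
    (hM0 : 1 ≤ M) :
    CacheMissesLE M B ((gapTree Fire.slots K).toTree (opCode m n)).serial
      (16896 * τ ^ 2 * ((2 ^ K) ^ 3 / (B * √M))) := by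
  refine cacheMissesLE_of_misses (misses_gapTree Fire.slots hk hZ) ?_
  have hl : (0 : ℝ) < 2 ^ k := by positivity
  have hB' : (0 : ℝ) < B := by exact_mod_cast hB
  have hM' : (0 : ℝ) < √M := Real.sqrt_pos.2 (by exact_mod_cast hM0)
  have hτ' : (1 : ℝ) ≤ τ := by exact_mod_cast hτ
  have h1 := blockLines_le hB hBM hM hτ
  have hsqrt : √(M : ℝ) ≤ 32 * τ * 2 ^ k := by
    rw [Real.sqrt_le_left (by positivity)]
    have h2 : (M : ℝ) ≤ 1024 * τ * (2 ^ k) ^ 2 := by exact_mod_cast hM.le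
    have h3 : (τ : ℝ) ≤ τ ^ 2 := by nlinarith
    nlinarith [sq_nonneg ((2 : ℝ) ^ k)]
  have h8 : (8 : ℝ) ^ (K - k) = (2 ^ K) ^ 3 / (2 ^ k) ^ 3 := by
    rw [eq_div_iff (by positivity)]
    have e : ∀ a : ℕ, ((2 : ℝ) ^ a) ^ 3 = 8 ^ a := fun a => by
      rw [← pow_mul, mul_comm, pow_mul]; norm_num
    rw [e, e, ← pow_add, Nat.sub_add_cancel hk]
  push_cast
  calc 2 * (8 : ℝ) ^ (K - k) * blockLines B k
      ≤ 2 * (8 : ℝ) ^ (K - k) * (264 * τ * (2 ^ k) ^ 2 / B) :=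
        mul_le_mul_of_nonneg_left h1 (by positivity)
    _ = 528 * τ * ((2 ^ K) ^ 3 / B) * (1 / 2 ^ k) := by
        rw [h8]; field_simp; ring
    _ ≤ 528 * τ * ((2 ^ K) ^ 3 / B) * (32 * τ / √M) := by
        refine mul_le_mul_of_nonneg_left ?_ (by positivity)
        rw [div_le_div_iff₀ hl hM']
        linarith
    _ = _ := by field_simp; ring

end Cache

theorem Tree.TimeLE.mono {φ : Type} {R : FireRules φ} {t : Tree φ} {a b : ℝ} (h : t.TimeLE R a)
    (hab : a ≤ b) : t.TimeLE R b :=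
  fun l hl hc => (h l hl hc).trans hab

theorem CacheMissesLE.mono {M B : ℕ} {L : List (Assign ℕ)} {a b : ℝ}
    (h : CacheMissesLE M B L a) (hab : a ≤ b) : CacheMissesLE M B L b :=
  let ⟨q, hq, hqa⟩ := h
  ⟨q, hq, hqa.trans hab⟩

theorem one_le_gapExp {m n : ℕ} (hn : 2 ≤ n) : 1 ≤ gapExp m n := by
  have h := (lt_two_pow_gapExp m n).2
  by_contra h0
  rw [Nat.lt_one_iff.1 (not_le.1 h0)] at h
  omega

theorem exists_timeLE_gapTree (κ : ℕ) : ∃ C : ℝ, 0 ≤ C ∧ ∀ m n : ℕ, 2 ≤ n → m ≤ κ * n →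
    ((gapTree Fire.slots (gapExp m n)).toTree (opCode m n)).TimeLE Fire.rules
      (C * ((n : ℝ) * Real.log n)) := by
  set c : ℝ := 2 * (κ + 1) with hc
  have hc1 : 1 ≤ c := by
    have : (0 : ℝ) ≤ κ := κ.cast_nonneg
    rw [hc]; linarith
  have hlc : 0 ≤ Real.log c := Real.log_nonneg hc1
  have hl2 : 0 < Real.log 2 := Real.log_pos (by norm_num)
  set A : ℝ := (Real.log c / Real.log 2 + 1) / Real.log 2 with hA
  have hA0 : 0 ≤ A := by positivity
  refine ⟨154 * A * c, by positivity, fun m n hn hm => timeLE_gapTree m n _ ?_⟩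
  have hN : ((2 : ℝ) ^ gapExp m n) ≤ c * n := by
    rw [hc]; exact_mod_cast two_pow_gapExp_le hn hm
  have hK : (1 : ℝ) ≤ gapExp m n := by exact_mod_cast one_le_gapExp hn
  have hn' : (2 : ℝ) ≤ n := by exact_mod_cast hn
  have hln : Real.log 2 ≤ Real.log n := Real.log_le_log (by norm_num) hn'
  have hKA : (gapExp m n : ℝ) ≤ A * Real.log n := by
    have h1 : gapExp m n * Real.log 2 ≤ Real.log c + Real.log n := by
      rw [← Real.log_pow, ← Real.log_mul (by positivity) (by positivity)]
      exact Real.log_le_log (by positivity) hN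
    have h2 : Real.log c ≤ Real.log c / Real.log 2 * Real.log n := by
      rw [div_mul_eq_mul_div, le_div_iff₀ hl2]
      exact mul_le_mul_of_nonneg_left hln hlc
    rw [hA, div_mul_eq_mul_div, le_div_iff₀ hl2]
    linarith
  have hN1 : (1 : ℝ) ≤ 2 ^ gapExp m n := one_le_pow₀ (by norm_num)
  push_cast
  set K : ℝ := ((gapExp m n : ℕ) : ℝ)
  set N : ℝ := 2 ^ gapExp m n
  have h3 : N ≤ K * N := by nlinarith
  have h4 : K * N ≤ A * Real.log n * (c * n) :=
    mul_le_mul hKA hN (by positivity) (by positivity)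
  -- Since `K` and `N` are at least one, the three terms together are at most 22 times `K * N`.
  calc 7 * (16 * K * N + 4 * N + 2) ≤ 154 * (K * N) := by linarith
    _ ≤ 154 * (A * Real.log n * (c * n)) := by linarith
    _ = _ := by ring

theorem exists_cacheMissesLE_gapTree (κ : ℕ) {τ : ℕ} (hτ : 1 ≤ τ) : ∃ C : ℝ, 0 ≤ C ∧
    ∀ m n : ℕ, 2 ≤ n → m ≤ κ * n → ∀ M B : ℕ, 1 ≤ B → B ≤ M → B ^ 2 ≤ τ * M →
      (M ≤ n ^ 2 → CacheMissesLE M B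
        ((gapTree Fire.slots (gapExp m n)).toTree (opCode m n)).serial
        (C * ((n : ℝ) ^ 3 / ((B : ℝ) * √(M : ℝ))))) ∧
      (n ^ 2 < M → CacheMissesLE M B
        ((gapTree Fire.slots (gapExp m n)).toTree (opCode m n)).serial
        (C * ((n : ℝ) ^ 2 / (B : ℝ) + 1))) := by
  set c : ℝ := 2 * (κ + 1) with hc
  set θ : ℝ := 256 * τ with hθ
  have hc0 : 1 ≤ c := by
    have : (0 : ℝ) ≤ κ := κ.cast_nonneg
    rw [hc]; linarith
  have hθ0 : 1 ≤ θ := by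
    have : (1 : ℝ) ≤ τ := by exact_mod_cast hτ
    rw [hθ]; linarith
  set C : ℝ := 6 * c ^ 3 * θ ^ 3 + 16896 * τ ^ 2 * c ^ 3 + c ^ 2 with hC
  have hC1 : 6 * c ^ 3 * θ ^ 3 ≤ C := by
    have : (0 : ℝ) ≤ 16896 * τ ^ 2 * c ^ 3 + c ^ 2 := by positivity
    linarith
  have hC2 : 16896 * τ ^ 2 * c ^ 3 ≤ C := by
    have : (0 : ℝ) ≤ 6 * c ^ 3 * θ ^ 3 + c ^ 2 := by positivity
    linarith
  have hC3 : c ^ 2 ≤ C := by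
    have : (0 : ℝ) ≤ 6 * c ^ 3 * θ ^ 3 + 16896 * τ ^ 2 * c ^ 3 := by positivity
    linarith
  have hC0 : 0 ≤ C := le_trans (by positivity) hC3
  refine ⟨C, hC0, fun m n hn hm M B hB hBM hBτ => ?_⟩
  have hN : ((2 : ℝ) ^ gapExp m n) ≤ c * n := by
    rw [hc]; exact_mod_cast two_pow_gapExp_le hn hm
  have hN3 : ((2 : ℝ) ^ gapExp m n) ^ 3 ≤ c ^ 3 * n ^ 3 := by
    rw [← mul_pow]; exact pow_le_pow_left₀ (by positivity) hN 3
  have hM1 : 1 ≤ M := hB.trans hBM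
  have hB' : (1 : ℝ) ≤ B := by exact_mod_cast hB
  have hM' : (1 : ℝ) ≤ M := by exact_mod_cast hM1
  have hn0 : (0 : ℝ) < n := by exact_mod_cast (by omega : 0 < n)
  have hs : (1 : ℝ) ≤ √(M : ℝ) := Real.one_le_sqrt.2 hM'
  have hBs : 0 < (B : ℝ) * √(M : ℝ) := by positivity
  -- Three regimes: a cache of bounded size, where even one miss per access is affordable; a cache
  -- that holds blocks of side `2 ^ k` with `k ≤ gapExp m n`; and a cache so large that the whole
  -- table fits.
  by_cases hMθ : M < 256 * τ
  · have hMθ' : (M : ℝ) ≤ θ := by rw [hθ]; exact_mod_cast hMθ.le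
    have key := misses_gapTree_trivial (m := m) (n := n) hB hBM (gapExp m n)
    constructor
    · intro _
      refine cacheMissesLE_of_misses key ?_
      push_cast
      have h1 : (B : ℝ) * √(M : ℝ) ≤ θ ^ 3 := by
        have h2 : √(M : ℝ) ≤ θ := by
          rw [Real.sqrt_le_left (by positivity)]
          nlinarith
        have h3 : (B : ℝ) ≤ θ := le_trans (by exact_mod_cast hBM) hMθ'
        calc (B : ℝ) * √(M : ℝ) ≤ θ * θ := mul_le_mul h3 h2 (by positivity) (by positivity)
          _ ≤ θ ^ 3 := by nlinarith [sq_nonneg θ]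
      rw [mul_div_assoc', le_div_iff₀ hBs]
      calc 6 * ((2 : ℝ) ^ gapExp m n) ^ 3 * (B * √(M : ℝ))
          ≤ 6 * (c ^ 3 * n ^ 3) * θ ^ 3 := by gcongr
        _ = 6 * c ^ 3 * θ ^ 3 * n ^ 3 := by ring
        _ ≤ C * n ^ 3 := by gcongr
    · intro hnM
      refine cacheMissesLE_of_misses key ?_
      push_cast
      have h1 : (n : ℝ) ≤ θ := by
        refine le_trans ?_ hMθ'
        exact_mod_cast (Nat.le_self_pow two_ne_zero n).trans hnM.le
      calc 6 * ((2 : ℝ) ^ gapExp m n) ^ 3 ≤ 6 * (c ^ 3 * n ^ 3) := by gcongr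
        _ ≤ 6 * (c ^ 3 * θ ^ 3) := by gcongr
        _ = 6 * c ^ 3 * θ ^ 3 * 1 := by ring
        _ ≤ C * ((n : ℝ) ^ 2 / B + 1) := by
          refine mul_le_mul hC1 ?_ (by norm_num) hC0
          have : (0 : ℝ) ≤ (n : ℝ) ^ 2 / B := by positivity
          linarith
  · obtain ⟨k, hk1, hk2, hk3⟩ := exists_block hτ hB hBτ (not_lt.1 hMθ)
    by_cases hk : k ≤ gapExp m n
    · have key := cacheMissesLE_of_block (m := m) (n := n) hk hτ hB hBτ hk2 hk3 hM1
      have hle : 16896 * (τ : ℝ) ^ 2 * (((2 : ℝ) ^ gapExp m n) ^ 3 / (B * √(M : ℝ))) ≤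
          C * ((n : ℝ) ^ 3 / ((B : ℝ) * √(M : ℝ))) := by
        rw [mul_div_assoc', mul_div_assoc', div_le_div_iff_of_pos_right hBs]
        calc 16896 * (τ : ℝ) ^ 2 * ((2 : ℝ) ^ gapExp m n) ^ 3
            ≤ 16896 * (τ : ℝ) ^ 2 * (c ^ 3 * n ^ 3) := by gcongr
          _ = 16896 * (τ : ℝ) ^ 2 * c ^ 3 * n ^ 3 := by ring
          _ ≤ C * n ^ 3 := by gcongr
      refine ⟨fun _ => key.mono hle, fun hnM => key.mono (hle.trans ?_)⟩
      refine mul_le_mul_of_nonneg_left ?_ hC0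
      have h1 : (n : ℝ) ≤ √(M : ℝ) := by
        rw [Real.le_sqrt' hn0]
        exact_mod_cast hnM.le
      -- When `n` is at most √M, the first bound is already stronger than the second.
      have h2 : (n : ℝ) ^ 3 / (B * √(M : ℝ)) ≤ n ^ 2 / B := by
        rw [div_le_div_iff₀ hBs (by positivity)]
        calc (n : ℝ) ^ 3 * B = n ^ 2 * B * n := by ring
          _ ≤ n ^ 2 * B * √(M : ℝ) := by gcongr
          _ = _ := by ring
      linarith
    · obtain ⟨hm2, hn2⟩ := lt_two_pow_gapExp m n
      have hA : (m + 1) * (n + 1) ≤ (2 ^ gapExp m n) ^ 2 := by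
        rw [sq]; exact Nat.mul_le_mul hm2 hn2
      have hKk : (2 ^ gapExp m n) ^ 2 ≤ (2 ^ k) ^ 2 :=
        Nat.pow_le_pow_left (Nat.pow_le_pow_right (by norm_num) (by omega)) 2
      have hkM : 256 * (2 ^ k) ^ 2 ≤ M :=
        (Nat.mul_le_mul_right _ (Nat.le_mul_of_pos_right 256 hτ)).trans hk1
      have hk0 : 0 < (2 ^ k) ^ 2 := by positivity
      constructor
      · intro hnM
        exfalso
        have : n ^ 2 ≤ (2 ^ gapExp m n) ^ 2 := Nat.pow_le_pow_left hn2.le 2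
        omega
      · intro _
        refine cacheMissesLE_of_misses
          (misses_gapTree_of_fits (m := m) (n := n) hB hBM (by omega) (gapExp m n)) ?_
        have hA' : (((m + 1) * (n + 1) : ℕ) : ℝ) ≤ c ^ 2 * n ^ 2 := by
          rw [← mul_pow]
          refine le_trans ?_ (pow_le_pow_left₀ (by positivity) hN 2)
          exact_mod_cast hA
        have hdiv : ((((m + 1) * (n + 1) / B : ℕ)) : ℝ) ≤ c ^ 2 * n ^ 2 / B :=
          Nat.cast_div_le.trans (by gcongr)
        calc (((m + 1) * (n + 1) / B + 1 : ℕ) : ℝ)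
            = (((m + 1) * (n + 1) / B : ℕ) : ℝ) + 1 := by push_cast; ring
          _ ≤ c ^ 2 * n ^ 2 / B + c ^ 2 := by
            have : (1 : ℝ) ≤ c ^ 2 := one_le_pow₀ hc0
            linarith
          _ = c ^ 2 * (n ^ 2 / B + 1) := by ring
          _ ≤ C * ((n : ℝ) ^ 2 / B + 1) := by gcongr

/-- The costs of the refined algorithm. -/
theorem exists_bounds (κ τ : ℕ) : ∃ C : ℝ, ∀ m n : ℕ, 2 ≤ n → m ≤ κ * n →
    ((gapTree Fire.slots (gapExp m n)).toTree (opCode m n)).TimeLE Fire.rules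
      (C * ((n : ℝ) * Real.log n)) ∧
    (((gapTree Fire.slots (gapExp m n)).toTree (opCode m n)).work : ℝ) ≤ C * (n : ℝ) ^ 3 ∧
    (((gapTree Fire.slots (gapExp m n)).toTree (opCode m n)).space : ℝ) ≤ C * (n : ℝ) ^ 2 ∧
    ∀ M B : ℕ, 1 ≤ B → B ≤ M → B ^ 2 ≤ τ * M →
      (M ≤ n ^ 2 → CacheMissesLE M B
        ((gapTree Fire.slots (gapExp m n)).toTree (opCode m n)).serial
        (C * ((n : ℝ) ^ 3 / ((B : ℝ) * √(M : ℝ))))) ∧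
      (n ^ 2 < M → CacheMissesLE M B
        ((gapTree Fire.slots (gapExp m n)).toTree (opCode m n)).serial
        (C * ((n : ℝ) ^ 2 / (B : ℝ) + 1))) := by
  obtain ⟨C₁, h₁, hT⟩ := exists_timeLE_gapTree κ
  -- The choice of the block needs a positive constant, so `τ + 1` replaces `τ`.
  obtain ⟨C₂, h₂, hQ⟩ := exists_cacheMissesLE_gapTree κ (Nat.succ_pos τ)
  set c : ℝ := 2 * (κ + 1) with hc
  have hc0 : 0 ≤ c := by positivity
  refine ⟨C₁ + C₂ + 14 * c ^ 3 + c ^ 2, fun m n hn hm => ?_⟩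
  have hn1 : (1 : ℝ) ≤ n := by exact_mod_cast (by omega : 1 ≤ n)
  have hN : ((2 : ℝ) ^ gapExp m n) ≤ c * n := by
    rw [hc]; exact_mod_cast two_pow_gapExp_le hn hm
  have c2 : 0 ≤ c ^ 2 := by positivity
  have c3 : 0 ≤ c ^ 3 := by positivity
  refine ⟨(hT m n hn hm).mono ?_, ?_, ?_, fun M B hB hBM hBτ => ?_⟩
  · have := Real.log_nonneg hn1
    exact mul_le_mul_of_nonneg_right (by linarith) (by positivity)
  · have h := work_gapTree_le m n (gapExp m n)
    calc _ ≤ ((14 * (2 ^ gapExp m n) ^ 3 : ℕ) : ℝ) := by exact_mod_cast h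
      _ = 14 * ((2 : ℝ) ^ gapExp m n) ^ 3 := by push_cast; ring
      _ ≤ 14 * (c * n) ^ 3 := by gcongr
      _ = 14 * c ^ 3 * n ^ 3 := by ring
      _ ≤ _ := mul_le_mul_of_nonneg_right (by linarith) (by positivity)
  · have h := space_gapTree_le m n (gapExp m n)
    obtain ⟨hm2, hn2⟩ := lt_two_pow_gapExp m n
    have hA : (m + 1) * (n + 1) ≤ (2 ^ gapExp m n) ^ 2 := by
      rw [sq]; exact Nat.mul_le_mul hm2 hn2
    calc _ ≤ (((2 ^ gapExp m n) ^ 2 : ℕ) : ℝ) := by exact_mod_cast h.trans hA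
      _ = ((2 : ℝ) ^ gapExp m n) ^ 2 := by push_cast; ring
      _ ≤ (c * n) ^ 2 := by gcongr
      _ = c ^ 2 * n ^ 2 := by ring
      _ ≤ _ := mul_le_mul_of_nonneg_right (by linarith) (by positivity)
  · obtain ⟨ha, hb⟩ := hQ m n hn hm M B hB hBM
      (hBτ.trans (Nat.mul_le_mul_right _ (Nat.le_succ τ)))
    exact ⟨fun h => (ha h).mono (mul_le_mul_of_nonneg_right (by linarith) (by positivity)),
      fun h => (hb h).mono (mul_le_mul_of_nonneg_right (by linarith) (by positivity))⟩

end Bounds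

/-! ## Lower bounds for straight-line programs -/

theorem IsGapSolution.unique {m n : ℕ} {W : Weights} {D D' : ℕ → ℕ → ℝ}
    (h : IsGapSolution m n W D) (h' : IsGapSolution m n W D') {i j : ℕ} (hi : i ≤ m)
    (hj : j ≤ n) : D i j = D' i j := by
  induction hk : i + j using Nat.strong_induction_on generalizing i j with
  | _ k ih =>
    subst hk
    by_cases h0 : (i, j) = (0, 0)
    · obtain ⟨rfl, rfl⟩ := Prod.mk.inj h0
      rw [h.1, h'.1]
    · have hD := h.2 i j hi hj h0
      have e : gapCandidates W D i j = gapCandidates W D' i j := by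
        unfold gapCandidates
        congr 1
        · congr 1
          · ext x
            refine and_congr_right fun h1 => and_congr_right fun h2 => ?_
            rw [ih (i - 1 + (j - 1)) (by omega) (by omega) (by omega) rfl]
          · ext x
            refine exists_congr fun q => and_congr_right fun hq => ?_
            rw [ih (i + q) (by omega) hi (by omega) rfl]
        · ext x
          refine exists_congr fun p => and_congr_right fun hp => ?_
          rw [ih (p + j) (by omega) (by omega) hj rfl]
      rw [e] at hD
      exact hD.unique (h'.2 i j hi hj h0)

/-- Weights for which all candidates of the cell `(i, j)` are equal to `f j + g i`. -/
noncomputable def potential (f g : ℕ → ℝ) : Weights where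
  w q j := if q < j then f j - f q else 0
  w' p i := if p < i then g i - g p else 0
  s i j := if 1 ≤ i ∧ 1 ≤ j then f j - f (j - 1) + (g i - g (i - 1)) else 0

theorem isGapSolution_potential (m n : ℕ) {f g : ℕ → ℝ} (hf : f 0 = 0) (hg : g 0 = 0) :
    IsGapSolution m n (potential f g) fun i j => f j + g i := by
  refine ⟨by simp [hf, hg], fun i j _ _ hij => ⟨?_, ?_⟩⟩
  · rcases Nat.eq_zero_or_pos j with rfl | hj
    · have hi : 0 < i := Nat.pos_of_ne_zero fun h => hij (by rw [h])
      exact Or.inr ⟨0, hi, by simp [potential, hi, hg]⟩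
    · exact Or.inl (Or.inr ⟨0, hj, by simp [potential, hj, hf]; ring⟩)
  · rintro x ((⟨hi, hj, rfl⟩ | ⟨q, hq, rfl⟩) | ⟨p, hp, rfl⟩) <;> apply le_of_eq
    · simp only [potential, hi, hj, and_self, if_true]; ring
    · simp only [potential, hq, if_true]; ring
    · simp only [potential, hp, if_true]; ring

theorem SeriallySolves.potential {m n : ℕ} {out : ℕ → ℕ → ℕ} {L : List (Assign ℕ)}
    (h : SeriallySolves m n out L) {f g : ℕ → ℝ} (hf : f 0 = 0) (hg : g 0 = 0) (μ : Mem)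
    {i j : ℕ} (hi : i ≤ m) (hj : j ≤ n) :
    execList (GapND.potential f g) μ L (out i j) = ((f j + g i : ℝ) : WithTop ℝ) := by
  obtain ⟨D, hD, hout⟩ := h (GapND.potential f g) μ
  rw [hout i j hi hj, hD.unique (isGapSolution_potential m n hf hg) hi hj]

theorem execList_of_notMem {W : Weights} {L : List (Assign ℕ)} {a : ℕ}
    (h : ∀ A ∈ L, A.dst ≠ a) (μ : Mem) : execList W μ L a = μ a := by
  induction L generalizing μ with
  | nil => rfl
  | cons A L ih =>
    refine (ih (fun B hB => h B (List.mem_cons_of_mem _ hB)) _).trans ?_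
    exact Function.update_of_ne (h A List.mem_cons_self).symm _ _

theorem dst_mem_footprint {L : List (Assign ℕ)} {A : Assign ℕ} (h : A ∈ L) :
    A.dst ∈ footprint L := by
  rw [footprint, List.mem_toFinset, traceList, List.mem_flatMap]
  exact ⟨A, h, by simp [Assign.trace]⟩

/-- The potentials `j` and `i * (n + 1)` give the entries of the table pairwise distinct values, so
the output addresses are distinct. Starting from memory filled with `⊤`, each of them must be
written to become finite. -/
theorem SeriallySolves.le_card_footprint {m n : ℕ} {out : ℕ → ℕ → ℕ} {L : List (Assign ℕ)}
    (h : SeriallySolves m n out L) : (m + 1) * (n + 1) ≤ (footprint L).card := by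
  have key := fun (i j : ℕ) (hi : i ≤ m) (hj : j ≤ n) =>
    h.potential (f := fun j => j) (g := fun i => (i * (n + 1) : ℕ)) (by simp) (by simp)
      (fun _ => ⊤) hi hj
  have hcard : (Finset.range (m + 1) ×ˢ Finset.range (n + 1)).card = (m + 1) * (n + 1) := by
    simp
  rw [← hcard]
  refine Finset.card_le_card_of_injOn (fun p => out p.1 p.2) ?_ ?_
  · rintro ⟨i, j⟩ hp
    simp only [Finset.coe_product, Finset.coe_range, Set.mem_prod, Set.mem_Iio] at hp
    by_contra hn
    have h1 := key i j (by omega) (by omega)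
    rw [execList_of_notMem fun A hA he => hn (by
      have := dst_mem_footprint hA
      rwa [he] at this)] at h1
    exact WithTop.coe_ne_top h1.symm
  · rintro ⟨i, j⟩ hp ⟨i', j'⟩ hp' he
    simp only [Finset.coe_product, Finset.coe_range, Set.mem_prod, Set.mem_Iio] at hp hp'
    have h1 := key i j (by omega) (by omega)
    have h2 := key i' j' (by omega) (by omega)
    have he' : out i j = out i' j' := he
    rw [he', h2, WithTop.coe_inj] at h1
    have h3 : i * (n + 1) + j = i' * (n + 1) + j' := by
      have h4 : j' + i' * (n + 1) = j + i * (n + 1) := by exact_mod_cast h1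
      omega
    have := rowMajor_inj (n := n) (i := i) (j := j) (i' := i') (j' := j') (by omega) (by omega) h3
    simpa using this

/-! ### Formal computation with sets of monomials -/

/-- The indeterminates of the formal `(min, +)` computation. -/
inductive Letter : Type where
  | w (q j : ℕ)
  | w' (p i : ℕ)
  | s (i j : ℕ)
  deriving DecidableEq

def Letter.wt (W : Weights) : Letter → ℝ
  | w q j => W.w q j
  | w' p i => W.w' p i
  | s i j => W.s i j

abbrev Monomial : Type := Multiset Letter

def Monomial.wt (W : Weights) (a : Monomial) : ℝ := (a.map (Letter.wt W)).sum

open Pointwise in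
/-- The set of monomials whose minimum a right-hand side computes. -/
def Val.formal (F : ℕ → Set Monomial) : Val ℕ → Set Monomial
  | cell a => F a
  | w q j => {{Letter.w q j}}
  | w' p i => {{Letter.w' p i}}
  | s i j => {{Letter.s i j}}
  | zero => {0}
  | top => ∅
  | add x y => x.formal F + y.formal F
  | min x y => x.formal F ∪ y.formal F

/-- The formal operands of the additions of a right-hand side. -/
def Val.gates (F : ℕ → Set Monomial) : Val ℕ → List (Set Monomial × Set Monomial)
  | add x y => (x.formal F, y.formal F) :: (x.gates F ++ y.gates F)
  | min x y => x.gates F ++ y.gates F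
  | _ => []

def Assign.formal (F : ℕ → Set Monomial) (A : Assign ℕ) : ℕ → Set Monomial :=
  Function.update F A.dst (A.val.formal F)

def formalList (F : ℕ → Set Monomial) (L : List (Assign ℕ)) : ℕ → Set Monomial :=
  L.foldl Assign.formal F

def gateList (F : ℕ → Set Monomial) : List (Assign ℕ) → List (Set Monomial × Set Monomial)
  | [] => []
  | A :: L => A.val.gates F ++ gateList (A.formal F) L

theorem Val.length_gates_le (F : ℕ → Set Monomial) (x : Val ℕ) :
    (x.gates F).length ≤ x.cost := by
  induction x with
  | add x y hx hy => simp only [gates, cost, List.length_cons, List.length_append]; omega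
  | min x y hx hy => simp only [gates, cost, List.length_append]; omega
  | _ => simp [gates]

theorem length_gateList_le (F : ℕ → Set Monomial) (L : List (Assign ℕ)) :
    (gateList F L).length ≤ workList L := by
  induction L generalizing F with
  | nil => simp [gateList]
  | cons A L ih =>
    have h1 := ih (A.formal F)
    have h2 := A.val.length_gates_le F
    simp only [gateList, List.length_append, workList, List.map_cons, List.sum_cons,
      Assign.cost] at h1 ⊢
    omega

@[simp] theorem Monomial.wt_add (W : Weights) (a b : Monomial) :
    Monomial.wt W (a + b) = Monomial.wt W a + Monomial.wt W b := by
  simp [Monomial.wt]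

/-- `v` is the minimum of the weights of the monomials of `P`. -/
def IsMinOf (W : Weights) (P : Set Monomial) (v : WithTop ℝ) : Prop :=
  (∀ a ∈ P, v ≤ (Monomial.wt W a : ℝ)) ∧ (v = ⊤ ∨ ∃ a ∈ P, v = (Monomial.wt W a : ℝ))

theorem isMinOf_singleton (W : Weights) (a : Monomial) :
    IsMinOf W {a} (Monomial.wt W a : ℝ) :=
  ⟨fun b hb => by rw [Set.mem_singleton_iff.1 hb], Or.inr ⟨a, rfl, rfl⟩⟩

/-- Evaluation turns unions into minima and pointwise sums of sets into sums; the empty set stands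
for `⊤`. -/
theorem Val.isMinOf_formal {W : Weights} {F : ℕ → Set Monomial} {μ : Mem}
    (h : ∀ a, IsMinOf W (F a) (μ a)) (x : Val ℕ) : IsMinOf W (x.formal F) (x.eval W μ) := by
  induction x with
  | cell a => exact h a
  | w q j => simpa [Monomial.wt, Letter.wt, formal, eval] using isMinOf_singleton W {Letter.w q j}
  | w' q j => simpa [Monomial.wt, Letter.wt, formal, eval] using isMinOf_singleton W {Letter.w' q j}
  | s q j => simpa [Monomial.wt, Letter.wt, formal, eval] using isMinOf_singleton W {Letter.s q j}
  | zero => simpa [Monomial.wt, Letter.wt, formal, eval] using isMinOf_singleton W 0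
  | top => exact ⟨fun a ha => ha.elim, Or.inl rfl⟩
  | add x y hx hy =>
    constructor
    · rintro _ ⟨a, ha, b, hb, rfl⟩
      simp only [Monomial.wt_add, WithTop.coe_add]
      exact add_le_add (hx.1 a ha) (hy.1 b hb)
    · rcases hx.2 with h1 | ⟨a, ha, h1⟩
      · exact Or.inl (by simp [Val.eval, h1])
      rcases hy.2 with h2 | ⟨b, hb, h2⟩
      · exact Or.inl (by simp [Val.eval, h2])
      exact Or.inr ⟨a + b, ⟨a, ha, b, hb, rfl⟩, by simp [Val.eval, h1, h2]⟩
  | min x y hx hy =>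
    constructor
    · rintro a (ha | ha)
      · exact (min_le_left _ _).trans (hx.1 a ha)
      · exact (min_le_right _ _).trans (hy.1 a ha)
    · rcases le_total (x.eval W μ) (y.eval W μ) with hl | hl
      · rw [Val.eval, min_eq_left hl]
        exact hx.2.imp_right fun ⟨a, ha, e⟩ => ⟨a, Or.inl ha, e⟩
      · rw [Val.eval, min_eq_right hl]
        exact hy.2.imp_right fun ⟨a, ha, e⟩ => ⟨a, Or.inr ha, e⟩

theorem isMinOf_formalList {W : Weights} {F : ℕ → Set Monomial} {μ : Mem}
    (h : ∀ a, IsMinOf W (F a) (μ a)) (L : List (Assign ℕ)) (a : ℕ) :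
    IsMinOf W (formalList F L a) (execList W μ L a) := by
  induction L generalizing F μ with
  | nil => exact h a
  | cons A L ih =>
    refine ih fun b => ?_
    unfold Assign.formal Assign.exec
    rcases eq_or_ne b A.dst with rfl | hb
    · simpa using A.val.isMinOf_formal h
    · simpa [hb] using h b

/-- Distinct letters of a monomial of `P` are brought together by an addition in `G`, and in
that context the operands can be replaced by other monomials of the operands. -/
def Joined (G : List (Set Monomial × Set Monomial)) (P : Set Monomial) : Prop :=
  ∀ a ∈ P, ∀ u ∈ a, ∀ v ∈ a, u ≠ v → ∃ p ∈ G, ∃ b ∈ p.1, ∃ b' ∈ p.2, ∃ c : Monomial,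
    a = b + b' + c ∧ (u ∈ b ∧ v ∈ b' ∨ v ∈ b ∧ u ∈ b') ∧
      ∀ e ∈ p.1, ∀ e' ∈ p.2, e + e' + c ∈ P

theorem joined_singleton (G : List (Set Monomial × Set Monomial)) (l : Letter) :
    Joined G {{l}} := by
  rintro a rfl u hu v hv huv
  exact absurd ((Multiset.mem_singleton.1 hu).trans (Multiset.mem_singleton.1 hv).symm) huv

theorem Joined.union {G : List (Set Monomial × Set Monomial)} {P Q : Set Monomial}
    (hP : Joined G P) (hQ : Joined G Q) : Joined G (P ∪ Q) := by
  rintro a (ha | ha) u hu v hv huv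
  · obtain ⟨p, hp, b, hb, b', hb', c, e, ho, hr⟩ := hP a ha u hu v hv huv
    exact ⟨p, hp, b, hb, b', hb', c, e, ho, fun x hx y hy => Or.inl (hr x hx y hy)⟩
  · obtain ⟨p, hp, b, hb, b', hb', c, e, ho, hr⟩ := hQ a ha u hu v hv huv
    exact ⟨p, hp, b, hb, b', hb', c, e, ho, fun x hx y hy => Or.inr (hr x hx y hy)⟩

-- If both letters come from the same summand, the addition found there still works, with the other
-- summand moved into the context `c`. Otherwise the present addition joins them, with empty
-- context.
open Pointwise in
theorem Joined.add {G : List (Set Monomial × Set Monomial)} {P Q : Set Monomial}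
    (hP : Joined G P) (hQ : Joined G Q) (hPQ : (P, Q) ∈ G) : Joined G (P + Q) := by
  rintro _ ⟨d, hd, d', hd', rfl⟩ u hu v hv huv
  rcases Multiset.mem_add.1 hu with hu | hu <;> rcases Multiset.mem_add.1 hv with hv | hv
  · obtain ⟨p, hp, b, hb, b', hb', c, e, ho, hr⟩ := hP d hd u hu v hv huv
    refine ⟨p, hp, b, hb, b', hb', c + d', by simp only [e]; abel, ho, fun x hx y hy => ?_⟩
    exact ⟨_, hr x hx y hy, d', hd', by simp only; abel⟩
  · refine ⟨_, hPQ, d, hd, d', hd', 0, by simp, Or.inl ⟨hu, hv⟩, fun x hx y hy => ?_⟩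
    exact ⟨x, hx, y, hy, by simp⟩
  · refine ⟨_, hPQ, d, hd, d', hd', 0, by simp, Or.inr ⟨hv, hu⟩, fun x hx y hy => ?_⟩
    exact ⟨x, hx, y, hy, by simp⟩
  · obtain ⟨p, hp, b, hb, b', hb', c, e, ho, hr⟩ := hQ d' hd' u hu v hv huv
    refine ⟨p, hp, b, hb, b', hb', c + d, by simp only [e]; abel, ho, fun x hx y hy => ?_⟩
    exact ⟨d, hd, _, hr x hx y hy, by simp only; abel⟩

theorem Val.joined_formal {F : ℕ → Set Monomial} {G : List (Set Monomial × Set Monomial)}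
    (h : ∀ a, Joined G (F a)) (x : Val ℕ) (hx : x.gates F ⊆ G) : Joined G (x.formal F) := by
  induction x with
  | cell a => exact h a
  | w q j => exact joined_singleton G _
  | w' q j => exact joined_singleton G _
  | s q j => exact joined_singleton G _
  | zero => rintro a rfl u hu; exact absurd hu (Multiset.notMem_zero u)
  | top => exact fun a ha => ha.elim
  | add x y ihx ihy =>
    simp only [gates, List.cons_subset, List.append_subset] at hx
    exact (ihx hx.2.1).add (ihy hx.2.2) hx.1
  | min x y ihx ihy =>
    simp only [gates, List.append_subset] at hx
    exact (ihx hx.1).union (ihy hx.2)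

theorem joined_formalList {F : ℕ → Set Monomial} {G : List (Set Monomial × Set Monomial)}
    (h : ∀ a, Joined G (F a)) (L : List (Assign ℕ)) (hL : gateList F L ⊆ G) (a : ℕ) :
    Joined G (formalList F L a) := by
  induction L generalizing F with
  | nil => exact h a
  | cons A L ih =>
    simp only [gateList, List.append_subset] at hL
    refine ih (fun b => ?_) hL.2
    unfold Assign.formal
    rcases eq_or_ne b A.dst with rfl | hb
    · simpa using A.val.joined_formal h hL.1
    · simpa [hb] using h b

/-! ### Crossing numbers of monomials -/

def step (x j : ℕ) : ℝ := if x < j then 1 else 0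

theorem step_zero (x : ℕ) : step x 0 = 0 := rfl

theorem monotone_step (x : ℕ) : Monotone (step x) := fun a b hab => by
  unfold step
  split_ifs with h1 h2
  · exact le_rfl
  · omega
  · exact zero_le_one
  · exact le_rfl

/-- The number of times a monomial crosses from column `x` to column `x + 1`. -/
noncomputable def colCross (x : ℕ) : Monomial → ℝ := Monomial.wt (potential (step x) 0)

/-- The number of times a monomial crosses from row `x` to row `x + 1`. -/
noncomputable def rowCross (x : ℕ) : Monomial → ℝ := Monomial.wt (potential 0 (step x))

theorem Letter.wt_potential_nonneg {f g : ℕ → ℝ} (hf : Monotone f) (hg : Monotone g)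
    (l : Letter) : 0 ≤ l.wt (potential f g) := by
  cases l with
  | w q j =>
    simp only [wt, potential]
    split_ifs with h
    · exact sub_nonneg.2 (hf h.le)
    · exact le_rfl
  | w' p i =>
    simp only [wt, potential]
    split_ifs with h
    · exact sub_nonneg.2 (hg h.le)
    · exact le_rfl
  | s i j =>
    simp only [wt, potential]
    split_ifs with h
    · exact add_nonneg (sub_nonneg.2 (hf (Nat.sub_le _ _))) (sub_nonneg.2 (hg (Nat.sub_le _ _)))
    · exact le_rfl

theorem Monomial.wt_nonneg {W : Weights} (h : ∀ l : Letter, 0 ≤ l.wt W) (a : Monomial) :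
    0 ≤ Monomial.wt W a :=
  Multiset.sum_nonneg fun x hx => by
    obtain ⟨l, _, rfl⟩ := Multiset.mem_map.1 hx
    exact h l

theorem Monomial.wt_mono {W : Weights} (h : ∀ l : Letter, 0 ≤ l.wt W) {a b : Monomial}
    (hab : a ≤ b) : Monomial.wt W a ≤ Monomial.wt W b := by
  obtain ⟨c, rfl⟩ := Multiset.le_iff_exists_add.1 hab
  have := Monomial.wt_nonneg h c
  rw [Monomial.wt_add]
  linarith

theorem Letter.wt_potential_step_nonneg (x : ℕ) (l : Letter) :
    0 ≤ l.wt (potential (step x) 0) :=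
  l.wt_potential_nonneg (monotone_step x) monotone_const

theorem Letter.wt_potential_step_nonneg' (x : ℕ) (l : Letter) :
    0 ≤ l.wt (potential 0 (step x)) :=
  l.wt_potential_nonneg monotone_const (monotone_step x)

theorem Monomial.wt_singleton (W : Weights) (l : Letter) :
    Monomial.wt W {l} = l.wt W := by
  simp [Monomial.wt]

theorem colCross_nonneg (x : ℕ) (a : Monomial) : 0 ≤ colCross x a :=
  Monomial.wt_nonneg (Letter.wt_potential_step_nonneg x) a

theorem rowCross_nonneg (x : ℕ) (a : Monomial) : 0 ≤ rowCross x a :=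
  Monomial.wt_nonneg (Letter.wt_potential_step_nonneg' x) a

theorem one_le_colCross_w {q j x : ℕ} (hq : q ≤ x) (hj : x < j) {a : Monomial}
    (h : Letter.w q j ∈ a) : 1 ≤ colCross x a := by
  refine le_trans (le_of_eq ?_)
    (Monomial.wt_mono (Letter.wt_potential_step_nonneg x) (Multiset.singleton_le.2 h))
  simp [Monomial.wt_singleton, Letter.wt, potential, step, hj, hq.trans_lt hj, hq.not_gt]

theorem one_le_colCross_s {i q : ℕ} (hi : 1 ≤ i) (hq : 1 ≤ q) {a : Monomial}
    (h : Letter.s i q ∈ a) : 1 ≤ colCross (q - 1) a := by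
  refine le_trans (le_of_eq ?_)
    (Monomial.wt_mono (Letter.wt_potential_step_nonneg _) (Multiset.singleton_le.2 h))
  have : q - 1 < q := by omega
  simp [Monomial.wt_singleton, Letter.wt, potential, step, hi, hq, this]

theorem one_le_rowCross_s {i q : ℕ} (hi : 1 ≤ i) (hq : 1 ≤ q) {a : Monomial}
    (h : Letter.s i q ∈ a) : 1 ≤ rowCross (i - 1) a := by
  refine le_trans (le_of_eq ?_)
    (Monomial.wt_mono (Letter.wt_potential_step_nonneg' _) (Multiset.singleton_le.2 h))
  have : i - 1 < i := by omega
  simp [Monomial.wt_singleton, Letter.wt, potential, step, hi, hq, this]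

theorem count_le_one {W : Weights} (h : ∀ l : Letter, 0 ≤ l.wt W) {a : Monomial} {l : Letter}
    (hl : 1 ≤ Monomial.wt W {l}) (ha : Monomial.wt W a ≤ 1) : a.count l ≤ 1 := by
  by_contra hc
  have h2 := Monomial.wt_mono h (Multiset.le_count_iff_replicate_le.1 (not_le.1 hc))
  have e : Multiset.replicate (Nat.succ 1) l = {l} + {l} := rfl
  rw [e, Monomial.wt_add] at h2
  linarith

theorem Letter.wt_potential_neg (f g : ℕ → ℝ) (l : Letter) :
    l.wt (potential (-f) (-g)) = -l.wt (potential f g) := by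
  cases l <;> simp only [wt, potential, Pi.neg_apply] <;> split_ifs <;> ring

theorem Monomial.wt_potential_neg (f g : ℕ → ℝ) (a : Monomial) :
    Monomial.wt (potential (-f) (-g)) a = -Monomial.wt (potential f g) a := by
  simp only [Monomial.wt, Letter.wt_potential_neg]
  exact Multiset.sum_map_neg

/-- Weights that reward the use of the gap `(q, j)` and of the diagonal step to `(i, q)`. -/
def reward (i q j : ℕ) : Weights where
  w a b := if a = q ∧ b = j then -1 else 0
  w' _ _ := 0
  s a b := if a = i ∧ b = q then -1 else 0

theorem Monomial.wt_reward (i q j : ℕ) (a : Monomial) :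
    Monomial.wt (reward i q j) a = -(a.count (Letter.w q j) : ℝ) - a.count (Letter.s i q) := by
  induction a using Multiset.induction with
  | empty => simp [Monomial.wt]
  | cons l a ih =>
    have e : l ::ₘ a = {l} + a := rfl
    rw [e, Monomial.wt_add, ih, Monomial.wt_singleton, ← e, Multiset.count_cons,
      Multiset.count_cons]
    cases l with
    | w x y =>
      by_cases h : x = q ∧ y = j
      · obtain ⟨rfl, rfl⟩ := h
        simp [Letter.wt, reward]; ring
      · have h' : ¬ (q = x ∧ j = y) := fun h2 => h ⟨h2.1.symm, h2.2.symm⟩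
        simp [Letter.wt, reward, h, h']
    | w' x y => simp [Letter.wt, reward]
    | s x y =>
      by_cases h : x = i ∧ y = q
      · obtain ⟨rfl, rfl⟩ := h
        simp [Letter.wt, reward]; ring
      · have h' : ¬ (i = x ∧ q = y) := fun h2 => h ⟨h2.1.symm, h2.2.symm⟩
        simp [Letter.wt, reward, h, h']

/-- No weight that is used is positive, so the cell `(i - 1, q - 1)` has value at most `0`; the
diagonal step to `(i, q)` and the gap to `(i, j)` then collect both rewards. -/
theorem IsGapSolution.reward_le {m n i q j : ℕ} {D : ℕ → ℕ → ℝ}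
    (hD : IsGapSolution m n (reward i q j) D) (hi : 1 ≤ i) (him : i ≤ m) (hq : 1 ≤ q)
    (hqj : q < j) (hjn : j ≤ n) : D i j ≤ -2 := by
  have hw : ∀ a b, (reward i q j).w a b ≤ 0 := fun a b => by
    simp only [reward]; split_ifs <;> norm_num
  have h0 : ∀ b ≤ n, D 0 b ≤ 0 := fun b hb => by
    rcases Nat.eq_zero_or_pos b with rfl | hb0
    · exact hD.1.le
    · have h1 := (hD.2 0 b (Nat.zero_le _) hb (by simp; omega)).2
        (Or.inl (Or.inr ⟨0, hb0, rfl⟩))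
      have := hw 0 b
      rw [hD.1] at h1
      linarith
  have h1 : ∀ a ≤ m, ∀ b ≤ n, D a b ≤ 0 := fun a ha b hb => by
    rcases Nat.eq_zero_or_pos a with rfl | ha0
    · exact h0 b hb
    · have h1 := (hD.2 a b ha hb (by simp; omega)).2 (Or.inr ⟨0, ha0, rfl⟩)
      have := h0 b hb
      simp only [reward] at h1
      linarith
  have h2 := (hD.2 i j him hjn (by simp; omega)).2 (Or.inl (Or.inr ⟨q, hqj, rfl⟩))
  have h3 := (hD.2 i q him (by omega) (by simp; omega)).2 (Or.inl (Or.inl ⟨hi, hq, rfl⟩))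
  have h4 := h1 (i - 1) (by omega) (q - 1) (by omega)
  simp only [reward, and_self, if_true] at h2 h3
  linarith

/-! ### The cubic lower bound for work -/

section Work

variable {m n : ℕ} {out : ℕ → ℕ → ℕ} {L : List (Assign ℕ)}

theorem isMinOf_out (W : Weights) (L : List (Assign ℕ)) (a : ℕ) :
    IsMinOf W (formalList (fun _ => ∅) L a) (execList W (fun _ => ⊤) L a) :=
  isMinOf_formalList (fun _ => ⟨fun _ h => h.elim, Or.inl rfl⟩) L a

/-- The solution for the potentials `f`, `g` bounds the weight of every monomial from below, and the
solution for `-f`, `-g` bounds it from above by the same value. Thus even monomials that are never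
optimal behave like paths to the cell `(i, j)`. -/
theorem SeriallySolves.wt_potential (h : SeriallySolves m n out L) {f g : ℕ → ℝ} (hf : f 0 = 0)
    (hg : g 0 = 0) {i j : ℕ} (hi : i ≤ m) (hj : j ≤ n) {a : Monomial}
    (ha : a ∈ formalList (fun _ => ∅) L (out i j)) :
    Monomial.wt (GapND.potential f g) a = f j + g i := by
  have h1 := (isMinOf_out (GapND.potential f g) L (out i j)).1 a ha
  have h2 := (isMinOf_out (GapND.potential (-f) (-g)) L (out i j)).1 a ha
  rw [h.potential hf hg _ hi hj, WithTop.coe_le_coe] at h1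
  rw [h.potential (by simp [hf]) (by simp [hg]) _ hi hj, WithTop.coe_le_coe,
    Monomial.wt_potential_neg] at h2
  simp only [Pi.neg_apply] at h2
  linarith

theorem SeriallySolves.colCross (h : SeriallySolves m n out L) (x : ℕ) {i j : ℕ} (hi : i ≤ m)
    (hj : j ≤ n) {a : Monomial} (ha : a ∈ formalList (fun _ => ∅) L (out i j)) :
    GapND.colCross x a = step x j := by
  simpa [GapND.colCross] using h.wt_potential (step_zero x) (g := 0) rfl hi hj ha

theorem SeriallySolves.rowCross (h : SeriallySolves m n out L) (x : ℕ) {i j : ℕ} (hi : i ≤ m)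
    (hj : j ≤ n) {a : Monomial} (ha : a ∈ formalList (fun _ => ∅) L (out i j)) :
    GapND.rowCross x a = step x i := by
  simpa [GapND.rowCross] using h.wt_potential (f := 0) rfl (step_zero x) hi hj ha

theorem step_le_one (x j : ℕ) : step x j ≤ 1 := by
  unfold step; split_ifs <;> norm_num

/-- An optimal monomial for `reward` has weight at most `-2`. Each of the two letters occurs at most
once, because it crosses a column boundary that may be crossed only once; so both must occur. -/
theorem SeriallySolves.exists_monomial (h : SeriallySolves m n out L) {i q j : ℕ} (hi : 1 ≤ i)
    (him : i ≤ m) (hq : 1 ≤ q) (hqj : q < j) (hjn : j ≤ n) :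
    ∃ a ∈ formalList (fun _ => ∅) L (out i j), Letter.w q j ∈ a ∧ Letter.s i q ∈ a := by
  obtain ⟨D, hD, hout⟩ := h (reward i q j) (fun _ => ⊤)
  have h2 := hD.reward_le hi him hq hqj hjn
  rcases (isMinOf_out (reward i q j) L (out i j)).2 with ht | ⟨a, ha, e⟩
  · rw [hout i j him hjn] at ht
    exact absurd ht WithTop.coe_ne_top
  · refine ⟨a, ha, ?_⟩
    rw [hout i j him hjn, WithTop.coe_inj, Monomial.wt_reward] at e
    have c1 : a.count (Letter.w q j) ≤ 1 :=
      count_le_one (Letter.wt_potential_step_nonneg (j - 1))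
        (one_le_colCross_w (by omega) (by omega) (Multiset.mem_singleton_self _))
        ((h.colCross (j - 1) him hjn ha).trans_le (step_le_one _ _))
    have c2 : a.count (Letter.s i q) ≤ 1 :=
      count_le_one (Letter.wt_potential_step_nonneg (q - 1))
        (one_le_colCross_s hi hq (Multiset.mem_singleton_self _))
        ((h.colCross (q - 1) him hjn ha).trans_le (step_le_one _ _))
    have c3 : 2 ≤ a.count (Letter.w q j) + a.count (Letter.s i q) := by
      have : (2 : ℝ) ≤ a.count (Letter.w q j) + a.count (Letter.s i q) := by linarith
      exact_mod_cast this
    exact ⟨Multiset.count_pos.1 (by omega), Multiset.count_pos.1 (by omega)⟩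

/-- The columns and the row of `(i, q, j)` can be read off from the operands of an addition. -/
structure Witness (p : Set Monomial × Set Monomial) (t : ℕ × ℕ × ℕ) : Prop where
  left_nonempty : p.1.Nonempty
  right_nonempty : p.2.Nonempty
  left_col : ∀ a ∈ p.1, 1 ≤ colCross (t.2.2 - 1) a ∧ ∀ x, t.2.2 ≤ x → colCross x a ≤ 0
  right_col : ∀ a ∈ p.2, 1 ≤ colCross (t.2.1 - 1) a ∧ ∀ x, t.2.1 ≤ x → colCross x a ≤ 0
  right_row : ∀ a ∈ p.2, 1 ≤ rowCross (t.1 - 1) a ∧ ∀ x, t.1 ≤ x → rowCross x a ≤ 0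

theorem eq_of_cross {c : ℕ → Monomial → ℝ} {P : Set Monomial} (hP : P.Nonempty) {j j' : ℕ}
    (hj : 1 ≤ j) (hj' : 1 ≤ j') (h : ∀ a ∈ P, 1 ≤ c (j - 1) a ∧ ∀ x, j ≤ x → c x a ≤ 0)
    (h' : ∀ a ∈ P, 1 ≤ c (j' - 1) a ∧ ∀ x, j' ≤ x → c x a ≤ 0) : j = j' := by
  obtain ⟨a, ha⟩ := hP
  rcases lt_trichotomy j j' with hlt | heq | hlt
  · have h1 := (h a ha).2 (j' - 1) (by omega)
    have h2 := (h' a ha).1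
    linarith
  · exact heq
  · have h1 := (h' a ha).2 (j - 1) (by omega)
    have h2 := (h a ha).1
    linarith

theorem Witness.unique {p : Set Monomial × Set Monomial} {t t' : ℕ × ℕ × ℕ} (h : Witness p t)
    (h' : Witness p t') (h1 : 1 ≤ t.1) (h2 : 1 ≤ t.2.1) (h3 : 1 ≤ t.2.2) (h1' : 1 ≤ t'.1)
    (h2' : 1 ≤ t'.2.1) (h3' : 1 ≤ t'.2.2) : t = t' :=
  Prod.ext (eq_of_cross h.right_nonempty h1 h1' h.right_row h'.right_row)
    (Prod.ext (eq_of_cross h.right_nonempty h2 h2' h.right_col h'.right_col)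
      (eq_of_cross h.left_nonempty h3 h3' h.left_col h'.left_col))

/-- Exchanging an operand's monomial again gives a monomial of the output, with prescribed crossing
numbers; hence these numbers are constant on `X` and on `Y`. The gap `w q j` uses up the boundaries
from `q` to `j` and nothing lies beyond `j`, so `j` is the last column reached in `X` and `q` the
last one in `Y`. The row is seen only in `Y`, through `s i q`. -/
theorem SeriallySolves.witness (h : SeriallySolves m n out L) {i q j : ℕ} (hi : 1 ≤ i)
    (him : i ≤ m) (hq : 1 ≤ q) (hqj : q < j) (hjn : j ≤ n) {X Y : Set Monomial}
    {b b' c : Monomial} (hb : b ∈ X) (hb' : b' ∈ Y)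
    (hP : ∀ e ∈ X, ∀ e' ∈ Y, e + e' + c ∈ formalList (fun _ => ∅) L (out i j))
    (hw : Letter.w q j ∈ b) (hs : Letter.s i q ∈ b') : Witness (X, Y) (i, q, j) := by
  have hX : ∀ x, ∀ a ∈ X, GapND.colCross x a = GapND.colCross x b := fun x a ha => by
    have h1 := h.colCross x him hjn (hP a ha b' hb')
    have h2 := h.colCross x him hjn (hP b hb b' hb')
    simp only [GapND.colCross, Monomial.wt_add] at h1 h2 ⊢
    linarith
  have hY : ∀ x, ∀ a ∈ Y, GapND.colCross x a = GapND.colCross x b' := fun x a ha => by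
    have h1 := h.colCross x him hjn (hP b hb a ha)
    have h2 := h.colCross x him hjn (hP b hb b' hb')
    simp only [GapND.colCross, Monomial.wt_add] at h1 h2 ⊢
    linarith
  have hY' : ∀ x, ∀ a ∈ Y, GapND.rowCross x a = GapND.rowCross x b' := fun x a ha => by
    have h1 := h.rowCross x him hjn (hP b hb a ha)
    have h2 := h.rowCross x him hjn (hP b hb b' hb')
    simp only [GapND.rowCross, Monomial.wt_add] at h1 h2 ⊢
    linarith
  have hsum : ∀ x, GapND.colCross x b + GapND.colCross x b' ≤ step x j := fun x => by
    have h2 := h.colCross x him hjn (hP b hb b' hb')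
    have h3 := colCross_nonneg x c
    simp only [GapND.colCross, Monomial.wt_add] at h2 h3 ⊢
    linarith
  have hsum' : ∀ x, GapND.rowCross x b' ≤ step x i := fun x => by
    have h2 := h.rowCross x him hjn (hP b hb b' hb')
    have h3 := rowCross_nonneg x c
    have h4 := rowCross_nonneg x b
    simp only [GapND.rowCross, Monomial.wt_add] at h2 h3 h4 ⊢
    linarith
  have hstep : ∀ {x k : ℕ}, k ≤ x → step x k = 0 := fun hk => if_neg hk.not_gt
  refine ⟨⟨b, hb⟩, ⟨b', hb'⟩, fun a ha => ⟨?_, fun x hx => ?_⟩, fun a ha => ⟨?_, fun x hx => ?_⟩,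
    fun a ha => ⟨?_, fun x hx => ?_⟩⟩
  · rw [hX _ a ha]
    exact one_le_colCross_w (by simp only; omega) (by simp only; omega) hw
  · have h1 := hsum x
    have h2 := colCross_nonneg x b'
    rw [hstep hx] at h1
    rw [hX _ a ha]
    linarith
  · rw [hY _ a ha]
    exact one_le_colCross_s hi hq hs
  · have h1 := hsum x
    rw [hY _ a ha]
    rcases lt_or_ge x j with hxj | hxj
    · have h2 := one_le_colCross_w hx hxj hw
      have h3 := step_le_one x j
      linarith
    · have h2 := colCross_nonneg x b
      rw [hstep hxj] at h1
      linarith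
  · rw [hY' _ a ha]
    exact one_le_rowCross_s hi hq hs
  · rw [hY' _ a ha, ← hstep hx]
    exact hsum' x

theorem SeriallySolves.exists_witness (h : SeriallySolves m n out L) {i q j : ℕ} (hi : 1 ≤ i)
    (him : i ≤ m) (hq : 1 ≤ q) (hqj : q < j) (hjn : j ≤ n) :
    ∃ p ∈ gateList (fun _ => ∅) L ++ (gateList (fun _ => ∅) L).map Prod.swap,
      Witness p (i, q, j) := by
  obtain ⟨a, ha, hw, hs⟩ := h.exists_monomial hi him hq hqj hjn
  obtain ⟨p, hp, b, hb, b', hb', c, -, ho, hP⟩ :=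
    joined_formalList (F := fun _ => ∅) (fun _ _ h => h.elim) L (List.Subset.refl _) (out i j)
      a ha _ hw _ hs (by simp)
  -- Either operand may contain the gap; adjoining the swapped pairs fixes the order, at the price
  -- of a factor two.
  rcases ho with ⟨h1, h2⟩ | ⟨h1, h2⟩
  · exact ⟨p, List.mem_append_left _ hp, h.witness hi him hq hqj hjn hb hb' hP h1 h2⟩
  · refine ⟨p.swap, List.mem_append_right _ (List.mem_map_of_mem hp),
      h.witness (c := c) hi him hq hqj hjn hb' hb (fun e he e' he' => ?_) h2 h1⟩
    rw [add_comm e e']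
    exact hP e' he' e he

-- Restricting to `q ≤ n / 2 < j` gives a product set of triples, and by `Witness.unique` different
-- triples have different ordered pairs of operands.
open Classical in
theorem SeriallySolves.le_workList (h : SeriallySolves m n out L) :
    m * (n / 2 * (n - n / 2)) ≤ 2 * workList L := by
  set T := Finset.Icc 1 m ×ˢ (Finset.Icc 1 (n / 2) ×ˢ Finset.Ioc (n / 2) n) with hT
  have hcard : T.card = m * (n / 2 * (n - n / 2)) := by simp [hT]
  have hmem : ∀ t ∈ T, (1 ≤ t.1 ∧ t.1 ≤ m) ∧ (1 ≤ t.2.1 ∧ t.2.1 ≤ n / 2) ∧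
      n / 2 < t.2.2 ∧ t.2.2 ≤ n := fun t ht => by
    simpa [hT] using ht
  set G := gateList (fun _ => ∅) L ++ (gateList (fun _ => ∅) L).map Prod.swap with hG
  have hlen : G.toFinset.card ≤ 2 * workList L := by
    refine (List.toFinset_card_le G).trans ?_
    have := length_gateList_le (fun _ => ∅) L
    simp only [hG, List.length_append, List.length_map]
    omega
  have hex : ∀ t : ℕ × ℕ × ℕ, ∃ p, t ∈ T → p ∈ G ∧ Witness p t := fun t => by
    by_cases ht : t ∈ T
    · obtain ⟨⟨h1, h2⟩, ⟨h3, h4⟩, h5, h6⟩ := hmem t ht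
      obtain ⟨p, hp, hpt⟩ := h.exists_witness h1 h2 h3 (by omega) h6
      exact ⟨p, fun _ => ⟨hp, hpt⟩⟩
    · exact ⟨default, fun h => absurd h ht⟩
  choose F hF using hex
  rw [← hcard]
  refine (Finset.card_le_card_of_injOn F (fun t ht => ?_) fun t ht t' ht' he => ?_).trans hlen
  · exact List.mem_toFinset.2 (hF t ht).1
  · obtain ⟨⟨h1, h2⟩, ⟨h3, h4⟩, h5, h6⟩ := hmem t ht
    obtain ⟨⟨h1', h2'⟩, ⟨h3', h4'⟩, h5', h6'⟩ := hmem t' ht'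
    have hw := (hF t ht).2
    rw [he] at hw
    exact hw.unique (hF t' ht').2 h1 h3 (by omega) h1' h3' (by omega)

end Work

/-- Work and space of serial straight-line programs that solve the GAP recurrence. -/
theorem exists_lower_bounds (κ : ℕ) : ∃ ε : ℝ, 0 < ε ∧
    ∀ (m n : ℕ) (out : ℕ → ℕ → ℕ) (L : List (Assign ℕ)),
      2 ≤ n → m ≤ κ * n → n ≤ κ * m → SeriallySolves m n out L →
      ε * (n : ℝ) ^ 3 ≤ (workList L : ℝ) ∧
      ε * (n : ℝ) ^ 2 ≤ ((footprint L).card : ℝ) := by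
  refine ⟨1 / (12 * (κ + 1)), by positivity, fun m n out L hn _ hnm h => ?_⟩
  have hκ : (0 : ℝ) < 12 * (κ + 1) := by positivity
  have hnm' : (n : ℝ) ≤ κ * m := by exact_mod_cast hnm
  have hn0 : (0 : ℝ) ≤ n := n.cast_nonneg
  have hm0 : (0 : ℝ) ≤ m := m.cast_nonneg
  constructor
  · have h1 := h.le_workList
    have h2 : n * n ≤ 6 * (n / 2 * (n - n / 2)) := by
      have h3 : n ≤ 3 * (n / 2) := by omega
      have h4 : n ≤ 2 * (n - n / 2) := by omega
      calc n * n ≤ 3 * (n / 2) * (2 * (n - n / 2)) := Nat.mul_le_mul h3 h4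
        _ = _ := by ring
    have h3 : m * (n * n) ≤ 12 * workList L := by
      calc m * (n * n) ≤ m * (6 * (n / 2 * (n - n / 2))) := Nat.mul_le_mul_left _ h2
        _ = 6 * (m * (n / 2 * (n - n / 2))) := by ring
        _ ≤ _ := by omega
    have h4 : (m : ℝ) * (n * n) ≤ 12 * workList L := by exact_mod_cast h3
    rw [one_div_mul_eq_div, div_le_iff₀ hκ]
    calc (n : ℝ) ^ 3 = n * (n * n) := by ring
      _ ≤ κ * m * (n * n) := by gcongr
      _ = κ * (m * (n * n)) := by ring
      _ ≤ (κ + 1) * (m * (n * n)) := by gcongr; linarith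
      _ ≤ (κ + 1) * (12 * workList L) := by gcongr
      _ = _ := by ring
  · have h1 : ((m : ℝ) + 1) * (n + 1) ≤ (footprint L).card := by
      exact_mod_cast h.le_card_footprint
    rw [one_div_mul_eq_div, div_le_iff₀ hκ]
    calc (n : ℝ) ^ 2 = n * n := by ring
      _ ≤ κ * m * n := by gcongr
      _ ≤ (12 * (κ + 1)) * (m + 1) * (n + 1) := by
        gcongr <;> linarith [(κ.cast_nonneg : (0 : ℝ) ≤ κ)]
      _ = (m + 1) * (n + 1) * (12 * (κ + 1)) := by ring
      _ ≤ _ := by gcongr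

/-! ## The critical path without fire constructs -/

namespace Tree

variable {φ : Type}

/-- The number of strands on a critical path if all fire constructs are full dependencies. -/
def height : Tree φ → ℕ
  | leaf _ => 1
  | node .par a b => max a.height b.height
  | node _ a b => a.height + b.height

/-- The length of a longest path that ends at a strand, if all fire constructs are full
dependencies. -/
def level : Tree φ → List Bool → ℕ
  | leaf _, _ => 0
  | node _ _ _, [] => 0
  | node _ a _, false :: p => a.level p
  | node .par _ b, true :: p => b.level p
  | node _ a b, true :: p => a.height + b.level p

theorem level_lt_height {t : Tree φ} {x : List Bool} (hx : x ∈ t.strands) :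
    t.level x < t.height := by
  induction t generalizing x with
  | leaf L => simp [level, height]
  | node c a b iha ihb =>
    simp only [strands, List.mem_append, List.mem_map] at hx
    rcases hx with ⟨x, hx, rfl⟩ | ⟨x, hx, rfl⟩
    · have := iha hx
      cases c <;> simp only [level, height] <;> omega
    · have := ihb hx
      cases c <;> simp only [level, height] <;> omega

theorem level_lt_of_edge {R : FireRules Empty} {t : Tree Empty} {x y : List Bool}
    (h : Edge R t x y) : t.level x < t.level y := by
  induction h with
  | ser h =>
    cases h with
    | full hx hy => exact (level_lt_height hx).trans_le (Nat.le_add_right _ _)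
  | @fire f => exact f.elim
  | left _ ih => simpa only [level] using ih
  | @right c _ _ _ _ _ ih => cases c <;> simp only [level] <;> omega

theorem length_le_height {R : FireRules Empty} {t : Tree Empty} {l : List (List Bool)}
    (hl : ∀ x ∈ l, x ∈ t.strands) (hc : l.IsChain (Edge R t)) : l.length ≤ t.height := by
  have hlt : (l.map t.level).Pairwise (· < ·) := by
    rw [← List.isChain_iff_pairwise, List.isChain_map]
    exact hc.imp fun x y hxy => level_lt_of_edge hxy
  have hsub : (l.map t.level).toFinset ⊆ Finset.range t.height := by
    intro z hz
    rw [List.mem_toFinset, List.mem_map] at hz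
    obtain ⟨x, hx, rfl⟩ := hz
    exact Finset.mem_range.2 (level_lt_height (hl x hx))
  have := Finset.card_le_card hsub
  rwa [List.toFinset_card_of_nodup (hlt.imp ne_of_lt), List.length_map,
    Finset.card_range] at this

end Tree

namespace OTree

variable (f : Op → List (Assign ℕ))

theorem height_initTree {φ : Type} (k r c : ℕ) :
    ((initTree k r c : OTree φ).toTree f).height = 1 := by
  induction k generalizing r c with
  | zero => rfl
  | succ k ih => simp [initTree, toTree, Tree.height, ih]

theorem height_boxTree {φ : Type} (mk : ℕ → ℕ → ℕ → Op) (k r c d : ℕ) :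
    ((boxTree mk .ser k r c d : OTree φ).toTree f).height = 2 ^ k := by
  induction k generalizing r c d with
  | zero => rfl
  | succ k ih => simp only [boxTree, toTree, Tree.height, ih, max_self]; ring

/-- Counting the parallel part once, a triangle is a sequence of three triangles and three boxes of
half the side, so h(k + 1) = 3 h(k) + 3 · 2^k with h(0) = 1. -/
theorem height_triTree (k r c : ℕ) :
    ((triTree (Slots.serial : Slots Empty) k r c).toTree f).height + 3 * 2 ^ k = 4 * 3 ^ k := by
  induction k generalizing r c with
  | zero => rfl
  | succ k ih =>
    have key : ∀ r c, ((triTree (Slots.serial : Slots Empty) k r c).toTree f).height =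
        4 * 3 ^ k - 3 * 2 ^ k :=
      fun r c => by have := ih r c; omega
    have h := ih 0 0
    simp only [triTree, Slots.serial, toTree, Tree.height, height_boxTree] at key h ⊢
    simp only [key, max_self, pow_succ]
    rw [key] at h
    omega

theorem height_gapTree_le (K : ℕ) :
    ((gapTree (Slots.serial : Slots Empty) K).toTree f).height ≤ 4 * 3 ^ K := by
  have h := height_triTree f K 0 0
  have h2 : 1 ≤ 2 ^ K := Nat.one_le_two_pow
  have h3 := height_initTree (φ := Empty) f K 0 0
  simp only [gapTree, Slots.serial, toTree, Tree.height] at h h3 ⊢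
  omega

end OTree

/-- Time of the COP algorithm. -/
theorem exists_timeLE_serial (κ : ℕ) : ∃ C : ℝ, ∀ m n : ℕ, 2 ≤ n → m ≤ κ * n →
    ((OTree.gapTree Slots.serial (gapExp m n)).toTree (opCode m n)).TimeLE Empty.elim
      (C * (n : ℝ) ^ Real.logb 2 3) := by
  set c : ℝ := 2 * (κ + 1) with hc
  have hc0 : 0 ≤ c := by positivity
  refine ⟨28 * c ^ Real.logb 2 3, fun m n hn hm l hl hchain => ?_⟩
  have hN : ((2 : ℝ) ^ gapExp m n) ≤ c * n := by
    rw [hc]; exact_mod_cast two_pow_gapExp_le hn hm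
  have h1 := OTree.sum_strandCost_le m n _ hl
  have h2 := (Tree.length_le_height hl hchain).trans (OTree.height_gapTree_le _ _)
  have h3 : ((3 : ℝ) ^ gapExp m n) ≤ c ^ Real.logb 2 3 * (n : ℝ) ^ Real.logb 2 3 := by
    rw [← Real.mul_rpow hc0 n.cast_nonneg]
    -- A power of three with exponent `gapExp m n` is the side of the table raised to the power log₂
    -- 3.
    have e : ((3 : ℝ) ^ gapExp m n) = ((2 : ℝ) ^ gapExp m n) ^ Real.logb 2 3 := by
      rw [← Real.rpow_natCast_mul (by norm_num), mul_comm, Real.rpow_mul_natCast (by norm_num),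
        Real.rpow_logb (by norm_num) (by norm_num) (by norm_num)]
    rw [e]
    exact Real.rpow_le_rpow (by positivity) hN (Real.logb_nonneg (by norm_num) (by norm_num))
  have h4 := h1.trans (Nat.mul_le_mul_right 7 h2)
  calc _ ≤ ((4 * 3 ^ gapExp m n * 7 : ℕ) : ℝ) := by exact_mod_cast h4
    _ = 28 * (3 : ℝ) ^ gapExp m n := by push_cast; ring
    _ ≤ 28 * (c ^ Real.logb 2 3 * (n : ℝ) ^ Real.logb 2 3) := by gcongr
    _ = _ := by ring

end GapND

/-! ### The main theorem -/

theorem mainTheorem2 :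
    -- the Nested Dataflow algorithm
    (∃ (k : ℕ) (R : GapND.FireRules (Fin k)) (P : GapND.Program GapND.GapProc (Fin k)),
      P.erase = GapND.copGap ∧
      (∀ m n : ℕ, ∃ t : GapND.Tree (Fin k), P.Unfolds [m, n] t ∧
        t.RaceFree R ∧ t.Solves R m n (GapND.rowMajor n)) ∧
      ∀ κ τ : ℕ, ∃ C : ℝ, ∀ (m n : ℕ) (t : GapND.Tree (Fin k)),
        2 ≤ n → m ≤ κ * n → n ≤ κ * m → P.Unfolds [m, n] t →
        t.TimeLE R (C * ((n : ℝ) * Real.log n)) ∧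
        (t.work : ℝ) ≤ C * (n : ℝ) ^ 3 ∧
        (t.space : ℝ) ≤ C * (n : ℝ) ^ 2 ∧
        ∀ M B : ℕ, 1 ≤ B → B ≤ M → B ^ 2 ≤ τ * M →
          (M ≤ n ^ 2 →
            GapND.CacheMissesLE M B t.serial (C * ((n : ℝ) ^ 3 / ((B : ℝ) * √(M : ℝ))))) ∧
          (n ^ 2 < M →
            GapND.CacheMissesLE M B t.serial (C * ((n : ℝ) ^ 2 / (B : ℝ) + 1)))) ∧
    -- optimality of work and space among all serial straight-line `(min, +)` programs
    (∀ κ : ℕ, ∃ ε : ℝ, 0 < ε ∧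
      ∀ (m n : ℕ) (out : ℕ → ℕ → ℕ) (L : List (GapND.Assign ℕ)),
        2 ≤ n → m ≤ κ * n → n ≤ κ * m → GapND.SeriallySolves m n out L →
        ε * (n : ℝ) ^ 3 ≤ (GapND.workList L : ℝ) ∧
        ε * (n : ℝ) ^ 2 ≤ ((GapND.footprint L).card : ℝ)) ∧
    -- time of the algorithm that is refined
    (∀ κ : ℕ, ∃ C : ℝ, ∀ (m n : ℕ), 2 ≤ n → m ≤ κ * n → n ≤ κ * m →
      ∃ t : GapND.Tree Empty, GapND.copGap.Unfolds [m, n] t ∧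
        t.TimeLE Empty.elim (C * (n : ℝ) ^ Real.logb 2 3)) := by
  refine ⟨⟨14, GapND.Fire.rules, GapND.Fire.slots.program,
    GapND.Fire.slots.erase_program GapND.Fire.isSequential_slots,
    fun m n => ⟨_, (GapND.unfolds_iff _ m n _).2 rfl, GapND.raceFree_gapTree m n _,
      GapND.solves_gapTree m n⟩, fun κ τ => ?_⟩, GapND.exists_lower_bounds, fun κ => ?_⟩
  · obtain ⟨C, hC⟩ := GapND.exists_bounds κ τ
    refine ⟨C, fun m n t hn hm _ ht => ?_⟩
    obtain rfl := (GapND.unfolds_iff GapND.Fire.slots m n t).1 ht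
    exact hC m n hn hm
  · obtain ⟨C, hC⟩ := GapND.exists_timeLE_serial κ
    refine ⟨C, fun m n hn hm _ => ⟨_, ?_, hC m n hn hm⟩⟩
    rw [← GapND.Slots.program_serial]
    exact (GapND.unfolds_iff GapND.Slots.serial m n _).2 rfl
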